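/- Let $(B,\mathfrak n)$ be a commutative Noetherian local ring, let $x_1,\dots,x_c\in\mathfrak n$ be a $B$-regular sequence, and let $A=B/(x_1,\dots,x_c)$. All $A$-modules considered are finitely generated, and $M^*=\operatorname{Hom}_A(M,A)$. *Cohomology operators.* For an $A$-module $N$ choose a resolution $(F,d)$ of $N$ by free $A$-modules, lift it to free $B$-modules and $B$-linear maps $(\widetilde F,\widetilde d)$ with $\widetilde F\otimes_BA=F$ and $\widetilde d\otimes_B A=d$, and write $\widetilde d^{\,2}=\sum_{i=1}^c x_i\widetilde t_i$ with $\widetilde t_i$ of degree $-2$. The maps $t_i=\widetilde t_i\otimes_BA$ are chain maps $F\to\Sigma^2F$; let $\varphi_N(\chi_i)\in\operatorname{Ext}^2_A(N,N)$ be the class of $t_i$ (it does not depend on the choices, and these elements commute). They give the homomorphism of graded rings $$\varphi_N\colon H=A[\chi_1,\dots,\chi_c]\to\operatorname{Ext}_A(N,N)=\bigoplus_n\operatorname{Ext}_A^n(N,N),\qquad |\chi_i|=2,$$ through which the ring of cohomology operators $H$ acts centrally on $D^b(A)$. *Dualization.* An $A$-module $M$ has G-dimension zero if $M\to M^{**}$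 is an isomorphism and $\operatorname{Ext}^n_A(M,A)=0=\operatorname{Ext}^n_A(M^*,A)$ for all $n\ge1$. In that case $M$ is the image of the differential $C_0\to C_{-1}$ of a complete resolution $C$, that is, a complex of finitely generated free $A$-modules such that $C$ and $C^*=\operatorname{Hom}_A(C,A)$ are exact. Every $\theta\in\operatorname{Ext}_A^n(M,M)$ is the class of a chain map $f\colon C\to\Sigma^nC$. Let $C^*$ carry the transposed differentials, without additional signs, indexed so that $(C^*)_j=\operatorname{Hom}_A(C_{-1-j},A)$; it is a complete resolution of $M^*$, the transposes of the components of $f$ form a chain map $C^*\to\Sigma^nC^*$, and $\mathcal D(\theta)\in\operatorname{Ext}_A^n(M^*,M^*)$ denotes its class (it depends only on $\theta$). **Lemma.** Let $M$ be a finitely generated $A$-module with $\operatorname{depth}_AM=\operatorname{depth}_AA$ and $\operatorname{pd}_BM<\infty$. Then the central action of $H=A[\chi_1,\dots,\chi_c]$ on $D^b(A)$ commutes with dualization of $M$: the module $M$ has G-dimension zero, and $$\mathcal D(\varphi_M(\eta))=\varphi_{M^*}(\eta)\qquad\text{for every homogeneous }\eta\in H.$$ -/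

import Mathlib

open CategoryTheory CategoryTheory.Abelian CochainComplex.HomComplex

universe u

noncomputable section

namespace CohOp

/-! ### Depth, duals, Gorenstein dimension zero -/

/-- The depth of a module over a local ring: the supremum of the lengths of the
`M`-regular sequences contained in the maximal ideal. -/
def depth (A : Type u) [CommRing A] [IsLocalRing A] (M : Type u) [AddCommGroup M] [Module A M] :
    ℕ∞ :=
  ⨆ (rs : List A) (_ : RingTheory.Sequence.IsRegular M rs)
    (_ : ∀ r ∈ rs, r ∈ IsLocalRing.maximalIdeal A), (rs.length : ℕ∞)

section Dual

variable {A : Type u} [CommRing A]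

/-- The dual module `M^* = Hom_A(M, A)`. -/
abbrev dual (M : ModuleCat.{u} A) : ModuleCat.{u} A := ModuleCat.of A (M →ₗ[A] A)

/-- The transpose of a linear map. -/
def dualMap {M N : ModuleCat.{u} A} (f : M ⟶ N) : dual N ⟶ dual M :=
  ModuleCat.ofHom (LinearMap.lcomp A A f.hom)

lemma dualMap_comp {M N P : ModuleCat.{u} A} (f : M ⟶ N) (g : N ⟶ P) :
    dualMap (f ≫ g) = dualMap g ≫ dualMap f := rfl

lemma dualMap_zero {M N : ModuleCat.{u} A} : dualMap (0 : M ⟶ N) = 0 := by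
  exact ModuleCat.hom_ext (LinearMap.ext fun g => LinearMap.ext fun _ => map_zero g)

lemma dualMap_add {M N : ModuleCat.{u} A} (f g : M ⟶ N) :
    dualMap (f + g) = dualMap f + dualMap g := by
  exact ModuleCat.hom_ext (LinearMap.ext fun h => LinearMap.ext fun _ => map_add h _ _)

lemma dualMap_units_smul {M N : ModuleCat.{u} A} (e : ℤˣ) (f : M ⟶ N) :
    dualMap (e • f) = e • dualMap f := by
  rcases Int.units_eq_one_or e with rfl | rfl
  · simp
  · rw [Units.neg_smul, one_smul, Units.neg_smul, one_smul]
    exact ModuleCat.hom_ext (LinearMap.ext fun h => LinearMap.ext fun _ => map_neg h _)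

/-- `M` has Gorenstein dimension zero (is totally reflexive): `M` is reflexive and
`Ext^n(M, A) = 0 = Ext^n(M^*, A)` for all `n ≥ 1`. -/
def GDimZero (M : ModuleCat.{u} A) : Prop :=
  Module.IsReflexive A M ∧
    ∀ n : ℕ, 1 ≤ n → Subsingleton (Ext M (ModuleCat.of A A) n) ∧
      Subsingleton (Ext (dual M) (ModuleCat.of A A) n)

/-- The dual complex, reindexed so that `(C^*)^p = Hom_A(C^{1-p}, A)`, with the transposed
differentials (no signs). -/
def dualComplex (C : CochainComplex (ModuleCat.{u} A) ℤ) : CochainComplex (ModuleCat.{u} A) ℤ where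
  X p := dual (C.X (1 - p))
  d p q := dualMap (C.d (1 - q) (1 - p))
  shape p q h := by
    rw [C.shape _ _ (by simp only [ComplexShape.up_Rel] at h ⊢; omega), dualMap_zero]
  d_comp_d' p q r _ _ := by rw [← dualMap_comp, C.d_comp_d, dualMap_zero]

/-- A chain map `C → Σⁿ C` is a cocycle of degree `n`: a family `f` of maps
`C^p → C^{p+n}` with `f ≫ d = (-1)^n d ≫ f`. Its transpose is a chain map `C^* → Σⁿ C^*`. -/
def dualCocycle {C : CochainComplex (ModuleCat.{u} A) ℤ} {n : ℤ} (f : Cocycle C C n) :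
    Cocycle (dualComplex C) (dualComplex C) n :=
  Cocycle.mk
    (Cochain.mk fun p q hpq => dualMap (f.1.v (1 - q) (1 - p) (by omega))) (n + 1) rfl (by
      ext p q hpq : 1
      have h := Cochain.congr_v (f.δ_eq_zero (n + 1)) (1 - q) (1 - p) (by omega)
      rw [δ_v n (n + 1) rfl f.1 (1 - q) (1 - p) (by omega) (1 - (p + 1)) (1 - (q - 1))
        (by omega) (by omega), Cochain.zero_v] at h
      have h2 := congrArg dualMap h
      rw [dualMap_add, dualMap_units_smul, dualMap_comp, dualMap_comp, dualMap_zero] at h2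
      rw [δ_v n (n + 1) rfl _ p q hpq (q - 1) (p + 1) (by omega) (by omega), Cochain.zero_v]
      change dualMap _ ≫ dualMap _ + (n + 1).negOnePow • (dualMap _ ≫ dualMap _) = 0
      have h3 := congrArg ((n + 1).negOnePow • ·) h2
      simp only [smul_add, smul_smul, smul_zero, Int.units_mul_self, one_smul] at h3
      exact (add_comm _ _).trans h3)

end Dual

/-! ### Complete resolutions and the dualization of `Ext` classes -/

section Resolutions

variable {A : Type u} [CommRing A]

/-- The projective resolution given by an exact complex of projectives with an augmentation. -/
def mkResolution {M : ModuleCat.{u} A} (K : ChainComplex (ModuleCat.{u} A) ℕ)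
    (hproj : ∀ n, Projective (K.X n)) (hex : ∀ n, K.ExactAt (n + 1)) (ε : K.X 0 ⟶ M)
    (hε : Function.Surjective ε.hom)
    (hker : ∀ y : K.X 0, ε.hom y = 0 ↔ ∃ z, (K.d 1 0).hom z = y) : ProjectiveResolution M where
  complex := K
  projective := hproj
  π := (ChainComplex.toSingle₀Equiv _ _).symm ⟨ε, by
    ext z
    exact (hker _).2 ⟨z, rfl⟩⟩
  quasiIso := ⟨fun n => by
    cases n with
    | zero =>
      rw [ChainComplex.quasiIsoAt₀_iff, ShortComplex.quasiIso_iff_of_zeros']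
      · refine (ShortComplex.exact_and_epi_g_iff_of_iso (S₂ := ShortComplex.mk (K.d 1 0) ε (by
          ext z
          exact (hker _).2 ⟨z, rfl⟩)) ?_).2 ⟨?_, (ModuleCat.epi_iff_surjective _).2 hε⟩
        · exact ShortComplex.isoMk (Iso.refl _) (Iso.refl _) (Iso.refl _) (by simp; rfl)
            (by simp; rfl)
        · exact (ShortComplex.moduleCat_exact_iff _).2 fun y hy => (hker y).1 hy
      · exact K.shape _ _ (by simp)
      all_goals rfl
    | succ n =>
      rw [quasiIsoAt_iff_exactAt']
      · exact hex n
      · exact ChainComplex.exactAt_succ_single_obj _ _⟩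

/-- A complex of projectives, indexed by `ℤ`, whose part in degrees `≤ 0` is a projective
resolution of `M` with augmentation `ε`. -/
structure Augmentation (K : CochainComplex (ModuleCat.{u} A) ℤ) (M : ModuleCat.{u} A) where
  projective : ∀ p, Projective (K.X p)
  exactAt : ∀ p < 0, K.ExactAt p
  ε : K.X 0 ⟶ M
  surjective : Function.Surjective ε.hom
  ker : ∀ y : K.X 0, ε.hom y = 0 ↔ ∃ z, (K.d (-1) 0).hom z = y

namespace Augmentation

variable {K : CochainComplex (ModuleCat.{u} A) ℤ} {M : ModuleCat.{u} A}

/-- The projective resolution `⋯ → K^{-2} → K^{-1} → K^0 → M → 0`. -/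
def resolution (a : Augmentation K M) : ProjectiveResolution M :=
  mkResolution (K.restriction ComplexShape.embeddingDownNat) (fun n => a.projective _)
    (fun n => by
      rw [HomologicalComplex.exactAt_iff' _ (n + 2) (n + 1) n (by simp) (by simp)]
      have h := a.exactAt (-((n + 1 : ℕ) : ℤ)) (by omega)
      rw [HomologicalComplex.exactAt_iff' _ (-((n + 2 : ℕ) : ℤ)) (-((n + 1 : ℕ) : ℤ)) (-(n : ℤ))
        (by simp; omega) (by simp)] at h
      exact h)
    a.ε a.surjective a.ker

/-- The class in `Ext^n(M, M)` of a chain map `f : K → Σⁿ K`: it is the class of the cocycle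
`K^{-n} → K^0 → M` on the resolution of `M`. -/
def cls (a : Augmentation K M) {n : ℕ} (f : Cocycle K K n) : Ext M M n :=
  a.resolution.extMk (f.1.v (-(n : ℤ)) 0 (by omega) ≫ a.ε) (n + 1) rfl (by
    have h := Cochain.congr_v (f.δ_eq_zero ((n : ℤ) + 1)) (-((n + 1 : ℕ) : ℤ)) 0 (by omega)
    rw [δ_v (n : ℤ) (n + 1) rfl f.1 (-((n + 1 : ℕ) : ℤ)) 0 (by omega) (-1) (-(n : ℤ))
      (by omega) (by omega), Cochain.zero_v] at h
    have h0 : K.d (-1) 0 ≫ a.ε = 0 := by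
      ext z
      exact (a.ker _).2 ⟨z, rfl⟩
    have h1 := congrArg (((n : ℤ) + 1).negOnePow • · ≫ a.ε) h
    simp only [Preadditive.add_comp, Category.assoc, h0, smul_smul, Linear.units_smul_comp,
      Int.units_mul_self, one_smul, Limits.comp_zero, smul_zero, zero_add, Limits.zero_comp] at h1
    exact h1)

end Augmentation

lemma exists_of_exactAt (K : CochainComplex (ModuleCat.{u} A) ℤ) (p q r : ℤ) (hpq : p + 1 = q)
    (hqr : q + 1 = r) (h : K.ExactAt q) (y : K.X q) (hy : (K.d q r).hom y = 0) :
    ∃ z, (K.d p q).hom z = y := by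
  rw [HomologicalComplex.exactAt_iff' K p q r (by simp; omega) (by simp; omega)] at h
  exact (ShortComplex.moduleCat_exact_iff _).1 h y hy

lemma d_d_apply (K : CochainComplex (ModuleCat.{u} A) ℤ) (p q r : ℤ) (z : K.X p) :
    (K.d q r).hom ((K.d p q).hom z) = 0 := by
  have h := congrArg (fun f => f.hom z) (K.d_comp_d p q r)
  exact h

/-- A complete resolution of `M`: a totally acyclic complex `C` of finitely generated free
modules (both `C` and `Hom_A(C, A)` are exact) together with an isomorphism of `M` with the image
of the differential `C^0 → C^1`, given by a factorization `C^0 ↠ M ↪ C^1`.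
In homological indexing `C^p` is `C_{-p}`, and the differential is `C_0 → C_{-1}`. -/
structure CompleteResolution (M : ModuleCat.{u} A) where
  C : CochainComplex (ModuleCat.{u} A) ℤ
  free : ∀ p, Module.Free A (C.X p)
  finite : ∀ p, Module.Finite A (C.X p)
  exact : ∀ p, C.ExactAt p
  dual_exact : ∀ p, (dualComplex C).ExactAt p
  ε : C.X 0 ⟶ M
  ι : M ⟶ C.X 1
  fac : ε ≫ ι = C.d 0 1
  surjective : Function.Surjective ε.hom
  injective : Function.Injective ι.hom

namespace CompleteResolution

variable {M : ModuleCat.{u} A}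

lemma fac_apply (R : CompleteResolution M) (y : R.C.X 0) :
    R.ι.hom (R.ε.hom y) = (R.C.d 0 1).hom y := by
  rw [← R.fac]; rfl

lemma ε_d (R : CompleteResolution M) (p : ℤ) (z : R.C.X p) : R.ε.hom ((R.C.d p 0).hom z) = 0 := by
  apply R.injective
  rw [fac_apply, d_d_apply, map_zero]

/-- The nonpositive half of a complete resolution of `M` resolves `M`. -/
def left (R : CompleteResolution M) : Augmentation R.C M where
  projective p := by
    have := R.free p
    exact ModuleCat.projective_of_free (Module.Free.chooseBasis A (R.C.X p))
  exactAt p _ := R.exact p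
  ε := R.ε
  surjective := R.surjective
  ker y := by
    constructor
    · intro h
      exact exists_of_exactAt R.C (-1) 0 1 rfl rfl (R.exact 0) y (by rw [← R.fac_apply, h, map_zero])
    · rintro ⟨z, rfl⟩
      exact R.ε_d _ z

/-- The nonpositive half of the dual of a complete resolution of `M` resolves `M^*`; the
augmentation `Hom_A(C^1, A) → M^*` is the restriction along `M ↪ C^1`. -/
def right (R : CompleteResolution M) : Augmentation (dualComplex R.C) (dual M) where
  projective p := by
    have := R.free (1 - p)
    have := R.finite (1 - p)
    exact ModuleCat.projective_of_free
      (Module.Free.chooseBasis A (Module.Dual A (R.C.X (1 - p))))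
  exactAt p _ := R.dual_exact p
  ε := dualMap R.ι
  surjective g := by
    obtain ⟨h, hh⟩ := exists_of_exactAt (dualComplex R.C) 0 1 2 rfl rfl (R.dual_exact 1)
      ((dualMap R.ε).hom g) (LinearMap.ext fun z => by
        exact (congrArg (show M →ₗ[A] A from g) (R.ε_d (1 - 2) z)).trans
          (map_zero (show M →ₗ[A] A from g)))
    refine ⟨h, LinearMap.ext fun m => ?_⟩
    obtain ⟨y, rfl⟩ := R.surjective m
    let h1 : R.C.X 1 →ₗ[A] A := h
    have h2 : h1 ((R.C.d 0 1).hom y) = g (R.ε.hom y) := LinearMap.congr_fun hh y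
    rw [← R.fac_apply] at h2
    exact h2
  ker y := by
    constructor
    · intro h
      refine exists_of_exactAt (dualComplex R.C) (-1) 0 1 rfl rfl (R.dual_exact 0) y
        (LinearMap.ext fun z => ?_)
      let y1 : R.C.X 1 →ₗ[A] A := y
      change y1 ((R.C.d 0 1).hom z) = 0
      rw [← R.fac_apply]
      exact LinearMap.congr_fun h (R.ε.hom z)
    · rintro ⟨z, rfl⟩
      refine LinearMap.ext fun m => ?_
      obtain ⟨y, rfl⟩ := R.surjective m
      let z1 : R.C.X 2 →ₗ[A] A := z
      change z1 ((R.C.d 1 2).hom (R.ι.hom (R.ε.hom y))) = 0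
      rw [R.fac_apply, d_d_apply, map_zero]

end CompleteResolution

/-- `Ext_A(M, M) = ⊕ₙ Ext_A^n(M, M)`. -/
abbrev GradedExt (M : ModuleCat.{u} A) : Type u := DirectSum ℕ fun n => Ext M M n

/-- `IsDualization θ θ'` says that `θ' = D(θ)`, where `D : Ext_A^n(M, M) → Ext_A^n(M^*, M^*)`
is the dualization map: `θ` is the class of some chain map `f : C → Σⁿ C` on a complete
resolution `C` of `M`, and for every complete resolution `C` and every chain map
`f : C → Σⁿ C` with class `θ` the class of the transposed chain map `C^* → Σⁿ C^*` is `θ'`. -/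
def IsDualization {M : ModuleCat.{u} A} {n : ℕ} (θ : Ext M M n) (θ' : Ext (dual M) (dual M) n) :
    Prop :=
  (∃ (R : CompleteResolution M) (f : Cocycle R.C R.C n), R.left.cls f = θ) ∧
    ∀ (R : CompleteResolution M) (f : Cocycle R.C R.C n), R.left.cls f = θ →
      R.right.cls (dualCocycle f) = θ'

end Resolutions

/-! ### Cohomology operators -/

section Operators

variable {B A : Type u} [CommRing B] [CommRing A] [Algebra B A] {c : ℕ}

/-- A lifting to `B` of a complex `F` of free `A`-modules, where `A = B/(x₁, …, x_c)`:
free `B`-modules `F̃ₙ` with `F̃ₙ / (x) F̃ₙ = Fₙ`, maps `d̃` lifting the differentials, and a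
decomposition `d̃² = ∑ xᵢ t̃ᵢ`; moreover `tᵢ` is the reduction of `t̃ᵢ` to `A`. -/
structure Lifting (x : Fin c → B) (F : ChainComplex (ModuleCat.{u} A) ℕ) where
  L : ℕ → ModuleCat.{u} B
  free : ∀ n, Module.Free B (L n)
  proj : ∀ n, L n →ₛₗ[algebraMap B A] F.X n
  proj_surjective : ∀ n, Function.Surjective (proj n)
  proj_eq_zero_iff : ∀ n (y : L n),
    proj n y = 0 ↔ y ∈ Ideal.span (Set.range x) • (⊤ : Submodule B (L n))
  d : ∀ n, L (n + 1) →ₗ[B] L n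
  proj_d : ∀ n (y : L (n + 1)), proj n (d n y) = (F.d (n + 1) n).hom (proj (n + 1) y)
  tl : ∀ (_ : Fin c) n, L (n + 2) →ₗ[B] L n
  d_d : ∀ n (y : L (n + 2)), d n (d (n + 1) y) = ∑ i, x i • tl i n y
  t : ∀ (_ : Fin c) n, F.X (n + 2) ⟶ F.X n
  t_proj : ∀ i n (y : L (n + 2)), (t i n).hom (proj (n + 2) y) = proj n (tl i n y)

lemma exists_of_mem_smul_top {N : Type u} [AddCommGroup N] [Module B N] (x : Fin c → B) (y : N)
    (hy : y ∈ Ideal.span (Set.range x) • (⊤ : Submodule B N)) : ∃ z : Fin c → N, y = ∑ i, x i • z i := by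
  induction hy using Submodule.smul_induction_on' with
  | smul r hr n _ =>
    obtain ⟨a, rfl⟩ := (Ideal.mem_span_range_iff_exists_fun).1 hr
    exact ⟨fun i => a i • n, by simp only [Finset.sum_smul, smul_smul, mul_comm]⟩
  | add y _ y' _ h h' =>
    obtain ⟨z, rfl⟩ := h
    obtain ⟨z', rfl⟩ := h'
    exact ⟨z + z', by simp [smul_add, Finset.sum_add_distrib]⟩

lemma mem_of_sum_eq_zero_aux {N : Type u} [AddCommGroup N] [Module B N] (c : ℕ) (x : Fin c → B)
    (h : ∀ (k : Fin c) (m : N),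
      x k • m ∈ Ideal.span (x '' {j | j < k}) • (⊤ : Submodule B N) →
        m ∈ Ideal.span (x '' {j | j < k}) • (⊤ : Submodule B N))
    (b : Fin c → N) (hb : ∑ i, x i • b i = 0) (i : Fin c) :
    b i ∈ Ideal.span (Set.range x) • (⊤ : Submodule B N) := by
  induction c with
  | zero => exact i.elim0
  | succ c ih =>
    have hlast : x '' {j | j < Fin.last c} = Set.range (x ∘ Fin.castSucc) := by
      ext r
      constructor
      · rintro ⟨j, hj, rfl⟩
        exact ⟨j.castLT hj, rfl⟩
      · rintro ⟨j, rfl⟩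
        exact ⟨j.castSucc, Fin.castSucc_lt_last j, rfl⟩
    have hle : Ideal.span (Set.range (x ∘ Fin.castSucc)) ≤ Ideal.span (Set.range x) :=
      Ideal.span_mono (Set.range_comp_subset_range _ _)
    rw [Fin.sum_univ_castSucc] at hb
    have hm : b (Fin.last c) ∈
        Ideal.span (Set.range (x ∘ Fin.castSucc)) • (⊤ : Submodule B N) := by
      rw [← hlast]
      apply h
      rw [hlast, eq_neg_of_add_eq_zero_right hb]
      exact Submodule.neg_mem _ (Submodule.sum_mem _ fun j _ =>
        Submodule.smul_mem_smul (Ideal.subset_span ⟨j, rfl⟩) trivial)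
    induction i using Fin.lastCases with
    | last => exact Submodule.smul_mono_left hle hm
    | cast i =>
      obtain ⟨e, he⟩ := exists_of_mem_smul_top _ _ hm
      have key := ih (x ∘ Fin.castSucc) (fun k m hkm => by
          have hk : (x ∘ Fin.castSucc) '' {j | j < k} = x '' {j | j < k.castSucc} := by
            ext r
            constructor
            · rintro ⟨j, hj, rfl⟩
              exact ⟨j.castSucc, hj, rfl⟩
            · rintro ⟨j, hj, rfl⟩
              exact ⟨j.castLT (lt_trans hj (Fin.castSucc_lt_last k)), hj, rfl⟩
          rw [hk] at hkm ⊢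
          exact h _ _ hkm)
        (fun j => b j.castSucc + x (Fin.last c) • e j) (by
          rw [he, Finset.smul_sum, ← Finset.sum_add_distrib] at hb
          rw [← hb]
          refine Finset.sum_congr rfl fun j _ => ?_
          simp only [Function.comp, smul_add, smul_smul, mul_comm]) i
      have h1 := Submodule.smul_mono_left (N := (⊤ : Submodule B N)) hle key
      have h2 : x (Fin.last c) • e i ∈ Ideal.span (Set.range x) • (⊤ : Submodule B N) :=
        Submodule.smul_mem_smul (Ideal.subset_span ⟨_, rfl⟩) trivial
      simpa using Submodule.sub_mem _ h1 h2

/-- A relation `∑ xᵢ bᵢ = 0` on a regular sequence has all its coefficients in `(x) N`. -/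
lemma mem_of_sum_eq_zero {N : Type u} [AddCommGroup N] [Module B N] (x : Fin c → B)
    (h : RingTheory.Sequence.IsWeaklyRegular N (List.ofFn x)) (b : Fin c → N)
    (hb : ∑ i, x i • b i = 0) (i : Fin c) :
    b i ∈ Ideal.span (Set.range x) • (⊤ : Submodule B N) := by
  refine mem_of_sum_eq_zero_aux c x (fun k m hm => ?_) b hb i
  have hI : Ideal.ofList ((List.ofFn x).take k) = Ideal.span (x '' {j | j < k}) := by
    refine congrArg Ideal.span (Set.ext fun r => ?_)
    simp only [Set.mem_ofPred_eq, List.mem_take_iff_getElem, Set.mem_image, List.length_ofFn,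
      List.getElem_ofFn]
    constructor
    · rintro ⟨j, hj, rfl⟩
      exact ⟨⟨j, by omega⟩, by simpa [Fin.lt_def] using (lt_min_iff.1 hj).1, rfl⟩
    · rintro ⟨j, hj, rfl⟩
      exact ⟨j, lt_min hj j.2, rfl⟩
  have hreg := h.regular_mod_prev k (by simp)
  rw [hI, List.getElem_ofFn] at hreg
  have := (hreg (a₁ := Submodule.Quotient.mk m) (a₂ := 0)) (by
    simp only [smul_zero]
    rw [← Submodule.Quotient.mk_smul]
    exact (Submodule.Quotient.mk_eq_zero _).2 hm)
  exact (Submodule.Quotient.mk_eq_zero _).1 this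

lemma mem_of_sum_eq_zero_free {N : Type u} [AddCommGroup N] [Module B N] [Module.Free B N]
    (x : Fin c → B) (h : RingTheory.Sequence.IsWeaklyRegular B (List.ofFn x)) (b : Fin c → N)
    (hb : ∑ i, x i • b i = 0) (i : Fin c) :
    b i ∈ Ideal.span (Set.range x) • (⊤ : Submodule B N) := by
  let e := Module.Free.chooseBasis B N
  rw [← e.linearCombination_repr (b i)]
  refine Submodule.sum_mem _ fun j _ => Submodule.smul_mem_smul ?_ trivial
  have := mem_of_sum_eq_zero x h (fun i => e.repr (b i) j) (by
    have h1 := congrArg (fun y => e.repr y j) hb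
    simpa using h1) i
  simpa using this

/-- The `tᵢ` commute with the differentials. -/
lemma Lifting.t_comm {x : Fin c → B} (hx : RingTheory.Sequence.IsRegular B (List.ofFn x))
    {F : ChainComplex (ModuleCat.{u} A) ℕ} (E : Lifting x F) (i : Fin c) (n : ℕ) :
    F.d (n + 3) (n + 2) ≫ E.t i n = E.t i (n + 1) ≫ F.d (n + 1) n := by
  have := E.free n
  ext z
  obtain ⟨y, rfl⟩ := E.proj_surjective (n + 3) z
  change (E.t i n).hom ((F.d (n + 3) (n + 2)).hom (E.proj (n + 3) y)) =
    (F.d (n + 1) n).hom ((E.t i (n + 1)).hom (E.proj (n + 3) y))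
  have h1 := E.proj_d (n + 2) y
  have h2 := E.t_proj i (n + 1) y
  rw [← h1, E.t_proj, h2, ← E.proj_d, ← sub_eq_zero, ← map_sub, E.proj_eq_zero_iff]
  refine mem_of_sum_eq_zero_free x hx.toIsWeaklyRegular
    (fun i => E.tl i n (E.d (n + 2) y) - E.d n (E.tl i (n + 1) y)) ?_ i
  simp only [smul_sub, Finset.sum_sub_distrib]
  rw [← E.d_d, sub_eq_zero]
  have h3 := congrArg (E.d n) (E.d_d (n + 1) y)
  rw [map_sum] at h3
  simpa only [map_smul] using h3

/-- Every complex of free `A`-modules has a lifting. -/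
theorem nonempty_lifting (x : Fin c → B) (hs : Function.Surjective (algebraMap B A))
    (hk : RingHom.ker (algebraMap B A) = Ideal.span (Set.range x))
    (F : ChainComplex (ModuleCat.{u} A) ℕ) (hF : ∀ n, Module.Free A (F.X n)) :
    Nonempty (Lifting x F) := by
  let J (n : ℕ) : Type u := Module.Free.ChooseBasisIndex A (F.X n)
  let e (n : ℕ) : Module.Basis (J n) A (F.X n) := Module.Free.chooseBasis A (F.X n)
  let pr (n : ℕ) : (J n →₀ B) →ₛₗ[algebraMap B A] F.X n :=
    { toFun := fun y => (e n).repr.symm (y.mapRange (algebraMap B A) (map_zero _))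
      map_add' := fun y y' => by
        rw [← map_add]
        congr 1
        ext j
        simp
      map_smul' := fun b y => by
        rw [← map_smul]
        congr 1
        ext j
        simp [Algebra.smul_def] }
  have pr_single (n : ℕ) (j : J n) : pr n (Finsupp.single j 1) = e n j := by
    change (e n).repr.symm _ = _
    rw [Finsupp.mapRange_single, map_one, Module.Basis.repr_symm_single_one]
  have pr_surj (n : ℕ) : Function.Surjective (pr n) :=
    (e n).repr.symm.surjective.comp (Finsupp.mapRange_surjective _ (map_zero _) hs)
  have pr_zero (n : ℕ) (y : J n →₀ B) :
      pr n y = 0 ↔ y ∈ Ideal.span (Set.range x) • (⊤ : Submodule B (J n →₀ B)) := by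
    constructor
    · intro h
      have h1 : y.mapRange (algebraMap B A) (map_zero _) = 0 :=
        (e n).repr.symm.injective (h.trans (map_zero _).symm)
      rw [← y.sum_single]
      refine Submodule.sum_mem _ fun j _ => ?_
      have h2 : Finsupp.single j (y j) = y j • Finsupp.single j (1 : B) := by simp
      rw [h2]
      refine Submodule.smul_mem_smul ?_ trivial
      rw [← hk]
      simpa using DFunLike.congr_fun h1 j
    · intro h
      induction h using Submodule.smul_induction_on' with
      | smul r hr z _ =>
        rw [← hk] at hr
        rw [LinearMap.map_smulₛₗ, (RingHom.mem_ker).1 hr, zero_smul]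
      | add y _ y' _ h h' => rw [map_add, h, h', add_zero]
  have pr_ext (n : ℕ) (N : ModuleCat.{u} A) (f g : (J n →₀ B) →ₛₗ[algebraMap B A] N)
      (h : ∀ j, f (Finsupp.single j 1) = g (Finsupp.single j 1)) : f = g := by
    refine LinearMap.ext fun y => ?_
    induction y using Finsupp.induction_linear with
    | zero => rw [map_zero, map_zero]
    | add y y' h h' => rw [map_add, map_add, h, h']
    | single j b =>
      have h2 : Finsupp.single j b = b • Finsupp.single j (1 : B) := by simp
      rw [h2, LinearMap.map_smulₛₗ, LinearMap.map_smulₛₗ, h]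
  choose s hs' using pr_surj
  let d (n : ℕ) : (J (n + 1) →₀ B) →ₗ[B] (J n →₀ B) :=
    Finsupp.linearCombination B fun j => s n ((F.d (n + 1) n).hom (e (n + 1) j))
  have pr_d (n : ℕ) (y : J (n + 1) →₀ B) :
      pr n (d n y) = (F.d (n + 1) n).hom (pr (n + 1) y) := by
    refine LinearMap.congr_fun (pr_ext (n + 1) (F.X n) ((pr n).comp (d n))
      ((F.d (n + 1) n).hom.comp (pr (n + 1))) fun j => ?_) y
    change pr n (Finsupp.linearCombination B _ _) = (F.d (n + 1) n).hom (pr (n + 1) _)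
    rw [Finsupp.linearCombination_single, one_smul, hs', pr_single]
  have dd (n : ℕ) (j : J (n + 2)) : ∃ z : Fin c → (J n →₀ B),
      d n (d (n + 1) (Finsupp.single j 1)) = ∑ i, x i • z i := by
    refine exists_of_mem_smul_top _ _ ((pr_zero n _).1 ?_)
    rw [pr_d, pr_d]
    have h := congrArg (fun f => f.hom (pr (n + 2) (Finsupp.single j 1)))
      (F.d_comp_d (n + 2) (n + 1) n)
    exact h
  choose z hz using dd
  let tl (i : Fin c) (n : ℕ) : (J (n + 2) →₀ B) →ₗ[B] (J n →₀ B) :=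
    Finsupp.linearCombination B fun j => z n j i
  let t (i : Fin c) (n : ℕ) : F.X (n + 2) ⟶ F.X n :=
    ModuleCat.ofHom ((e (n + 2)).constr ℕ fun j => pr n (z n j i))
  refine ⟨⟨fun n => ModuleCat.of B (J n →₀ B), fun n => inferInstance, pr, fun n z => ⟨s n z, hs' n z⟩,
    pr_zero, d, pr_d, tl, fun n y => ?_, t, fun i n y => ?_⟩⟩
  · have : (d n).comp (d (n + 1)) = ∑ i, x i • tl i n := by
      refine Finsupp.lhom_ext' fun j => LinearMap.ext_ring ?_
      simp [hz, tl]
    simpa using LinearMap.congr_fun this y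
  · refine LinearMap.congr_fun (pr_ext (n + 2) (F.X n) ((t i n).hom.comp (pr (n + 2)))
      ((pr n).comp (tl i n)) fun j => ?_) y
    change (e (n + 2)).constr ℕ _ (pr (n + 2) _) = pr n (Finsupp.linearCombination B _ _)
    rw [Finsupp.linearCombination_single, one_smul, pr_single, Module.Basis.constr_basis]

/-- Every module has a free resolution. -/
theorem exists_free_resolution (M : ModuleCat.{u} A) :
    ∃ P : ProjectiveResolution M, ∀ n, Module.Free A (P.complex.X n) := by
  have hepi (N : ModuleCat.{u} A) : Epi ((ModuleCat.adj A).counit.app N) :=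
    inferInstance
  let Λ : LeftResolution (𝟭 (ModuleCat.{u} A)) :=
    { F := forget _ ⋙ ModuleCat.free A
      π := (ModuleCat.adj A).counit
      epi_π_app := hepi }
  have hfree0 (X : Type u) : Module.Free A ((ModuleCat.free A).obj X) :=
    inferInstanceAs (Module.Free A (X →₀ A))
  have hF (N : ModuleCat.{u} A) : Module.Free A (Λ.F.obj N) := hfree0 N
  have hfree (n : ℕ) : Module.Free A ((Λ.chainComplex M).X n) := by
    obtain _ | _ | n := n
    · exact Module.Free.of_equiv (Λ.chainComplexXZeroIso M).symm.toLinearEquiv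
    · exact Module.Free.of_equiv (Λ.chainComplexXOneIso M).symm.toLinearEquiv
    · exact Module.Free.of_equiv (Λ.chainComplexXIso M n).symm.toLinearEquiv
  have hd : (Λ.chainComplex M).d 1 0 = (Λ.chainComplexXOneIso M).hom ≫
      Λ.π.app (Limits.kernel (Λ.π.app M)) ≫ Limits.kernel.ι _ ≫ (Λ.chainComplexXZeroIso M).inv :=
    Λ.map_chainComplex_d_1_0 M
  refine ⟨mkResolution (Λ.chainComplex M)
    (fun n => ModuleCat.projective_of_free (Module.Free.chooseBasis A _))
    (fun n => Λ.exactAt_map_chainComplex_succ M n)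
    ((Λ.chainComplexXZeroIso M).hom ≫ Λ.π.app M) ?_ ?_, hfree⟩
  · exact (ModuleCat.epi_iff_surjective _).1 (epi_comp _ _)
  · intro y
    constructor
    · intro hy
      obtain ⟨w, hw⟩ := (ShortComplex.moduleCat_exact_iff _).1
        (ShortComplex.exact_kernel (Λ.π.app M)) ((Λ.chainComplexXZeroIso M).hom.hom y) hy
      obtain ⟨v, rfl⟩ := (ModuleCat.epi_iff_surjective _).1 (Λ.epi_π_app _) w
      refine ⟨(Λ.chainComplexXOneIso M).inv.hom v, ?_⟩
      have h1 : (Λ.chainComplexXOneIso M).inv ≫ (Λ.chainComplex M).d 1 0 =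
          (Λ.π.app (Limits.kernel (Λ.π.app M)) ≫ Limits.kernel.ι (Λ.π.app M)) ≫
            (Λ.chainComplexXZeroIso M).inv := by
        rw [hd]
        simp
      refine (congrArg (fun f => f.hom v) h1).trans ?_
      refine (congrArg (Λ.chainComplexXZeroIso M).inv.hom hw).trans ?_
      exact congrArg (fun f => f.hom y) (Λ.chainComplexXZeroIso M).hom_inv_id
    · rintro ⟨z, rfl⟩
      have h : (Λ.chainComplex M).d 1 0 ≫ (Λ.chainComplexXZeroIso M).hom ≫ Λ.π.app M = 0 := by
        rw [hd]
        simp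
      exact congrArg (fun f => f.hom z) h

/-- The element `φ_M(χᵢ)` of `Ext_A^2(M, M)`: the class of the chain map `tᵢ : P → Σ² P`, i.e. of
the cocycle `P₂ → P₀ → M`. -/
def operator {x : Fin c → B} (hx : RingTheory.Sequence.IsRegular B (List.ofFn x))
    {M : ModuleCat.{u} A} (P : ProjectiveResolution M) (E : Lifting x P.complex) (i : Fin c) :
    Ext M M 2 :=
  P.extMk (E.t i 0 ≫ P.π.f 0) 3 rfl (by
    have h : (P.complex.d 3 2 ≫ E.t i 0) ≫ P.π.f 0 = 0 := by
      rw [E.t_comm hx i 0, Category.assoc, P.complex_d_comp_π_f_zero, Limits.comp_zero]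
    exact (Category.assoc _ _ _).symm.trans h)

/-- The product of a list of elements of `Ext_A^2(M, M)`. -/
def word {M : ModuleCat.{u} A} (χ : Fin c → Ext M M 2) : (w : List (Fin c)) → Ext M M (2 * w.length)
  | [] => Ext.mk₀ (𝟙 M)
  | i :: w => (χ i).comp (word χ w) (by simp only [List.length_cons]; ring)

/-- The extension of `χᵢ ↦ e i ∈ Ext_A^2(M, M)` to the polynomial ring `A[χ₁, …, χ_c]`: a monomial
`a χ₁^{α₁} ⋯ χ_c^{α_c}` goes to `a e₁^{α₁} ⋯ e_c^{α_c}` in `Ext_A^{2|α|}(M, M)`. -/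
def polyAction {M : ModuleCat.{u} A} (e : Fin c → Ext M M 2) (η : MvPolynomial (Fin c) A) :
    GradedExt M :=
  ∑ α ∈ η.support,
    DirectSum.of (fun n => Ext M M n) _
      (η.coeff α • word e ((List.finRange c).flatMap fun i => List.replicate (α i) i))

/-- The map `φ_M : A[χ₁, …, χ_c] → Ext_A(M, M)` given by the cohomology operators. -/
def phi {x : Fin c → B} (hx : RingTheory.Sequence.IsRegular B (List.ofFn x))
    {M : ModuleCat.{u} A} (P : ProjectiveResolution M) (E : Lifting x P.complex)
    (η : MvPolynomial (Fin c) A) : GradedExt M :=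
  polyAction (operator hx P E) η

end Operators

/-- The action of a ring `H` on `M` and on `M^*`, given by `φ_M` and `φ_{M^*}`, commutes with
dualization of `M`: `M` has G-dimension zero and `D(φ_M(η)) = φ_{M^*}(η)` for all `η`. -/
def CommutesWithDualization {A : Type u} [CommRing A] {M : ModuleCat.{u} A} {H : Type u}
    (φ : H → GradedExt M) (φ' : H → GradedExt (dual M)) : Prop :=
  GDimZero M ∧ ∀ (η : H) (n : ℕ), IsDualization (φ η n) (φ' η n)

end CohOp

end

/-! The heart of the matter is a transposition. Let $C$ be a complete resolution of $M$, lift it to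
finite free $B$-modules, and write $\widetilde d^2=\sum x_i\widetilde t_i$. Applying
$\operatorname{Hom}_B(-,B)$ gives a lifting of $C^*$ whose square is $\sum x_i\widetilde t_i^{\,*}$,
without signs. So a single chain map $t_i$ on $C$ represents $\varphi_M(\chi_i)$, and its transpose
represents $\varphi_{M^*}(\chi_i)$ (`exists_operator_cocycle`, `isOperator_dual`,
`CompleteResolution.exists_operator`).

This needs the class of $t_i$ to be independent of the resolution and of the lifting. That, and the
commutation of the operators, follow from one computation, `IsOperator.exists_homotopy`: lifted
chain maps commute with lifted differentials modulo $(x)$, and the resulting relation $\sum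
x_ib_i=0$ on a regular sequence forces every $b_i$ into $(x)$.

To pass from the $\chi_i$ to all of $H$, products in `Ext` are computed by composing chain maps
(`extMk_comp_extMk`); even degrees keep this free of signs. Transposition reverses products, which
is harmless since the operators commute (`areDual_word`). The class of the transpose depends only on
the class of the chain map, because a nullhomotopy can be pushed to the right along $C$ by exactness
of $C^*$ (`right_cls_dualCocycle_eq_zero`).

It remains to produce $C$. Total reflexivity is defined coinductively, through finite free syzygies
and cosyzygies, so that splicing them yields a complete resolution
(`TotRefl.nonempty_completeResolution`), and a complete resolution gives G-dimension zero. A first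
syzygy of $M$ over $B$ has a finite free resolution. Killing one regular element lowers the
Gorenstein dimension by one (`gdimLE_of_ker`, whose base case is `totRefl_of_ker`), so $M$ has
finite Gorenstein dimension over $A$. Since $\operatorname{depth}M=\operatorname{depth}A$, that
dimension is zero by the Auslander–Bridger argument (`TotRefl.of_ses`, `TotRefl.of_depth`). -/

namespace CohOp

/-! ### Short exact sequences of modules -/

/-- `0 → K → F → N → 0` is exact. -/
structure IsSES {R : Type*} [Ring R] {K F N : Type*} [AddCommGroup K] [Module R K] [AddCommGroup F]
    [Module R F] [AddCommGroup N] [Module R N] (j : K →ₗ[R] F) (p : F →ₗ[R] N) : Prop where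
  inj : Function.Injective j
  surj : Function.Surjective p
  exact : ∀ y, p y = 0 ↔ ∃ k, j k = y

lemma IsSES.of_surjective {R : Type*} [Ring R] {F N : Type*} [AddCommGroup F]
    [Module R F] [AddCommGroup N] [Module R N] (p : F →ₗ[R] N) (hp : Function.Surjective p) :
    IsSES (LinearMap.ker p).subtype p :=
  ⟨Subtype.val_injective, hp, fun y => ⟨fun h => ⟨⟨y, h⟩, rfl⟩, by rintro ⟨k, rfl⟩; exact k.2⟩⟩

lemma IsSES.of_injective {R : Type*} [Ring R] {F N : Type*} [AddCommGroup F]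
    [Module R F] [AddCommGroup N] [Module R N] (i : N →ₗ[R] F) (hi : Function.Injective i) :
    IsSES i (LinearMap.range i).mkQ :=
  ⟨hi, Submodule.mkQ_surjective _, fun y => by simp⟩

lemma IsSES.apply_eq_zero {R : Type*} [Ring R] {K F N : Type*} [AddCommGroup K] [Module R K]
    [AddCommGroup F] [Module R F] [AddCommGroup N] [Module R N] {j : K →ₗ[R] F} {p : F →ₗ[R] N}
    (h : IsSES j p) (k : K) : p (j k) = 0 := (h.exact _).2 ⟨k, rfl⟩

/-- Factoring a semilinear map through a surjective one. -/
lemma exists_factor {R R' : Type*} [CommRing R] [CommRing R'] {f : R →+* R'}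
    (hf : Function.Surjective f) {F N G : Type*} [AddCommGroup F] [Module R F] [AddCommGroup N]
    [Module R' N] [AddCommGroup G] [Module R' G] (p : F →ₛₗ[f] N) (hp : Function.Surjective p)
    (g : F →ₛₗ[f] G) (h : ∀ y, p y = 0 → g y = 0) : ∃ ν : N →ₗ[R'] G, ∀ y, ν (p y) = g y := by
  choose s hs using hp
  have key (y : F) : g (s (p y)) = g y := by
    rw [← sub_eq_zero, ← map_sub]
    exact h _ (by rw [map_sub, hs, sub_self])
  refine ⟨{ toFun := fun n => g (s n), map_add' := fun a b => ?_, map_smul' := fun r a => ?_ },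
    fun y => key y⟩
  · rw [← map_add, ← key (s a + s b), map_add, hs, hs]
  · obtain ⟨r, rfl⟩ := hf r
    rw [RingHom.id_apply, ← LinearMap.map_smulₛₗ, ← key (r • s a), LinearMap.map_smulₛₗ, hs]

lemma exists_factor_linear {R : Type*} [CommRing R] {F N G : Type*} [AddCommGroup F] [Module R F]
    [AddCommGroup N] [Module R N] [AddCommGroup G] [Module R G] (p : F →ₗ[R] N)
    (hp : Function.Surjective p) (g : F →ₗ[R] G) (h : ∀ y, p y = 0 → g y = 0) :
    ∃ ν : N →ₗ[R] G, ∀ y, ν (p y) = g y :=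
  exists_factor (f := RingHom.id R) Function.surjective_id p hp g h

/-- Division by a regular element. -/
lemma exists_divide {R : Type*} [CommRing R] {L M : Type*} [AddCommGroup L] [Module R L]
    [AddCommGroup M] [Module R M] {x : R} (hx : IsSMulRegular M x) (θ : L →ₗ[R] M)
    (h : ∀ l, ∃ m, θ l = x • m) : ∃ θ' : L →ₗ[R] M, ∀ l, x • θ' l = θ l := by
  choose s hs using h
  refine ⟨{ toFun := s, map_add' := fun a b => hx ?_, map_smul' := fun r a => hx ?_ },
    fun l => (hs l).symm⟩
  · change x • _ = x • _
    rw [smul_add, ← hs, ← hs, ← hs, map_add]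
  · change x • _ = x • _
    rw [RingHom.id_apply, smul_comm, ← hs, ← hs, map_smul]

lemma exists_equiv_fin (R : Type*) [CommRing R] (F : Type*) [AddCommGroup F] [Module R F]
    [Module.Free R F] [Module.Finite R F] : ∃ n, Nonempty (F ≃ₗ[R] (Fin n → R)) :=
  ⟨_, ⟨((Module.Free.chooseBasis R F).reindex (Fintype.equivFin _)).equivFun⟩⟩

/-! ### Totally reflexive modules -/

/-- A class of modules closed under some finite free syzygies and cosyzygies, and whose members
have no self-extensions with the ring. -/
def IsTotReflClass {R : Type u} [CommRing R] (𝒞 : ModuleCat.{u} R → Prop) : Prop :=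
  ∀ N, 𝒞 N →
    (∃ (K F : ModuleCat.{u} R) (j : K →ₗ[R] F) (p : F →ₗ[R] N), Module.Free R F ∧
      Module.Finite R F ∧ IsSES j p ∧ 𝒞 K ∧ ∀ f : K →ₗ[R] R, ∃ g : F →ₗ[R] R, g ∘ₗ j = f) ∧
    ∃ (G N' : ModuleCat.{u} R) (i : N →ₗ[R] G) (q : G →ₗ[R] N'), Module.Free R G ∧
      Module.Finite R G ∧ IsSES i q ∧ 𝒞 N'

/-- `N` is totally reflexive: it lies in a class as above. -/
def TotRefl (R : Type u) [CommRing R] (N : Type u) [AddCommGroup N] [Module R N] : Prop :=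
  ∃ 𝒞 : ModuleCat.{u} R → Prop, IsTotReflClass 𝒞 ∧ 𝒞 (ModuleCat.of R N)

section

variable {R : Type u} [CommRing R]

/-- Every witnessing class is contained in `TotRefl`, so the union of all of them is again such a
class. This is the unfolding rule of a coinductive predicate. -/
lemma isTotReflClass_totRefl : IsTotReflClass fun N : ModuleCat.{u} R => TotRefl R N := by
  rintro N ⟨𝒞, h𝒞, hN⟩
  obtain ⟨⟨K, F, j, p, h1, h2, h3, h4, h5⟩, ⟨G, N', i, q, h6, h7, h8, h9⟩⟩ := h𝒞 _ hN
  exact ⟨⟨K, F, j, p, h1, h2, h3, ⟨𝒞, h𝒞, h4⟩, h5⟩, ⟨G, N', i, q, h6, h7, h8, ⟨𝒞, h𝒞, h9⟩⟩⟩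

variable {N : Type u} [AddCommGroup N] [Module R N]

lemma TotRefl.syzygy (h : TotRefl R N) : ∃ (K F : ModuleCat.{u} R) (j : K →ₗ[R] F) (p : F →ₗ[R] N),
    Module.Free R F ∧ Module.Finite R F ∧ IsSES j p ∧ TotRefl R K ∧
      ∀ f : K →ₗ[R] R, ∃ g : F →ₗ[R] R, g ∘ₗ j = f :=
  (isTotReflClass_totRefl (ModuleCat.of R N) h).1

lemma TotRefl.cosyzygy (h : TotRefl R N) :
    ∃ (G N' : ModuleCat.{u} R) (i : N →ₗ[R] G) (q : G →ₗ[R] N'),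
      Module.Free R G ∧ Module.Finite R G ∧ IsSES i q ∧ TotRefl R N' :=
  (isTotReflClass_totRefl (ModuleCat.of R N) h).2

/-- The matching introduction rule: adjoining `N` to the class of all totally reflexive modules
preserves the closure property, so one step in each direction is enough. -/
lemma TotRefl.mk {K F G N' : Type u} [AddCommGroup K] [Module R K] [AddCommGroup F] [Module R F]
    [AddCommGroup G] [Module R G] [AddCommGroup N'] [Module R N'] [Module.Free R F]
    [Module.Finite R F] [Module.Free R G] [Module.Finite R G] (j : K →ₗ[R] F) (p : F →ₗ[R] N)
    (i : N →ₗ[R] G) (q : G →ₗ[R] N') (hjp : IsSES j p) (hiq : IsSES i q) (hK : TotRefl R K)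
    (hN' : TotRefl R N') (he : ∀ f : K →ₗ[R] R, ∃ g : F →ₗ[R] R, g ∘ₗ j = f) : TotRefl R N := by
  refine ⟨fun X => TotRefl R X ∨ X = ModuleCat.of R N, ?_, Or.inr rfl⟩
  rintro X (hX | rfl)
  · obtain ⟨⟨K, F, j, p, h1, h2, h3, h4, h5⟩, ⟨G, N', i, q, h6, h7, h8, h9⟩⟩ :=
      isTotReflClass_totRefl X hX
    exact ⟨⟨K, F, j, p, h1, h2, h3, Or.inl h4, h5⟩, ⟨G, N', i, q, h6, h7, h8, Or.inl h9⟩⟩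
  · exact ⟨⟨ModuleCat.of R K, ModuleCat.of R F, j, p, ‹_›, ‹_›, hjp, Or.inl hK, he⟩,
      ⟨ModuleCat.of R G, ModuleCat.of R N', i, q, ‹_›, ‹_›, hiq, Or.inl hN'⟩⟩

lemma TotRefl.of_equiv {N₁ : Type u} [AddCommGroup N₁] [Module R N₁] (h : TotRefl R N)
    (e : N ≃ₗ[R] N₁) : TotRefl R N₁ := by
  obtain ⟨K, F, j, p, h1, h2, h3, h4, h5⟩ := h.syzygy
  obtain ⟨G, N', i, q, h6, h7, h8, h9⟩ := h.cosyzygy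
  refine TotRefl.mk j (e.toLinearMap ∘ₗ p) (i ∘ₗ e.symm.toLinearMap) q
    ⟨h3.inj, e.surjective.comp h3.surj, fun y => ?_⟩
    ⟨h8.inj.comp e.symm.injective, h8.surj, fun y => ?_⟩ h4 h9 h5
  · rw [← h3.exact]
    simp
  · rw [h8.exact]
    exact ⟨fun ⟨k, hk⟩ => ⟨e k, by simpa using hk⟩, fun ⟨k, hk⟩ => ⟨_, hk⟩⟩

/-- `Ext¹(N, R) = 0`. -/
lemma TotRefl.exists_extend (h : TotRefl R N) {K X : Type*} [AddCommGroup K] [Module R K]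
    [AddCommGroup X] [Module R X] {j : K →ₗ[R] X} {p : X →ₗ[R] N} (hjp : IsSES j p)
    (f : K →ₗ[R] R) : ∃ g : X →ₗ[R] R, ∀ k, g (j k) = f k := by
  obtain ⟨L, F, a, b, h1, h2, h3, h4, h5⟩ := h.syzygy
  obtain ⟨q, hq⟩ := Module.projective_lifting_property p b hjp.surj
  have hq' (y : F) : p (q y) = b y := LinearMap.congr_fun hq y
  have hrange (l : L) : q (a l) ∈ LinearMap.range j := by
    obtain ⟨k, hk⟩ := (hjp.exact (q (a l))).1 (by rw [hq', h3.apply_eq_zero])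
    exact ⟨k, hk⟩
  -- `t` is the map of kernels induced by the lift `q : F → X` of `b`. Since `X` is the pushout of
  -- `F` and `K` under `L`, a functional on `X` extending `f` is the same as a functional on `F`
  -- that agrees with `f ∘ t` on `L`.
  let t : L →ₗ[R] K := (LinearEquiv.ofInjective j hjp.inj).symm.toLinearMap ∘ₗ
    (q ∘ₗ a).codRestrict (LinearMap.range j) hrange
  have ht (l : L) : j (t l) = q (a l) :=
    congrArg Subtype.val ((LinearEquiv.ofInjective j hjp.inj).apply_symm_apply
      ⟨q (a l), hrange l⟩)
  obtain ⟨g, hg⟩ := h5 (f ∘ₗ t)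
  have hg' (l : L) : g (a l) = f (t l) := LinearMap.congr_fun hg l
  obtain ⟨ν, hν⟩ := exists_factor_linear (j.coprod q) (fun y => by
    obtain ⟨z, hz⟩ := h3.surj (p y)
    obtain ⟨k, hk⟩ := (hjp.exact (y - q z)).1 (by rw [map_sub, hq', hz, sub_self])
    exact ⟨(k, z), by simp [hk]⟩) (f.coprod g) (by
      rintro ⟨k, z⟩ hkz
      simp only [LinearMap.coprod_apply] at hkz ⊢
      have hz : b z = 0 := by
        rw [← hq', eq_neg_of_add_eq_zero_right hkz, map_neg, hjp.apply_eq_zero, neg_zero]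
      obtain ⟨l, rfl⟩ := (h3.exact _).1 hz
      rw [← ht, ← map_add] at hkz
      rw [hg', ← map_add, hjp.inj (hkz.trans (map_zero j).symm), map_zero])
  exact ⟨ν, fun k => by simpa using hν (k, 0)⟩

lemma TotRefl.exists_extend_free (h : TotRefl R N) {K X : Type*} [AddCommGroup K] [Module R K]
    [AddCommGroup X] [Module R X] {j : K →ₗ[R] X} {p : X →ₗ[R] N} (hjp : IsSES j p)
    {G : Type*} [AddCommGroup G] [Module R G] [Module.Free R G] [Module.Finite R G]
    (f : K →ₗ[R] G) : ∃ g : X →ₗ[R] G, ∀ k, g (j k) = f k := by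
  obtain ⟨n, ⟨e⟩⟩ := exists_equiv_fin R G
  choose g hg using fun m : Fin n => h.exists_extend hjp (LinearMap.proj m ∘ₗ e.toLinearMap ∘ₗ f)
  refine ⟨e.symm.toLinearMap ∘ₗ LinearMap.pi g, fun k => e.injective ?_⟩
  ext m
  simp [hg]

lemma TotRefl.prod_free (h : TotRefl R N) (G : Type u) [AddCommGroup G] [Module R G]
    [Module.Free R G] [Module.Finite R G] : TotRefl R (N × G) := by
  obtain ⟨K, F, j, p, h1, h2, h3, h4, h5⟩ := h.syzygy
  obtain ⟨Q, N', i, q, h6, h7, h8, h9⟩ := h.cosyzygy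
  refine TotRefl.mk (LinearMap.inl R F G ∘ₗ j) (p.prodMap LinearMap.id)
    (i.prodMap (LinearMap.id : G →ₗ[R] G)) (q ∘ₗ LinearMap.fst R Q G)
    ⟨fun a b hab => h3.inj (congrArg Prod.fst hab),
      h3.surj.prodMap Function.surjective_id, ?_⟩
    ⟨h8.inj.prodMap Function.injective_id, h8.surj.comp LinearMap.fst_surjective, ?_⟩ h4 h9
    fun f => ?_
  · rintro ⟨y, z⟩
    constructor
    · intro hy
      obtain ⟨k, rfl⟩ := (h3.exact y).1 (congrArg Prod.fst hy)
      exact ⟨k, Prod.ext rfl (congrArg Prod.snd hy).symm⟩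
    · rintro ⟨k, hk⟩
      rw [← hk]
      exact Prod.ext (h3.apply_eq_zero k) rfl
  · rintro ⟨y, z⟩
    constructor
    · intro hy
      obtain ⟨k, rfl⟩ := (h8.exact y).1 hy
      exact ⟨(k, z), rfl⟩
    · rintro ⟨k, hk⟩
      rw [← hk]
      exact h8.apply_eq_zero k.1
  · obtain ⟨g, hg⟩ := h5 f
    exact ⟨g ∘ₗ LinearMap.fst R F G, hg⟩

lemma totRefl_of_subsingleton [Subsingleton N] : TotRefl R N := by
  refine ⟨fun X => Subsingleton X, fun X hX => ?_, inferInstanceAs (Subsingleton N)⟩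
  have : Subsingleton X := hX
  refine ⟨⟨X, X, LinearMap.id, LinearMap.id, inferInstance, inferInstance, ⟨fun a b _ => ?_,
    fun a => ⟨a, rfl⟩, fun y => ?_⟩, hX, fun f => ⟨f, rfl⟩⟩, ⟨X, X, LinearMap.id, LinearMap.id,
      inferInstance, inferInstance, ⟨fun a b _ => ?_, fun a => ⟨a, rfl⟩, fun y => ?_⟩, hX⟩⟩
  · exact Subsingleton.elim _ _
  · exact ⟨fun _ => ⟨y, rfl⟩, fun _ => Subsingleton.elim _ _⟩
  · exact Subsingleton.elim _ _
  · exact ⟨fun _ => ⟨y, rfl⟩, fun _ => Subsingleton.elim _ _⟩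

lemma totRefl_of_free (G : Type u) [AddCommGroup G] [Module R G]
    [Module.Free R G] [Module.Finite R G] : TotRefl R G :=
  ((totRefl_of_subsingleton (R := R) (N := PUnit.{u + 1})).prod_free G).of_equiv
    { LinearMap.snd R PUnit.{u + 1} G with
      invFun := fun g => (0, g)
      left_inv := fun _ => rfl
      right_inv := fun _ => rfl }

/-- Extensions of a module by a totally reflexive module that split on the left. -/
lemma TotRefl.split {G L : Type u} [AddCommGroup G] [Module R G] [Module.Free R G]
    [Module.Finite R G] [AddCommGroup L] [Module R L] {j : G →ₗ[R] L} {p : L →ₗ[R] N}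
    (h : TotRefl R N) (hjp : IsSES j p) : Nonempty (L ≃ₗ[R] N × G) := by
  obtain ⟨g, hg⟩ := h.exists_extend_free hjp LinearMap.id
  refine ⟨LinearEquiv.ofBijective (p.prod g) ⟨?_, ?_⟩⟩
  · rw [← LinearMap.ker_eq_bot, LinearMap.ker_eq_bot']
    intro l hl
    obtain ⟨k, rfl⟩ := (hjp.exact l).1 (congrArg Prod.fst hl)
    have : g (j k) = 0 := congrArg Prod.snd hl
    rw [hg] at this
    rw [show k = 0 from this, map_zero]
  · rintro ⟨n, y⟩
    obtain ⟨l, rfl⟩ := hjp.surj n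
    refine ⟨l + j (y - g l), Prod.ext ?_ ?_⟩
    · simp [hjp.apply_eq_zero]
    · simp [hg]

/-- A surjection onto a free module splits. -/
lemma IsSES.split_of_projective {K G L : Type*} [AddCommGroup K] [Module R K] [AddCommGroup G]
    [Module R G] [Module.Projective R G] [AddCommGroup L] [Module R L] {j : K →ₗ[R] L}
    {p : L →ₗ[R] G} (hjp : IsSES j p) : Nonempty (L ≃ₗ[R] K × G) := by
  obtain ⟨s, hs⟩ := Module.projective_lifting_property p LinearMap.id hjp.surj
  have hs' (y : G) : p (s y) = y := LinearMap.congr_fun hs y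
  refine ⟨(LinearEquiv.ofBijective (j.coprod s) ⟨?_, ?_⟩).symm⟩
  · rw [← LinearMap.ker_eq_bot, LinearMap.ker_eq_bot']
    rintro ⟨k, y⟩ hky
    simp only [LinearMap.coprod_apply] at hky
    have hy : y = 0 := by
      have := congrArg p hky
      rwa [map_add, hjp.apply_eq_zero, zero_add, hs', map_zero] at this
    subst hy
    rw [map_zero, add_zero] at hky
    rw [hjp.inj (hky.trans (map_zero j).symm)]
    rfl
  · intro l
    obtain ⟨k, hk⟩ := (hjp.exact (l - s (p l))).1 (by rw [map_sub, hs', sub_self])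
    exact ⟨(k, p l), by simp [hk]⟩

lemma isSMulRegular_of_free {x : R} (hx : IsSMulRegular R x) (F : Type*) [AddCommGroup F]
    [Module R F] [Module.Free R F] : IsSMulRegular F x := by
  intro a b hab
  apply (Module.Free.chooseBasis R F).repr.injective
  ext m
  apply hx
  have := congrArg (fun y => (Module.Free.chooseBasis R F).repr y m) hab
  simpa using this

/-- `N` embeds in a free module, on which a regular element of the ring is regular. -/
lemma TotRefl.isSMulRegular (h : TotRefl R N) {x : R} (hx : IsSMulRegular R x) :
    IsSMulRegular N x := by
  obtain ⟨G, N', i, q, h6, h7, h8, h9⟩ := h.cosyzygy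
  intro a b hab
  apply h8.inj
  apply isSMulRegular_of_free hx G
  have := congrArg i hab
  simpa using this

/-! ### Gorenstein dimension -/

/-- `N` has a resolution of length `g` by finite free modules and one totally reflexive module. -/
def GdimLE (R : Type u) [CommRing R] : ℕ → ∀ (N : Type u) [AddCommGroup N] [Module R N], Prop
  | 0, N, _, _ => TotRefl R N
  | g + 1, N, _, _ => ∃ (n : ℕ) (p : (Fin n → R) →ₗ[R] N), Function.Surjective p ∧
      GdimLE R g (LinearMap.ker p)

lemma GdimLE.of_equiv {g : ℕ} {N₁ : Type u} [AddCommGroup N₁] [Module R N₁] (h : GdimLE R g N)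
    (e : N ≃ₗ[R] N₁) : GdimLE R g N₁ := by
  cases g with
  | zero => exact TotRefl.of_equiv h e
  | succ g =>
    obtain ⟨n, p, hp, hK⟩ := h
    refine ⟨n, e.toLinearMap ∘ₗ p, e.surjective.comp hp, ?_⟩
    rwa [LinearEquiv.ker_comp]

lemma GdimLE.succ {g : ℕ} {K F : Type u} [AddCommGroup K] [Module R K] [AddCommGroup F] [Module R F]
    [Module.Free R F] [Module.Finite R F] {j : K →ₗ[R] F} {p : F →ₗ[R] N} (hjp : IsSES j p)
    (hK : GdimLE R g K) : GdimLE R (g + 1) N := by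
  obtain ⟨n, ⟨e⟩⟩ := exists_equiv_fin R F
  refine ⟨n, p ∘ₗ e.symm.toLinearMap, hjp.surj.comp e.symm.surjective, hK.of_equiv ?_⟩
  refine LinearEquiv.ofBijective ((e.toLinearMap ∘ₗ j).codRestrict _ fun k => ?_) ⟨?_, ?_⟩
  · simp [hjp.apply_eq_zero]
  · intro a b hab
    exact hjp.inj (e.injective (congrArg Subtype.val hab))
  · rintro ⟨y, hy⟩
    obtain ⟨k, hk⟩ := (hjp.exact (e.symm y)).1 hy
    exact ⟨k, Subtype.ext (by simp [hk])⟩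

lemma GdimLE.prod_free {g : ℕ} (h : GdimLE R g N) (G : Type u) [AddCommGroup G] [Module R G]
    [Module.Free R G] [Module.Finite R G] : GdimLE R g (N × G) := by
  cases g with
  | zero => exact TotRefl.prod_free h G
  | succ g =>
    obtain ⟨n, p, hp, hK⟩ := h
    refine GdimLE.succ (j := LinearMap.inl R (Fin n → R) G ∘ₗ (LinearMap.ker p).subtype)
      (p := p.prodMap (LinearMap.id : G →ₗ[R] G))
      ⟨fun a b hab => Subtype.ext (congrArg Prod.fst hab),
        hp.prodMap Function.surjective_id, ?_⟩ hK
    rintro ⟨y, z⟩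
    constructor
    · intro hy
      exact ⟨⟨y, congrArg Prod.fst hy⟩, Prod.ext rfl (congrArg Prod.snd hy).symm⟩
    · rintro ⟨k, hk⟩
      rw [← hk]
      exact Prod.ext k.2 rfl

end

/-! ### Change of rings along the quotient by a regular element -/

section

variable {R R' : Type u} [CommRing R] [CommRing R'] (f : R →+* R')

/-- Reduction of the coordinates. -/
def red (n : ℕ) : (Fin n → R) →ₛₗ[f] (Fin n → R') where
  toFun y m := f (y m)
  map_add' _ _ := by ext; simp
  map_smul' _ _ := by ext; simp

variable {f}

lemma red_surjective (hf : Function.Surjective f) (n : ℕ) : Function.Surjective (red f n) :=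
  fun y => ⟨fun m => (hf (y m)).choose, funext fun m => (hf (y m)).choose_spec⟩

variable {x : R} (hker : ∀ r, f r = 0 ↔ ∃ s, r = x * s)
include hker

lemma red_eq_zero_iff (n : ℕ) (y : Fin n → R) : red f n y = 0 ↔ ∃ z, y = x • z := by
  constructor
  · intro h
    choose z hz using fun m => (hker (y m)).1 (congrFun h m)
    exact ⟨z, funext hz⟩
  · rintro ⟨z, rfl⟩
    ext m
    exact (hker _).2 ⟨z m, rfl⟩

lemma map_smul_eq_zero {F N : Type*} [AddCommGroup F] [Module R F] [AddCommGroup N] [Module R' N]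
    (p : F →ₛₗ[f] N) (y : F) : p (x • y) = 0 := by
  rw [LinearMap.map_smulₛₗ, (hker x).2 ⟨1, (mul_one x).symm⟩, zero_smul]

variable (hf : Function.Surjective f) (hx : IsSMulRegular R x)
include hf hx

/-- A syzygy over `R` of a submodule `W` of a free `R'`-module. -/
lemma exists_cover_submodule {n m : ℕ} (W : Submodule R' (Fin n → R'))
    (q : (Fin m → R) →ₗ[R] W.comap (red f n)) (hq : Function.Surjective q) :
    ∃ r : (Fin m → R) →ₛₗ[f] W, Function.Surjective r ∧
      Nonempty (LinearMap.ker r ≃ₗ[R] LinearMap.ker q × (Fin n → R)) := by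
  let r : (Fin m → R) →ₛₗ[f] W :=
    ((red f n).comp ((Submodule.subtype _).comp q)).codRestrict W fun y => (q y).2
  have hr (y) : (r y : Fin n → R') = red f n (q y) := rfl
  have hFx := isSMulRegular_of_free hx (Fin n → R)
  refine ⟨r, ?_, ?_⟩
  · rintro ⟨w, hw⟩
    obtain ⟨y, rfl⟩ := red_surjective hf n w
    obtain ⟨z, hz⟩ := hq ⟨y, hw⟩
    exact ⟨z, Subtype.ext (by rw [hr, hz])⟩
  -- The kernel of `r` is where `q` takes values in `x R^n`. Division by `x` gives `θ` from `ker r`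
  -- onto `R^n` with kernel `ker q`, and this sequence splits.
  · obtain ⟨θ, hθ⟩ := exists_divide hFx
      ((Submodule.subtype _).comp (q.comp (LinearMap.ker r).subtype)) (fun l => by
        exact (red_eq_zero_iff hker n _).1 ((hr l).symm.trans (congrArg Subtype.val l.2)))
    have hθ' (l : LinearMap.ker r) : x • θ l = (q l : Fin n → R) := hθ l
    have hle (l : LinearMap.ker q) : (l : Fin m → R) ∈ LinearMap.ker r := by
      have h1 : q l = 0 := l.2
      exact Subtype.ext (by rw [hr, h1]; exact map_zero _)
    refine IsSES.split_of_projective (j := Submodule.inclusion fun l hl => hle ⟨l, hl⟩) (p := θ)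
      ⟨Submodule.inclusion_injective _, fun y => ?_, fun l => ?_⟩
    · obtain ⟨z, hz⟩ := hq ⟨x • y, by
        rw [Submodule.mem_comap, (red_eq_zero_iff hker n _).2 ⟨y, rfl⟩]
        exact W.zero_mem⟩
      refine ⟨⟨z, Subtype.ext ?_⟩, hFx ?_⟩
      · rw [hr, hz]
        exact (red_eq_zero_iff hker n _).2 ⟨y, rfl⟩
      · change x • θ _ = x • y
        rw [hθ']
        exact congrArg Subtype.val hz
    · constructor
      · intro hl
        have h1 : q l = 0 := Subtype.ext (by rw [← hθ', hl, smul_zero]; rfl)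
        exact ⟨⟨l, h1⟩, rfl⟩
      · rintro ⟨k, rfl⟩
        apply hFx
        change x • θ _ = x • 0
        rw [hθ', smul_zero]
        exact congrArg Subtype.val k.2

/-- Maps on the reduction of a syzygy extend to the free module. -/
lemma exists_extend_submodule {n : ℕ} (W : Submodule R' (Fin n → R'))
    (hK : TotRefl R (W.comap (red f n))) (φ : W →ₗ[R'] R') :
    ∃ χ : (Fin n → R') →ₗ[R'] R', χ ∘ₗ W.subtype = φ := by
  obtain ⟨K₁, G, a, q, h1, h2, h3, -, h5⟩ := hK.syzygy
  obtain ⟨m, ⟨e⟩⟩ := exists_equiv_fin R G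
  let ρ : W.comap (red f n) →ₛₗ[f] W :=
    ((red f n).comp (Submodule.subtype _)).codRestrict W fun y => y.2
  obtain ⟨s, hs⟩ := hf.hasRightInverse
  -- `lam` lifts to `R` the pullback of `φ` to `G`. It need not descend to the preimage of `W`, but
  -- on `K₁` it equals `x μ`. Extending `μ` to `μ'` on `G`, the map `lam - x μ'` does descend, to
  -- `ψ`, and it still lifts `φ`.
  let lam : G →ₗ[R] R :=
    (Pi.basisFun R (Fin m)).constr R (fun i => s (φ (ρ (q (e.symm (Pi.single i 1)))))) ∘ₗ
      e.toLinearMap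
  have hlam (y : G) : f (lam y) = φ (ρ (q y)) := by
    obtain ⟨y, rfl⟩ := e.symm.surjective y
    let u : (Fin m → R) →ₛₗ[f] R' := φ.comp (ρ.comp (q.comp e.symm.toLinearMap))
    let v : (Fin m → R) →ₛₗ[f] R' :=
      { toFun := fun y => f (lam (e.symm y))
        map_add' := by simp
        map_smul' := by simp }
    have huv : v = u := by
      refine (Pi.basisFun R (Fin m)).ext fun i => ?_
      simp only [Pi.basisFun_apply]
      change f ((Pi.basisFun R (Fin m)).constr R _ (e (e.symm (Pi.single i 1)))) = u _
      rw [e.apply_symm_apply, ← Pi.basisFun_apply, Module.Basis.constr_basis, hs]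
      simp [u]
    exact LinearMap.congr_fun huv y
  obtain ⟨μ, hμ⟩ := exists_divide (x := x) hx (lam ∘ₗ a) (fun l => by
    refine (hker _).1 ?_
    change f (lam (a l)) = 0
    rw [hlam, h3.apply_eq_zero, map_zero, map_zero])
  obtain ⟨μ', hμ'⟩ := h5 μ
  obtain ⟨ψ, hψ⟩ := exists_factor_linear q h3.surj (lam - x • μ') (fun y hy => by
    obtain ⟨l, rfl⟩ := (h3.exact y).1 hy
    have h7 : lam (a l) = x • μ l := (hμ l).symm
    have h8 : μ' (a l) = μ l := LinearMap.congr_fun hμ' l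
    simp [h7, h8])
  have hψ' (k) : f (ψ k) = φ (ρ k) := by
    obtain ⟨y, rfl⟩ := h3.surj k
    rw [hψ, LinearMap.sub_apply, map_sub, hlam, LinearMap.smul_apply, smul_eq_mul,
      (hker (x * _)).2 ⟨_, rfl⟩, sub_zero]
  -- The preimage of `W` contains `x R^n`, and `ψ` sends `x R^n` into `x R`. So `χ y = ψ (x y) / x`
  -- makes sense on all of `R^n`, and it extends `ψ` by linearity.
  have hmem (y : Fin n → R) : x • y ∈ W.comap (red f n) := by
    rw [Submodule.mem_comap, (red_eq_zero_iff hker n _).2 ⟨y, rfl⟩]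
    exact W.zero_mem
  obtain ⟨χ, hχ⟩ := exists_divide (x := x) hx
    (ψ ∘ₗ (x • LinearMap.id : (Fin n → R) →ₗ[R] (Fin n → R)).codRestrict _ hmem) (fun y => by
    refine (hker _).1 ?_
    change f (ψ ⟨x • y, hmem y⟩) = 0
    rw [hψ', show ρ ⟨x • y, hmem y⟩ = 0 from
      Subtype.ext ((red_eq_zero_iff hker n _).2 ⟨y, rfl⟩), map_zero])
  have hχ' (k : W.comap (red f n)) : χ k = ψ k := by
    apply hx
    refine (hχ k).trans ?_
    change ψ ⟨x • (k : Fin n → R), _⟩ = x • ψ k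
    rw [← map_smul]
    rfl
  let v : (Fin n → R) →ₛₗ[f] R' :=
      { toFun := fun y => f (χ y)
        map_add' := by simp
        map_smul' := by simp }
  obtain ⟨ν, hν⟩ := exists_factor hf (red f n) (red_surjective hf n) v (fun y hy => by
    obtain ⟨z, rfl⟩ := (red_eq_zero_iff hker n y).1 hy
    exact map_smul_eq_zero hker v z)
  refine ⟨ν, LinearMap.ext fun ⟨w, hw⟩ => ?_⟩
  obtain ⟨y, rfl⟩ := red_surjective hf n w
  change ν (red f n y) = _
  rw [hν]
  change f (χ (⟨y, hw⟩ : W.comap (red f n))) = _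
  rw [hχ', hψ']
  rfl

-- Replaces a cover by a free `R`-module with one by a free `R'`-module. The syzygy over `R` becomes
-- the full preimage of the syzygy over `R'`, the form required by the lemmas on submodules `W`.
omit hx in
lemma exists_factor_red {n : ℕ} {N : Type*} [AddCommGroup N] [Module R' N]
    (p : (Fin n → R) →ₛₗ[f] N) (hp : Function.Surjective p) :
    ∃ p' : (Fin n → R') →ₗ[R'] N, Function.Surjective p' ∧ (∀ y, p' (red f n y) = p y) ∧
      (LinearMap.ker p').comap (red f n) = LinearMap.ker p := by
  obtain ⟨p', hp'⟩ := exists_factor hf (red f n) (red_surjective hf n) p (fun y hy => by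
    obtain ⟨z, rfl⟩ := (red_eq_zero_iff hker n y).1 hy
    exact map_smul_eq_zero hker p z)
  refine ⟨p', fun y => ?_, hp', ?_⟩
  · obtain ⟨z, rfl⟩ := hp y
    exact ⟨_, hp' z⟩
  · ext y
    rw [Submodule.mem_comap, LinearMap.mem_ker, LinearMap.mem_ker, hp']

/-- Multiplication by `x` maps `R^n` into `ker p`. Followed by an embedding of `ker p` in a free
module with totally reflexive cokernel `K'`, and reduced modulo `x`, it induces `ν`. Injectivity of
`ν` holds because `x` is regular on `K'`. The preimage of its range is an extension of `K'` by
`R^n`, which splits. -/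
lemma exists_cosyzygy_submodule {n : ℕ} {N : Type u} [AddCommGroup N] [Module R' N]
    (p : (Fin n → R) →ₛₗ[f] N) (hp : Function.Surjective p) (hK : TotRefl R (LinearMap.ker p)) :
    ∃ (m : ℕ) (ν : N →ₗ[R'] (Fin m → R')), Function.Injective ν ∧
      TotRefl R ((LinearMap.range ν).comap (red f m)) := by
  obtain ⟨G, K', i, q, h1, h2, h3, hK'⟩ := hK.cosyzygy
  obtain ⟨m, ⟨e⟩⟩ := exists_equiv_fin R G
  have hFx := isSMulRegular_of_free hx (Fin n → R)
  have hmem (y : Fin n → R) : x • y ∈ LinearMap.ker p := map_smul_eq_zero hker p y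
  let mx : (Fin n → R) →ₗ[R] LinearMap.ker p :=
    (x • LinearMap.id : (Fin n → R) →ₗ[R] (Fin n → R)).codRestrict _ hmem
  have hmx (k : LinearMap.ker p) : mx k = x • k := rfl
  obtain ⟨ν, hν⟩ := exists_factor hf p hp
    ((red f m).comp (e.toLinearMap ∘ₗ i ∘ₗ mx)) (fun y hy => by
      change red f m (e (i (mx (⟨y, hy⟩ : LinearMap.ker p)))) = 0
      rw [hmx, map_smul, map_smul]
      exact (red_eq_zero_iff hker m _).2 ⟨_, rfl⟩)
  have hν' (y) : ν (p y) = red f m (e (i (mx y))) := hν y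
  have hdiv {g : G} {k : LinearMap.ker p} (h : i k = x • g) : ∃ k', i k' = g := by
    refine (h3.exact g).1 (hK'.isSMulRegular hx ?_)
    change x • q g = x • 0
    rw [← map_smul, ← h, h3.apply_eq_zero, smul_zero]
  refine ⟨m, ν, ?_, ?_⟩
  · rw [← LinearMap.ker_eq_bot, LinearMap.ker_eq_bot']
    intro z hz
    obtain ⟨y, rfl⟩ := hp z
    rw [hν'] at hz
    obtain ⟨g, hg⟩ := (red_eq_zero_iff hker m _).1 hz
    have hg' : i (mx y) = x • e.symm g := by
      rw [← map_smul, ← hg, e.symm_apply_apply]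
    obtain ⟨k, hk⟩ := hdiv hg'
    rw [← hk, ← map_smul, ← hmx] at hg'
    have : y = k := hFx (congrArg Subtype.val (h3.inj hg'))
    rw [this]
    exact k.2
  · set L := (LinearMap.range ν).comap (red f m) with hL
    have hL' (g : Fin m → R) : g ∈ L ↔ ∃ y z, g = e (i (mx y)) + x • z := by
      rw [hL, Submodule.mem_comap, LinearMap.mem_range]
      constructor
      · rintro ⟨z, hz⟩
        obtain ⟨y, rfl⟩ := hp z
        rw [hν', eq_comm, ← sub_eq_zero, ← map_sub] at hz
        obtain ⟨w, hw⟩ := (red_eq_zero_iff hker m _).1 hz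
        exact ⟨y, w, by rw [← hw]; abel⟩
      · rintro ⟨y, z, rfl⟩
        exact ⟨p y, by rw [hν', map_add, (red_eq_zero_iff hker m (x • z)).2 ⟨z, rfl⟩, add_zero]⟩
    -- Dividing by `x` realizes the map `e (i (x y)) + x z ↦ q (e⁻¹ z)`. It is built this way
    -- because `y` and `z` are in general not determined by the element.
    obtain ⟨θ, hθ⟩ := exists_divide (x := x) (hK'.isSMulRegular hx)
      (q ∘ₗ e.symm.toLinearMap ∘ₗ L.subtype) (fun ⟨l, hl⟩ => by
        obtain ⟨y, z, rfl⟩ := (hL' l).1 hl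
        refine ⟨q (e.symm z), ?_⟩
        change q (e.symm (e (i (mx y)) + x • z)) = _
        rw [map_add, map_add, e.symm_apply_apply, h3.apply_eq_zero, zero_add, map_smul, map_smul])
    have hθ' (l : L) : x • θ l = q (e.symm l) := hθ l
    have hθe (y z h) : θ ⟨e (i (mx y)) + x • z, h⟩ = q (e.symm z) := by
      apply hK'.isSMulRegular hx
      change x • θ _ = x • _
      rw [hθ', map_add, map_add, e.symm_apply_apply, h3.apply_eq_zero, zero_add, map_smul, map_smul]
    let j : (Fin n → R) →ₗ[R] L := (e.toLinearMap ∘ₗ i ∘ₗ mx).codRestrict L fun y =>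
      (hL' _).2 ⟨y, 0, by simp⟩
    have hses : IsSES j θ := by
      refine ⟨fun a b hab => hFx (congrArg Subtype.val
        (h3.inj (e.injective (congrArg Subtype.val hab)))), fun k => ?_, ?_⟩
      · obtain ⟨g, rfl⟩ := h3.surj k
        refine ⟨⟨e (i (mx 0)) + x • e g, (hL' _).2 ⟨_, _, rfl⟩⟩, ?_⟩
        rw [hθe, e.symm_apply_apply]
      · rintro ⟨l, hl⟩
        constructor
        · intro h
          obtain ⟨y, z, rfl⟩ := (hL' l).1 hl
          rw [hθe] at h
          obtain ⟨k, hk⟩ := (h3.exact _).1 h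
          refine ⟨y + k, Subtype.ext ?_⟩
          change e (i (mx (y + k))) = e (i (mx y)) + x • z
          rw [map_add, hmx, map_add, map_add, map_smul, map_smul, hk, e.apply_symm_apply]
        · rintro ⟨y, hy⟩
          have h9 : θ ⟨e (i (mx y)) + x • 0, (hL' _).2 ⟨_, _, rfl⟩⟩ = 0 := by
            rw [hθe, map_zero, map_zero]
          rw [← h9, ← hy]
          congr 1
          refine Subtype.ext ?_
          change _ = e (i (mx y)) + x • 0
          rw [smul_zero, add_zero]
          rfl
    obtain ⟨E⟩ := hK'.split hses
    exact (hK'.prod_free _).of_equiv E.symm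

/-- If the syzygy over `R` of an `R'`-module is totally reflexive over `R`, then the module
is totally reflexive over `R' = R/x`. -/
theorem totRefl_of_ker {n : ℕ} {N : Type u} [AddCommGroup N] [Module R' N]
    (p : (Fin n → R) →ₛₗ[f] N) (hp : Function.Surjective p) (hK : TotRefl R (LinearMap.ker p)) :
    TotRefl R' N := by
  -- The coinductive class is formed by the `R'`-modules whose syzygy over `R` is totally reflexive.
  -- It is closed because the kernels of the new covers are, up to free summands, a syzygy and a
  -- cosyzygy of the old kernel.
  refine ⟨fun N => ∃ (n : ℕ) (p : (Fin n → R) →ₛₗ[f] N), Function.Surjective p ∧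
    TotRefl R (LinearMap.ker p), ?_, ⟨n, p, hp, hK⟩⟩
  rintro N ⟨n, p, hp, hK⟩
  constructor
  · obtain ⟨p', hp', hpp, hcomap⟩ := exists_factor_red hker hf p hp
    have hK' := hK
    rw [← hcomap] at hK'
    obtain ⟨K₁, G, a, q, h1, h2, h3, h4, h5⟩ := hK'.syzygy
    obtain ⟨m, ⟨e⟩⟩ := exists_equiv_fin R G
    obtain ⟨r, hr, ⟨E⟩⟩ := exists_cover_submodule hker hf hx (LinearMap.ker p')
      (q ∘ₗ e.symm.toLinearMap) (h3.surj.comp e.symm.surjective)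
    refine ⟨ModuleCat.of R' (LinearMap.ker p'), ModuleCat.of R' (Fin n → R'), Submodule.subtype _,
      p', inferInstanceAs (Module.Free R' (Fin n → R')), inferInstanceAs (Module.Finite R' (Fin n → R')),
      .of_surjective _ hp', ⟨m, r, hr, ?_⟩, fun φ => exists_extend_submodule hker hf hx _ hK' φ⟩
    have hK₁ : TotRefl R (LinearMap.ker (q ∘ₗ e.symm.toLinearMap)) := by
      refine h4.of_equiv (LinearEquiv.ofBijective ((e.toLinearMap ∘ₗ a).codRestrict _ fun k => ?_)
        ⟨fun b c hbc => h3.inj (e.injective (congrArg Subtype.val hbc)), ?_⟩)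
      · simp [h3.apply_eq_zero]
      · rintro ⟨y, hy⟩
        obtain ⟨k, hk⟩ := (h3.exact (e.symm y)).1 hy
        exact ⟨k, Subtype.ext (by simp [hk])⟩
    exact (hK₁.prod_free _).of_equiv E.symm
  · obtain ⟨m, ν, hν, hL⟩ := exists_cosyzygy_submodule hker hf hx p hp hK
    refine ⟨ModuleCat.of R' (Fin m → R'), ModuleCat.of R' ((Fin m → R') ⧸ LinearMap.range ν), ν,
      (LinearMap.range ν).mkQ, inferInstanceAs (Module.Free R' (Fin m → R')),
      inferInstanceAs (Module.Finite R' (Fin m → R')), .of_injective _ hν, m,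
      ((LinearMap.range ν).mkQ).comp (red f m),
      (Submodule.mkQ_surjective _).comp (red_surjective hf m), ?_⟩
    have : LinearMap.ker (((LinearMap.range ν).mkQ).comp (red f m)) =
        (LinearMap.range ν).comap (red f m) := by
      rw [LinearMap.ker_comp, Submodule.ker_mkQ]
    rw [this]
    exact hL

/-- Drives the inductions on Gorenstein dimension: one step of the resolution over `R` is spent on
covering `W`, and the new kernel gains only a free summand. -/
lemma GdimLE.submodule {g n : ℕ} (W : Submodule R' (Fin n → R'))
    (hK : GdimLE R (g + 1) (W.comap (red f n))) :
    ∃ (m : ℕ) (r : (Fin m → R) →ₛₗ[f] W), Function.Surjective r ∧ GdimLE R g (LinearMap.ker r) := by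
  obtain ⟨m, q, hq, hK₁⟩ := hK
  obtain ⟨r, hr, ⟨E⟩⟩ := exists_cover_submodule hker hf hx W q hq
  exact ⟨m, r, hr, (hK₁.prod_free _).of_equiv E.symm⟩

/-- Gorenstein dimension drops by one when passing to the quotient by a regular element. -/
theorem gdimLE_of_ker {g n : ℕ} {N : Type u} [AddCommGroup N] [Module R' N]
    (p : (Fin n → R) →ₛₗ[f] N) (hp : Function.Surjective p) (hK : GdimLE R g (LinearMap.ker p)) :
    GdimLE R' g N := by
  induction g generalizing n N with
  | zero => exact totRefl_of_ker hker hf hx p hp hK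
  | succ g ih =>
    obtain ⟨p', hp', hpp, hcomap⟩ := exists_factor_red hker hf p hp
    rw [← hcomap] at hK
    obtain ⟨m, r, hr, hr'⟩ := GdimLE.submodule hker hf hx _ hK
    exact ⟨n, p', hp', ih r hr hr'⟩

end

/-! ### Transport along a ring isomorphism, and iteration -/

section

variable {B A : Type u} [CommRing B] [CommRing A] {f : B →+* A} (hf : Function.Bijective f)
include hf

/-- A bijective ring map is viewed as the quotient by `0`. This makes `exists_factor_red` available,
which does not ask for regularity. -/
lemma eq_zero_iff_of_bijective (r : B) : f r = 0 ↔ ∃ s, r = 0 * s := by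
  rw [map_eq_zero_iff f hf.1]
  simp

lemma red_injective (n : ℕ) : Function.Injective (red f n) := fun _ _ h =>
  funext fun m => hf.1 (congrFun h m)

/-- Needed when the regular sequence is exhausted: the last quotient is then isomorphic to `A` but
not equal to it. The proof is by coinduction, carrying syzygies and cosyzygies over `B` to `A` in
coordinates. -/
lemma TotRefl.of_bijective {M N : Type u} [AddCommGroup M] [Module B M] [AddCommGroup N]
    [Module A N] (e : M →ₛₗ[f] N) (he : Function.Bijective e) (h : TotRefl B M) : TotRefl A N := by
  refine ⟨fun N => ∃ (M : ModuleCat.{u} B) (e : M →ₛₗ[f] N), Function.Bijective e ∧ TotRefl B M, ?_,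
    ⟨ModuleCat.of B M, e, he, h⟩⟩
  clear! M N
  rintro N ⟨M, e, he, h⟩
  constructor
  · obtain ⟨K, F, j, p, h1, h2, h3, h4, h5⟩ := h.syzygy
    obtain ⟨n, ⟨ε⟩⟩ := exists_equiv_fin B F
    obtain ⟨p', hp', hpp, hcomap⟩ := exists_factor_red (eq_zero_iff_of_bijective hf) hf.2
      (e.comp (p ∘ₗ ε.symm.toLinearMap)) (he.2.comp (h3.surj.comp ε.symm.surjective))
    have hpp' (y : F) : p' (red f n (ε y)) = e (p y) := by
      rw [hpp]
      exact congrArg (fun z => e (p z)) (ε.symm_apply_apply y)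
    let κ : K →ₛₗ[f] LinearMap.ker p' := ((red f n).comp (ε.toLinearMap ∘ₗ j)).codRestrict _
      fun k => (hpp' (j k)).trans (by rw [h3.apply_eq_zero, map_zero])
    have hκ (k) : (κ k : Fin n → A) = red f n (ε (j k)) := rfl
    refine ⟨ModuleCat.of A (LinearMap.ker p'), ModuleCat.of A (Fin n → A), Submodule.subtype _,
      p', inferInstanceAs (Module.Free A (Fin n → A)), inferInstanceAs (Module.Finite A (Fin n → A)),
      .of_surjective _ hp', ⟨K, κ, ⟨fun a b hab => ?_, ?_⟩, h4⟩, fun φ => ?_⟩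
    · exact h3.inj (ε.injective (red_injective hf n (congrArg Subtype.val hab)))
    · rintro ⟨w, hw⟩
      obtain ⟨y, rfl⟩ := red_surjective hf.2 n w
      obtain ⟨y, rfl⟩ := ε.surjective y
      rw [LinearMap.mem_ker, hpp', map_eq_zero_iff e he.1] at hw
      obtain ⟨k, rfl⟩ := (h3.exact y).1 hw
      exact ⟨k, rfl⟩
    · obtain ⟨s, hs⟩ := hf.2.hasRightInverse
      obtain ⟨g, hg⟩ := h5
        { toFun := fun k => s (φ (κ k))
          map_add' := fun a b => hf.1 (by rw [hs, map_add, map_add, map_add, hs, hs])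
          map_smul' := fun r a => hf.1 (by
            rw [hs, LinearMap.map_smulₛₗ, map_smul, RingHom.id_apply, smul_eq_mul, smul_eq_mul,
              map_mul, hs]) }
      have hg' (k : K) : f (g (j k)) = φ (κ k) := by
        rw [show g (j k) = s (φ (κ k)) from LinearMap.congr_fun hg k, hs]
      let v : (Fin n → B) →ₛₗ[f] A :=
        { toFun := fun y => f (g (ε.symm y))
          map_add' := by simp
          map_smul' := by simp }
      obtain ⟨ν, hν⟩ := exists_factor hf.2 (red f n) (red_surjective hf.2 n) v (fun y hy => by
        rw [(map_eq_zero_iff _ (red_injective hf n)).1 hy, map_zero])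
      refine ⟨ν, LinearMap.ext fun ⟨w, hw⟩ => ?_⟩
      obtain ⟨y, rfl⟩ := red_surjective hf.2 n w
      obtain ⟨y, rfl⟩ := ε.surjective y
      have hw' := hw
      rw [LinearMap.mem_ker, hpp', map_eq_zero_iff e he.1] at hw'
      obtain ⟨k, rfl⟩ := (h3.exact y).1 hw'
      refine (hν _).trans ?_
      change f (g (ε.symm (ε (j k)))) = _
      rw [ε.symm_apply_apply, hg']
      rfl
  · obtain ⟨G, M', i, q, h1, h2, h3, h4⟩ := h.cosyzygy
    obtain ⟨m, ⟨ε⟩⟩ := exists_equiv_fin B G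
    obtain ⟨ν, hν⟩ := exists_factor hf.2 e he.2 ((red f m).comp (ε.toLinearMap ∘ₗ i))
      (fun y hy => by rw [(map_eq_zero_iff e he.1).1 hy, map_zero])
    have hν' (y : M) : ν (e y) = red f m (ε (i y)) := hν y
    let π : (Fin m → B) →ₛₗ[f] ((Fin m → A) ⧸ LinearMap.range ν) :=
      (LinearMap.range ν).mkQ.comp (red f m)
    have hπ (g : G) : π (ε g) = 0 ↔ ∃ k, i k = g := by
      refine (Submodule.Quotient.mk_eq_zero _).trans ⟨?_, ?_⟩
      · rintro ⟨z, hz⟩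
        obtain ⟨y, rfl⟩ := he.2 z
        rw [hν'] at hz
        exact ⟨y, ε.injective (red_injective hf m hz)⟩
      · rintro ⟨y, rfl⟩
        exact ⟨e y, hν' y⟩
    obtain ⟨s, hs⟩ := h3.surj.hasRightInverse
    have key (g : G) : π (ε (s (q g))) = π (ε g) := by
      rw [← sub_eq_zero, ← map_sub, ← map_sub, hπ]
      exact (h3.exact _).1 (by rw [map_sub, hs, sub_self])
    let e' : M' →ₛₗ[f] ((Fin m → A) ⧸ LinearMap.range ν) :=
      { toFun := fun y => π (ε (s y))
        map_add' := fun a b => by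
          rw [← map_add, ← map_add, ← key (s a + s b), map_add, hs, hs]
        map_smul' := fun r a => by
          rw [← LinearMap.map_smulₛₗ, ← map_smul, ← key (r • s a), map_smul, hs] }
    have he' (g : G) : e' (q g) = π (ε g) := key g
    refine ⟨ModuleCat.of A (Fin m → A), ModuleCat.of A ((Fin m → A) ⧸ LinearMap.range ν), ν,
      (LinearMap.range ν).mkQ, inferInstanceAs (Module.Free A (Fin m → A)),
      inferInstanceAs (Module.Finite A (Fin m → A)), .of_injective _ fun a b hab => ?_, M', e',
      ⟨?_, fun z => ?_⟩, h4⟩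
    · obtain ⟨a, rfl⟩ := he.2 a
      obtain ⟨b, rfl⟩ := he.2 b
      rw [hν', hν'] at hab
      rw [h3.inj (ε.injective (red_injective hf m hab))]
    · refine (injective_iff_map_eq_zero e').2 fun a ha => ?_
      obtain ⟨g, rfl⟩ := h3.surj a
      rw [he', hπ] at ha
      exact (h3.exact g).2 ha
    · obtain ⟨y, rfl⟩ := Submodule.mkQ_surjective _ z
      obtain ⟨y, rfl⟩ := red_surjective hf.2 m y
      obtain ⟨y, rfl⟩ := ε.surjective y
      exact ⟨q y, he' y⟩

lemma GdimLE.of_bijective {g : ℕ} {M N : Type u} [AddCommGroup M] [Module B M] [AddCommGroup N]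
    [Module A N] (e : M →ₛₗ[f] N) (he : Function.Bijective e) (h : GdimLE B g M) :
    GdimLE A g N := by
  induction g generalizing M N with
  | zero => exact TotRefl.of_bijective hf e he h
  | succ g ih =>
    obtain ⟨n, p, hp, hK⟩ := h
    obtain ⟨p', hp', hpp, hcomap⟩ := exists_factor_red (eq_zero_iff_of_bijective hf) hf.2
      (e.comp p) (he.2.comp hp)
    have hpp' (y) : p' (red f n y) = e (p y) := hpp y
    refine ⟨n, p', hp', ih (((red f n).comp (Submodule.subtype _)).codRestrict _
      fun (k : LinearMap.ker p) => (hpp' k).trans (by rw [k.2, map_zero]))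
      ⟨fun a b hab => ?_, ?_⟩ hK⟩
    · exact Subtype.ext (red_injective hf n (congrArg Subtype.val hab))
    · rintro ⟨w, hw⟩
      obtain ⟨y, rfl⟩ := red_surjective hf.2 n w
      rw [LinearMap.mem_ker, hpp', map_eq_zero_iff e he.1] at hw
      exact ⟨⟨y, hw⟩, rfl⟩

end

lemma isWeaklyRegular_quotient {B : Type u} [CommRing B] {x : B} {xs : List B}
    (h : RingTheory.Sequence.IsWeaklyRegular B (x :: xs)) :
    RingTheory.Sequence.IsWeaklyRegular (B ⧸ Ideal.span {x})
      (xs.map (Ideal.Quotient.mk (Ideal.span {x}))) := by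
  refine (RingTheory.Sequence.isWeaklyRegular_map_algebraMap_iff (B ⧸ Ideal.span {x})
    (B ⧸ Ideal.span {x}) xs).2 ?_
  refine (LinearEquiv.isWeaklyRegular_congr (Submodule.quotEquivOfEq _ _ ?_) xs).1
    ((RingTheory.Sequence.isWeaklyRegular_cons_iff B x xs).1 h).2
  rw [← Submodule.ideal_span_singleton_smul]
  simp

/-- Gorenstein dimension drops by `c` when passing to the quotient by a regular sequence of
length `c`. -/
theorem gdimLE_of_isWeaklyRegular {A : Type u} [CommRing A] {B : Type u} [CommRing B]
    (f : B →+* A) (hf : Function.Surjective f) (xs : List B)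
    (hreg : RingTheory.Sequence.IsWeaklyRegular B xs) (hker : RingHom.ker f = Ideal.ofList xs)
    {n g : ℕ} {N : Type u} [AddCommGroup N] [Module A N] (p : (Fin n → B) →ₛₗ[f] N)
    (hp : Function.Surjective p) (hK : GdimLE B (g + xs.length) (LinearMap.ker p)) :
    GdimLE A (g + 1) N := by
  generalize hlen : xs.length = c at hK
  induction c generalizing B n N xs with
  | zero =>
    obtain rfl := List.length_eq_zero_iff.1 hlen
    rw [Ideal.ofList_nil] at hker
    have hbij : Function.Bijective f := ⟨(RingHom.injective_iff_ker_eq_bot f).2 hker, hf⟩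
    obtain ⟨p', hp', hpp, hcomap⟩ := exists_factor_red (eq_zero_iff_of_bijective hbij) hf p hp
    refine ⟨n, p', hp', GdimLE.of_bijective hbij (((red f n).comp (Submodule.subtype _)).codRestrict _
      fun (k : LinearMap.ker p) => (hpp k).trans k.2) ⟨fun a b hab => ?_, ?_⟩ hK⟩
    · exact Subtype.ext (red_injective hbij n (congrArg Subtype.val hab))
    · rintro ⟨w, hw⟩
      obtain ⟨y, rfl⟩ := red_surjective hf n w
      rw [LinearMap.mem_ker, hpp] at hw
      exact ⟨⟨y, hw⟩, rfl⟩
  | succ c ih =>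
    obtain _ | ⟨x, xs⟩ := xs
    · simp at hlen
    have hlen' : xs.length = c := by simpa using hlen
    have hfx : Ideal.span {x} ≤ RingHom.ker f := by
      rw [hker, Ideal.ofList_cons]
      exact le_sup_left
    let π := Ideal.Quotient.mk (Ideal.span {x})
    let f' : B ⧸ Ideal.span {x} →+* A := Ideal.Quotient.lift _ f fun a ha => hfx ha
    have hπ : Function.Surjective π := Ideal.Quotient.mk_surjective
    have hπk (r : B) : π r = 0 ↔ ∃ s, r = x * s := by
      rw [Ideal.Quotient.eq_zero_iff_mem, Ideal.mem_span_singleton]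
      rfl
    have hx : IsSMulRegular B x := ((RingTheory.Sequence.isWeaklyRegular_cons_iff B x xs).1 hreg).1
    have hf' : Function.Surjective f' := fun a => by
      obtain ⟨b, rfl⟩ := hf a
      exact ⟨π b, rfl⟩
    have hker' : RingHom.ker f' = Ideal.ofList (xs.map π) := by
      rw [← Ideal.map_ofList, RingHom.ker, ← Ideal.map_comap_of_surjective π hπ (Ideal.comap f' ⊥),
        Ideal.comap_comap]
      change Ideal.map π (RingHom.ker f) = _
      rw [hker, Ideal.ofList_cons, Ideal.map_sup, Ideal.map_quotient_self, bot_sup_eq]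
    let : Module (B ⧸ Ideal.span {x}) N := Module.compHom N f'
    let p₁ : (Fin n → B) →ₛₗ[π] N :=
      { toFun := p
        map_add' := map_add p
        map_smul' := fun r y => LinearMap.map_smulₛₗ p r y }
    obtain ⟨p₂, hp₂, hpp, hcomap⟩ := exists_factor_red hπk hπ p₁ hp
    -- One unit of the bound is spent on `x`: the syzygy `ker p₂` over `B/(x)` has Gorenstein
    -- dimension at most `g + c`, as the induction hypothesis for the shorter sequence demands.
    have hK' : GdimLE B (g + c + 1) (LinearMap.ker p₁) := hK
    rw [← hcomap] at hK'
    obtain ⟨m, r, hr, hr'⟩ := GdimLE.submodule hπk hπ hx _ hK'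
    let p₃ : (Fin n → B ⧸ Ideal.span {x}) →ₛₗ[f'] N :=
      { toFun := p₂
        map_add' := map_add p₂
        map_smul' := fun r y => map_smul p₂ r y }
    refine ih f' hf' (xs.map π) (isWeaklyRegular_quotient hreg) hker' p₃ hp₂ (by simpa) ?_
    exact gdimLE_of_ker hπk hπ hx r hr hr'

/-- Syzygies lower the projective dimension, and a finite projective module over a local ring is
free, hence totally reflexive. -/
lemma gdimLE_of_hasProjectiveDimensionLT {B : Type u} [CommRing B] [IsLocalRing B]
    [IsNoetherianRing B] (g : ℕ) (N : Type u) [AddCommGroup N] [Module B N] [Module.Finite B N]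
    (h : HasProjectiveDimensionLT (ModuleCat.of B N) (g + 1)) : GdimLE B g N := by
  induction g generalizing N with
  | zero =>
    have h1 : Projective (ModuleCat.of B N) := projective_iff_hasProjectiveDimensionLT_one.2 h
    have h2 : Module.Projective B N := (IsProjective.iff_projective _).2 h1
    have : Module.Free B N := Module.free_of_flat_of_isLocalRing
    exact totRefl_of_free N
  | succ g ih =>
    obtain ⟨n, p, hp⟩ := Module.Finite.exists_fin' B N
    have hS := LinearMap.shortExact_shortComplexKer hp
    exact ⟨n, p, hp, ih _ ((hS.hasProjectiveDimensionLT_X₃_iff g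
      (ModuleCat.projective_of_categoryTheory_projective (ModuleCat.of B (Fin n → B)))).1 h)⟩

/-- A finite module over `A = B/(x)` with finite projective dimension over `B` has finite
Gorenstein dimension over `A`. -/
theorem exists_gdimLE {B A : Type u} [CommRing B] [IsLocalRing B] [IsNoetherianRing B]
    [CommRing A] (f : B →+* A) (hf : Function.Surjective f) (xs : List B)
    (hreg : RingTheory.Sequence.IsWeaklyRegular B xs) (hker : RingHom.ker f = Ideal.ofList xs)
    (M : ModuleCat.{u} A) [Module.Finite A M]
    (hpd : projectiveDimension ((ModuleCat.restrictScalars f).obj M) < ⊤) :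
    ∃ g, GdimLE A g M := by
  obtain ⟨d, hd⟩ := (projectiveDimension_ne_top_iff _).1 hpd.ne
  obtain ⟨n, p, hp⟩ := Module.Finite.exists_fin' A M
  let p₁ : (Fin n → B) →ₛₗ[f] M := p.comp (red f n)
  have hp₁ : Function.Surjective p₁ := hp.comp (red_surjective hf n)
  let p₂ : (Fin n → B) →ₗ[B] (ModuleCat.restrictScalars f).obj M :=
    { toFun := p₁
      map_add' := map_add p₁
      map_smul' := fun r y => LinearMap.map_smulₛₗ p₁ r y }
  -- The bound `d + xs.length` for the first syzygy is not sharp. It is chosen to leave one unit for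
  -- each element of the sequence.
  refine ⟨d + 1, gdimLE_of_isWeaklyRegular f hf xs hreg hker p₁ hp₁ ?_⟩
  have hS := LinearMap.shortExact_shortComplexKer (f := p₂) hp₁
  have h1 : HasProjectiveDimensionLT (ModuleCat.of B (LinearMap.ker p₂)) (d + xs.length + 1) := by
    refine (hS.hasProjectiveDimensionLT_X₃_iff (d + xs.length)
      (ModuleCat.projective_of_categoryTheory_projective (ModuleCat.of B (Fin n → B)))).1 ?_
    have : HasProjectiveDimensionLT ((ModuleCat.restrictScalars f).obj M) (d + 1) := hd
    exact hasProjectiveDimensionLT_of_ge _ (d + 1) _ (by omega)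
  exact gdimLE_of_hasProjectiveDimensionLT _ _ h1

/-! ### Depth and totally reflexive modules -/

section

variable {R : Type u} [CommRing R]

/-- The short complex in `ModuleCat` of a short exact sequence. -/
def IsSES.shortComplex {K F N : Type u} [AddCommGroup K] [Module R K] [AddCommGroup F] [Module R F]
    [AddCommGroup N] [Module R N] {j : K →ₗ[R] F} {p : F →ₗ[R] N} (h : IsSES j p) :
    ShortComplex (ModuleCat.{u} R) :=
  ShortComplex.mk (ModuleCat.ofHom j) (ModuleCat.ofHom p)
    (ModuleCat.hom_ext (LinearMap.ext fun k => h.apply_eq_zero k))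

lemma IsSES.shortExact {K F N : Type u} [AddCommGroup K] [Module R K] [AddCommGroup F] [Module R F]
    [AddCommGroup N] [Module R N] {j : K →ₗ[R] F} {p : F →ₗ[R] N} (h : IsSES j p) :
    h.shortComplex.ShortExact where
  exact := (ShortComplex.moduleCat_exact_iff _).2 fun y hy => (h.exact y).1 hy
  mono_f := (ModuleCat.mono_iff_injective _).2 h.inj
  epi_g := (ModuleCat.epi_iff_surjective _).2 h.surj

/-- The map induced on `Ext`. -/
noncomputable def extMap {N N' : Type u} [AddCommGroup N] [Module R N] [AddCommGroup N'] [Module R N']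
    (X : ModuleCat.{u} R) (i : ℕ) (j : N →ₗ[R] N') (α : Ext X (ModuleCat.of R N) i) :
    Ext X (ModuleCat.of R N') i :=
  α.comp (Ext.mk₀ (ModuleCat.ofHom j)) (add_zero i)

variable {X : ModuleCat.{u} R} {i : ℕ} {K F N : Type u} [AddCommGroup K] [Module R K]
  [AddCommGroup F] [Module R F] [AddCommGroup N] [Module R N]

lemma extMap_extMap (j : K →ₗ[R] F) (p : F →ₗ[R] N) (α : Ext X (ModuleCat.of R K) i) :
    extMap X i p (extMap X i j α) = extMap X i (p ∘ₗ j) α := by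
  rw [extMap, extMap, Ext.comp_assoc_of_second_deg_zero, Ext.mk₀_comp_mk₀]
  rfl

lemma extMap_id (α : Ext X (ModuleCat.of R K) i) : extMap X i LinearMap.id α = α :=
  Ext.comp_mk₀_id α

lemma extMap_apply_zero (j : K →ₗ[R] F) : extMap X i j 0 = 0 :=
  map_zero ((Ext.mk₀ (ModuleCat.ofHom j)).postcomp X (add_zero i))

lemma extMap_zero (α : Ext X (ModuleCat.of R K) i) : extMap X i (0 : K →ₗ[R] F) α = 0 := by
  rw [extMap, ModuleCat.ofHom_zero, Ext.mk₀_zero, Ext.comp_zero]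

lemma extMap_add (j j' : K →ₗ[R] F) (α : Ext X (ModuleCat.of R K) i) :
    extMap X i (j + j') α = extMap X i j α + extMap X i j' α := by
  rw [extMap, ModuleCat.ofHom_add, Ext.mk₀_add, Ext.comp_add]
  rfl

lemma extMap_sum {ι : Type*} (s : Finset ι) (j : ι → K →ₗ[R] F) (α : Ext X (ModuleCat.of R K) i) :
    extMap X i (∑ l ∈ s, j l) α = ∑ l ∈ s, extMap X i (j l) α := by
  classical
  induction s using Finset.induction_on with
  | empty => exact extMap_zero α
  | insert a s ha ih => rw [Finset.sum_insert ha, Finset.sum_insert ha, extMap_add, ih]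

lemma extMap_smul (r : R) (j : K →ₗ[R] F) (α : Ext X (ModuleCat.of R K) i) :
    extMap X i (r • j) α = r • extMap X i j α := by
  have h : ModuleCat.ofHom (r • j) = r • ModuleCat.ofHom j := rfl
  rw [extMap, h, Ext.mk₀_smul, Ext.comp_smul]
  rfl

/-- By the long exact sequence the kernel comes from `Ext^{i-1}(X, N)`. Quantifying over `i'` makes
the hypothesis empty for `i = 0`, where left exactness suffices. -/
lemma IsSES.extMap_injective {j : K →ₗ[R] F} {p : F →ₗ[R] N} (h : IsSES j p)
    (hN : ∀ i', i' + 1 = i → Subsingleton (Ext X (ModuleCat.of R N) i')) :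
    Function.Injective (extMap X i j) := by
  cases i with
  | zero =>
    have : Mono (ModuleCat.ofHom j) := (ModuleCat.mono_iff_injective _).2 h.inj
    exact Ext.postcomp_mk₀_injective_of_mono X (ModuleCat.ofHom j)
  | succ i =>
    have : Subsingleton (Ext X h.shortComplex.X₃ i) := hN i rfl
    refine (injective_iff_map_eq_zero
      ((Ext.mk₀ (ModuleCat.ofHom j)).postcomp X (add_zero (i + 1)))).2 fun α hα => ?_
    obtain ⟨β, rfl⟩ := Ext.covariant_sequence_exact₁ X h.shortExact α hα rfl
    rw [Subsingleton.elim β 0, Ext.zero_comp]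
    rfl

/-- The identity of `F` is a finite sum of maps factoring through `R`. -/
lemma subsingleton_ext_of_free [Module.Free R F] [Module.Finite R F]
    (h : Subsingleton (Ext X (ModuleCat.of R R) i)) : Subsingleton (Ext X (ModuleCat.of R F) i) := by
  refine ⟨fun α β => ?_⟩
  have key (α : Ext X (ModuleCat.of R F) i) : α = 0 := by
    let b := Module.Free.chooseBasis R F
    have hid : (LinearMap.id : F →ₗ[R] F) =
        ∑ l, (LinearMap.toSpanSingleton R F (b l)) ∘ₗ (b.coord l) := by
      ext y
      simp [b.sum_repr]
    rw [← extMap_id α, hid, extMap_sum]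
    refine Finset.sum_eq_zero fun l _ => ?_
    rw [← extMap_extMap, Subsingleton.elim (extMap X i (b.coord l) α) 0]
    exact extMap_apply_zero _
  rw [key α, key β]

/-- For `X` the residue field, this is the bound of the depth of a totally reflexive module from
below by that of the ring. Embedding `N` in a free module reduces degree `i + 1` for `N` to degree
`i` for the cokernel. -/
lemma TotRefl.subsingleton_ext (h : TotRefl R N) {t : ℕ}
    (ht : ∀ i < t, Subsingleton (Ext X (ModuleCat.of R R) i)) :
    ∀ i < t, Subsingleton (Ext X (ModuleCat.of R N) i) := by
  intro i
  induction i generalizing N with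
  | zero =>
    intro hi
    obtain ⟨G, N', a, q, h1, h2, h3, h4⟩ := h.cosyzygy
    have h5 := subsingleton_ext_of_free (F := G) (ht 0 hi)
    exact (h3.extMap_injective (X := X) (i := 0) (by omega)).subsingleton
  | succ i ih =>
    intro hi
    obtain ⟨G, N', a, q, h1, h2, h3, h4⟩ := h.cosyzygy
    have h5 := subsingleton_ext_of_free (F := G) (ht _ hi)
    refine (h3.extMap_injective (X := X) (i := i + 1) fun i' hi' => ?_).subsingleton
    obtain rfl : i' = i := by omega
    exact ih h4 (by omega)

lemma IsSES.subsingleton_ext_left {j : K →ₗ[R] F} {p : F →ₗ[R] N} (h : IsSES j p) {t : ℕ}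
    (hF : ∀ i < t, Subsingleton (Ext X (ModuleCat.of R F) i))
    (hN : ∀ i < t, Subsingleton (Ext X (ModuleCat.of R N) i)) :
    ∀ i < t, Subsingleton (Ext X (ModuleCat.of R K) i) := by
  intro i hi
  have := hF i hi
  exact (h.extMap_injective fun i' hi' => hN i' (by omega)).subsingleton

end

/-! ### Ext from the residue field and the Auslander–Bridger argument -/

section

variable {R : Type u} [CommRing R] [IsLocalRing R]

/-- The residue field as a module. -/
noncomputable abbrev resField (R : Type u) [CommRing R] [IsLocalRing R] : ModuleCat.{u} R :=
  ModuleCat.of R (IsLocalRing.ResidueField R)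

lemma smul_ext_resField {r : R} (hr : r ∈ IsLocalRing.maximalIdeal R) {N : ModuleCat.{u} R} {i : ℕ}
    (α : Ext (resField R) N i) : r • α = 0 := by
  have h : r • 𝟙 (resField R) = 0 := by
    refine ModuleCat.hom_ext (LinearMap.ext fun y => ?_)
    change r • y = 0
    rw [Algebra.smul_def, IsLocalRing.ResidueField.algebraMap_eq, (IsLocalRing.residue_eq_zero_iff r).2 hr,
      zero_mul]
  rw [← Ext.mk₀_id_comp α, ← Ext.smul_comp, ← Ext.mk₀_smul, h, Ext.mk₀_zero, Ext.zero_comp]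

/-- Over a local ring, `j` splits once its reduction to the residue field is injective. Suppose `j
g` lies in `𝔪 H` although `g` has a unit coordinate, and push a nonzero class `α` forward along `1 ↦
g`. Its image under `j` is zero because `𝔪` kills Ext from the residue field, so it is itself zero;
but a multiple of the coordinate functional recovers `α` from it. -/
lemma exists_retraction_of_extMap_injective {G H : Type u} [AddCommGroup G] [Module R G]
    [Module.Free R G] [Module.Finite R G] [AddCommGroup H] [Module R H]
    [Module.Free R H] [Module.Finite R H] (j : G →ₗ[R] H) {t : ℕ}
    (ht : Nontrivial (Ext (resField R) (ModuleCat.of R R) t))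
    (hj : Function.Injective (extMap (resField R) t j)) : ∃ ρ : H →ₗ[R] G, ∀ y, ρ (j y) = y := by
  suffices h : ∃ ρ : H →ₗ[R] G, ρ ∘ₗ j = LinearMap.id from
    ⟨h.choose, fun y => LinearMap.congr_fun h.choose_spec y⟩
  rw [IsLocalRing.split_injective_iff_lTensor_residueField_injective,
    injective_iff_map_eq_zero]
  let b := Module.Free.chooseBasis R G
  let b' := Module.Free.chooseBasis R H
  let k := IsLocalRing.ResidueField R
  intro y hy
  obtain ⟨g, rfl⟩ : ∃ g : G, (1 : k) ⊗ₜ[R] g = y :=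
    TensorProduct.mk_surjective R G k IsLocalRing.residue_surjective y
  have hjg (m) : b'.coord m (j g) ∈ IsLocalRing.maximalIdeal R := by
    have h1 := congrArg (fun z => TensorProduct.rid R k ((b'.coord m).lTensor k z)) hy
    simp only [LinearMap.lTensor_tmul, TensorProduct.rid_tmul, map_zero] at h1
    rw [← IsLocalRing.residue_eq_zero_iff]
    rwa [Algebra.smul_def, mul_one] at h1
  by_cases hg : ∀ l, b.coord l g ∈ IsLocalRing.maximalIdeal R
  · rw [← b.sum_repr g, TensorProduct.tmul_sum]
    refine Finset.sum_eq_zero fun l _ => ?_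
    have h1 : b.repr g l • (1 : k) = 0 := by
      rw [Algebra.smul_def, mul_one]
      exact (IsLocalRing.residue_eq_zero_iff _).2 (hg l)
    rw [TensorProduct.tmul_smul, TensorProduct.smul_tmul', h1, TensorProduct.zero_tmul]
  · exfalso
    push Not at hg
    obtain ⟨l, hl⟩ := hg
    rw [IsLocalRing.mem_maximalIdeal, mem_nonunits_iff, not_not] at hl
    obtain ⟨u, hu⟩ := hl
    let v : G →ₗ[R] R := (↑u⁻¹ : R) • b.coord l
    have hv : v ∘ₗ LinearMap.toSpanSingleton R G g = LinearMap.id := by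
      ext
      simp [v, ← hu]
    have hjv : j ∘ₗ LinearMap.toSpanSingleton R G g =
        ∑ m, b'.coord m (j g) • LinearMap.toSpanSingleton R H (b' m) := by
      ext
      simp [b'.sum_repr]
    obtain ⟨α, hα⟩ := exists_ne (0 : Ext (resField R) (ModuleCat.of R R) t)
    have h0 : extMap (resField R) t j (extMap _ t (LinearMap.toSpanSingleton R G g) α) = 0 := by
      rw [extMap_extMap, hjv, extMap_sum]
      exact Finset.sum_eq_zero fun m _ => by rw [extMap_smul, smul_ext_resField (hjg m)]
    have h1 := hj (h0.trans (extMap_apply_zero j).symm)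
    apply hα
    rw [← extMap_id α, ← hv, ← extMap_extMap, h1]
    exact extMap_apply_zero v

/-- A module of Gorenstein dimension at most one over a ring of depth `t`, itself of depth at
least `t`, is totally reflexive. -/
lemma TotRefl.of_ses {K F M : Type u} [AddCommGroup K] [Module R K] [AddCommGroup F] [Module R F]
    [AddCommGroup M] [Module R M] [Module.Free R F] [Module.Finite R F] {j : K →ₗ[R] F}
    {p : F →ₗ[R] M} (hjp : IsSES j p) (hK : TotRefl R K) {t : ℕ}
    (ht : ∀ i < t, Subsingleton (Ext (resField R) (ModuleCat.of R R) i))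
    (ht' : Nontrivial (Ext (resField R) (ModuleCat.of R R) t))
    (hM : ∀ i < t, Subsingleton (Ext (resField R) (ModuleCat.of R M) i)) : TotRefl R M := by
  obtain ⟨G, K', i, q, h1, h2, hiq, hK'⟩ := hK.cosyzygy
  obtain ⟨H, K'', i', q', h3, h4, hiq', hK''⟩ := hK'.cosyzygy
  obtain ⟨e, he⟩ := hK'.exists_extend_free hiq j
  obtain ⟨μ, hμ⟩ := exists_factor_linear q hiq.surj (p ∘ₗ e) (fun g hg => by
    obtain ⟨k, rfl⟩ := (hiq.exact g).1 hg
    rw [LinearMap.comp_apply, he, hjp.apply_eq_zero])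
  have hμ' (g : G) : μ (q g) = p (e g) := hμ g
  -- Extending `j` to `e : G → F` replaces `0 → K → F → M → 0` by `0 → G → F × K' → M → 0`, whose
  -- first term is free. Embedding `K'` in `H` then places `G` in the free module `F × H`.
  have hL : IsSES (e.prod q) (p.coprod (-μ)) := by
    refine ⟨(injective_iff_map_eq_zero _).2 fun g hg => ?_, fun m => ?_, ?_⟩
    · obtain ⟨k, rfl⟩ := (hiq.exact g).1 (congrArg Prod.snd hg)
      have h5 : e (i k) = 0 := congrArg Prod.fst hg
      rw [he] at h5
      rw [hjp.inj (h5.trans (map_zero j).symm), map_zero]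
    · obtain ⟨y, rfl⟩ := hjp.surj m
      exact ⟨(y, 0), by simp⟩
    · rintro ⟨y, z⟩
      constructor
      · intro h
        obtain ⟨g, rfl⟩ := hiq.surj z
        rw [LinearMap.coprod_apply, LinearMap.neg_apply, hμ', ← sub_eq_add_neg, ← map_sub] at h
        obtain ⟨k, hk⟩ := (hjp.exact _).1 h
        refine ⟨g + i k, Prod.ext ?_ ?_⟩
        · simp [he, hk]
        · simp [hiq.apply_eq_zero]
      · rintro ⟨g, hg⟩
        rw [← hg]
        simp [hμ']
  have hH : IsSES ((LinearMap.id : F →ₗ[R] F).prodMap i') (q' ∘ₗ LinearMap.snd R F H) := by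
    refine ⟨Function.injective_id.prodMap hiq'.inj, hiq'.surj.comp LinearMap.snd_surjective, ?_⟩
    rintro ⟨y, z⟩
    constructor
    · intro h
      obtain ⟨k, rfl⟩ := (hiq'.exact z).1 h
      exact ⟨(y, k), rfl⟩
    · rintro ⟨k, hk⟩
      rw [← hk]
      exact hiq'.apply_eq_zero k.2
  -- Both inclusions are injective on `Ext^t`, since `Ext^{t-1}` into their cokernels `M` and `K''`
  -- vanishes. This is where the depth of `M` enters; it makes `G` a direct summand of `F × H`.
  have hinj : Function.Injective (extMap (resField R) t
      ((LinearMap.id : F →ₗ[R] F).prodMap i' ∘ₗ (e.prod q))) := by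
    have h5 := (hH.extMap_injective (X := resField R) (i := t) fun i' hi' =>
      hK''.subsingleton_ext ht i' (by omega)).comp
      (hL.extMap_injective (X := resField R) (i := t) fun i' hi' => hM i' (by omega))
    convert h5 using 1
    funext α
    exact (extMap_extMap _ _ _).symm
  obtain ⟨ρ, hρ⟩ := exists_retraction_of_extMap_injective _ ht' hinj
  have hρ' (g : G) : ρ (e g, i' (q g)) = g := hρ g
  let d : G →ₗ[R] F × H := e.prod (i' ∘ₗ q)
  have hd (g : G) : ρ (d g) = g := hρ g
  -- The retraction `ρ` splits `0 → G → F × K' → M → 0`. The map `σ` is the resulting section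
  -- followed by the inclusion into `F × H`, and it serves as the cosyzygy embedding of `M`.
  obtain ⟨σ, hσ⟩ := exists_factor_linear p hjp.surj
    (LinearMap.inl R F H - d ∘ₗ ρ ∘ₗ LinearMap.inl R F H) (fun y hy => by
      obtain ⟨k, rfl⟩ := (hjp.exact y).1 hy
      have h5 : d (i k) = (j k, 0) := by
        simp [d, he, hiq.apply_eq_zero]
      have h6 : ρ (j k, 0) = i k := by rw [← h5, hd]
      simp [h5, h6])
  have hσ' (y : F) : σ (p y) = (y, 0) - d (ρ (y, 0)) := hσ y
  have hρσ (m : M) : ρ (σ m) = 0 := by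
    obtain ⟨y, rfl⟩ := hjp.surj m
    rw [hσ', map_sub, hd, sub_self]
  have hqσ (m : M) : q' (σ m).2 = 0 := by
    obtain ⟨y, rfl⟩ := hjp.surj m
    rw [hσ']
    simp [d, hiq'.apply_eq_zero]
  have hσinj : Function.Injective σ := by
    refine (injective_iff_map_eq_zero σ).2 fun m hm => ?_
    obtain ⟨y, rfl⟩ := hjp.surj m
    rw [hσ', sub_eq_zero] at hm
    have h5 : i' (q (ρ (y, 0))) = 0 := (congrArg Prod.snd hm).symm
    obtain ⟨k, hk⟩ := (hiq.exact _).1 (hiq'.inj (h5.trans (map_zero i').symm))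
    have h6 : y = e (ρ (y, 0)) := congrArg Prod.fst hm
    rw [← hk, he] at h6
    rw [h6, hjp.apply_eq_zero]
  let Q := (F × H) ⧸ LinearMap.range σ
  obtain ⟨τ, hτ⟩ := exists_factor_linear (LinearMap.range σ).mkQ (Submodule.mkQ_surjective _)
    (q' ∘ₗ LinearMap.snd R F H) (fun y hy => by
      obtain ⟨m, rfl⟩ := (Submodule.Quotient.mk_eq_zero _).1 hy
      exact hqσ m)
  have hτ' (y : F × H) : τ ((LinearMap.range σ).mkQ y) = q' y.2 := hτ y
  -- The cokernel of `σ` is an extension of `K''` by the free module `G`, so it splits and is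
  -- totally reflexive.
  have hQ : IsSES ((LinearMap.range σ).mkQ ∘ₗ d) τ := by
    refine ⟨(injective_iff_map_eq_zero _).2 fun g hg => ?_, fun z => ?_, fun y => ?_⟩
    · obtain ⟨m, hm⟩ := (Submodule.Quotient.mk_eq_zero _).1 hg
      rw [← hd g, ← hm, hρσ]
    · obtain ⟨h, rfl⟩ := hiq'.surj z
      exact ⟨(LinearMap.range σ).mkQ (0, h), hτ' _⟩
    · obtain ⟨⟨y, h⟩, rfl⟩ := Submodule.mkQ_surjective _ y
      rw [hτ']
      constructor
      · intro hy
        obtain ⟨k, rfl⟩ := (hiq'.exact h).1 hy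
        obtain ⟨g, rfl⟩ := hiq.surj k
        refine ⟨g + ρ (y - e g, 0), ?_⟩
        rw [eq_comm, ← sub_eq_zero, LinearMap.comp_apply, ← map_sub]
        refine (Submodule.Quotient.mk_eq_zero _).2 ⟨p (y - e g), ?_⟩
        rw [hσ', map_add, ← sub_sub]
        congr 1
        simp [d]
      · rintro ⟨g, hg⟩
        rw [← hτ' (y, h), ← hg, LinearMap.comp_apply, hτ']
        exact hiq'.apply_eq_zero _
  obtain ⟨E⟩ := hK''.split hQ
  refine TotRefl.mk j p σ (LinearMap.range σ).mkQ hjp (.of_injective σ hσinj) hK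
    ((hK''.prod_free G).of_equiv E.symm) fun φ => ?_
  -- Since `d (i k) = (j k, 0)`, the retraction sends `(j k, 0)` to `i k`. An extension of `φ` to
  -- `G` thus becomes, through `ρ`, an extension to `F`.
  obtain ⟨φ', hφ'⟩ := hK'.exists_extend hiq φ
  refine ⟨φ' ∘ₗ ρ ∘ₗ LinearMap.inl R F H, LinearMap.ext fun k => ?_⟩
  have h5 := hρ' (i k)
  rw [he, hiq.apply_eq_zero, map_zero] at h5
  simp [h5, hφ']

/-- A module of finite Gorenstein dimension whose depth is at least that of the ring is totally
reflexive. -/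
lemma TotRefl.of_gdimLE {g : ℕ} {M : Type u} [AddCommGroup M] [Module R M] (h : GdimLE R g M) {t : ℕ}
    (ht : ∀ i < t, Subsingleton (Ext (resField R) (ModuleCat.of R R) i))
    (ht' : Nontrivial (Ext (resField R) (ModuleCat.of R R) t))
    (hM : ∀ i < t, Subsingleton (Ext (resField R) (ModuleCat.of R M) i)) : TotRefl R M := by
  induction g generalizing M with
  | zero => exact h
  | succ g ih =>
    obtain ⟨n, p, hp, hK⟩ := h
    have hses := IsSES.of_surjective p hp
    exact TotRefl.of_ses hses (ih hK (hses.subsingleton_ext_left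
      (fun i hi => subsingleton_ext_of_free (ht i hi)) hM)) ht ht' hM

/-! ### Depth and the vanishing of Ext -/

section Depth

lemma length_le_depth {M : Type u} [AddCommGroup M] [Module R M] {rs : List R}
    (h : RingTheory.Sequence.IsRegular M rs) (hrs : ∀ r ∈ rs, r ∈ IsLocalRing.maximalIdeal R) :
    (rs.length : ℕ∞) ≤ depth R M :=
  le_iSup_of_le rs (le_iSup_of_le h (le_iSup_of_le hrs le_rfl))

lemma exists_isRegular_of_le_depth {M : Type u} [AddCommGroup M] [Module R M] {t : ℕ} (h0 : t ≠ 0)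
    (ht : (t : ℕ∞) ≤ depth R M) : ∃ rs : List R, RingTheory.Sequence.IsRegular M rs ∧
      (∀ r ∈ rs, r ∈ IsLocalRing.maximalIdeal R) ∧ t ≤ rs.length := by
  -- No sequence, not even the empty one, is regular on the zero module, and its depth is `0` as an
  -- empty supremum. Hence the need for `t ≠ 0`.
  obtain ⟨s, rfl⟩ := Nat.exists_eq_succ_of_ne_zero h0
  have h1 : (s : ℕ∞) < depth R M := lt_of_lt_of_le (by exact_mod_cast Nat.lt_succ_self s) ht
  simp only [depth, lt_iSup_iff] at h1
  obtain ⟨rs, h2, h3, h4⟩ := h1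
  exact ⟨rs, h2, h3, by exact_mod_cast h4⟩

lemma smul_top_lt_top (M : Type u) [AddCommGroup M] [Module R M] [Module.Finite R M] [Nontrivial M] :
    IsLocalRing.maximalIdeal R • (⊤ : Submodule R M) < ⊤ := by
  refine lt_top_iff_ne_top.2 fun h => ?_
  exact Submodule.top_ne_ideal_smul_of_le_jacobson_annihilator
    (IsLocalRing.maximalIdeal_le_jacobson _) h.symm

variable [IsNoetherianRing R]

/-- A regular sequence longer than the finite Krull dimension would leave a nonzero quotient of
negative dimension. -/
lemma depth_self_ne_top : depth R R ≠ ⊤ := by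
  intro h
  obtain ⟨d, hd⟩ : ∃ d : ℕ, ringKrullDim R = d := by
    obtain ⟨d, hd⟩ := WithBot.ne_bot_iff_exists.1 (ringKrullDim_ne_bot (R := R))
    obtain ⟨d', hd'⟩ := ENat.ne_top_iff_exists.1 (fun h' : d = ⊤ => by
      apply ringKrullDim_ne_top (R := R)
      rw [← hd, h']
      rfl)
    exact ⟨d', by rw [← hd, ← hd']; rfl⟩
  obtain ⟨rs, h1, -, h3⟩ := exists_isRegular_of_le_depth (R := R) (M := R) (t := d + 1) (by omega)
    (by rw [h]; exact le_top)
  have h4 := ringKrullDim_add_length_eq_ringKrullDim_of_isRegular rs h1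
  have : Nontrivial (R ⧸ Ideal.ofList rs) := Ideal.Quotient.nontrivial_iff.2 fun h5 => h1.top_ne_smul (by
    rw [h5]
    simp)
  have h5 : (0 : WithBot ℕ∞) ≤ ringKrullDim (R ⧸ Ideal.ofList rs) := ringKrullDim_nonneg_of_nontrivial
  have h6 : ((d + 1 : ℕ) : WithBot ℕ∞) ≤ d := by
    rw [← hd, ← h4]
    refine le_trans ?_ (add_le_add_left h5 _)
    rw [zero_add]
    exact_mod_cast h3
  have h7 : d + 1 ≤ d := by exact_mod_cast h6
  omega

lemma subsingleton_ext_of_lt_depth (M : Type u) [AddCommGroup M] [Module R M] [Module.Finite R M]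
    [Nontrivial M] {t : ℕ} (ht : (t : ℕ∞) ≤ depth R M) :
    ∀ i < t, Subsingleton (Ext (resField R) (ModuleCat.of R M) i) := by
  intro i hi
  obtain ⟨rs, h1, h2, h3⟩ := exists_isRegular_of_le_depth (by omega) ht
  have : Module.Finite R (ModuleCat.of R M) := ‹_›
  refine ModuleCat.subsingleton_ext_of_exists_isRegular (IsLocalRing.maximalIdeal R) (resField R) ?_
    (ModuleCat.of R M) (smul_top_lt_top M) rs h2 h1 i (by omega)
  rw [Module.support_eq_zeroLocus]
  refine PrimeSpectrum.zeroLocus_anti_mono ?_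
  exact (Ideal.annihilator_quotient (I := IsLocalRing.maximalIdeal R)).ge

/-- Rees's characterization of depth: if `Ext^t` vanished along with the lower ones, there would be
a regular sequence of length `t + 1`. -/
lemma nontrivial_ext_depth {t : ℕ} (ht : depth R R = t) :
    Nontrivial (Ext (resField R) (ModuleCat.of R R) t) := by
  by_contra h
  rw [not_nontrivial_iff_subsingleton] at h
  have h0 := subsingleton_ext_of_lt_depth (R := R) R ht.ge
  obtain ⟨rs, h1, h2, h3⟩ := ModuleCat.exists_isRegular_of_exists_subsingleton_ext
    (IsLocalRing.maximalIdeal R) (t + 1) (ModuleCat.of R R) (smul_top_lt_top R) (resField R) (by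
      rw [Module.support_eq_zeroLocus]
      congr 1
      exact congrArg _ (Ideal.annihilator_quotient (I := IsLocalRing.maximalIdeal R)))
    (fun i hi => by
      obtain rfl | hi' := (Nat.lt_succ_iff_lt_or_eq.1 hi).symm
      · exact h
      · exact h0 i hi')
  have h4 := length_le_depth h3 h2
  rw [ht, h1] at h4
  have : t + 1 ≤ t := by exact_mod_cast h4
  omega

/-- The Auslander–Bridger criterion. -/
theorem TotRefl.of_depth {g : ℕ} {M : Type u} [AddCommGroup M] [Module R M] [Module.Finite R M]
    (h : GdimLE R g M) (hM : depth R M = depth R R) : TotRefl R M := by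
  cases subsingleton_or_nontrivial M with
  | inl _ => exact totRefl_of_subsingleton
  | inr _ =>
    obtain ⟨t, ht⟩ := ENat.ne_top_iff_exists.1 (depth_self_ne_top (R := R))
    exact TotRefl.of_gdimLE h (subsingleton_ext_of_lt_depth R ht.le) (nontrivial_ext_depth ht.symm)
      (subsingleton_ext_of_lt_depth M (by rw [hM, ht]))

end Depth

end

/-! ### Complete resolutions of totally reflexive modules -/

section

variable {A : Type u} [CommRing A]

/-- Splicing syzygies and cosyzygies. -/
lemma TotRefl.exists_splice {M : ModuleCat.{u} A} (hM : TotRefl A M) :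
    ∃ (C Z : ℤ → ModuleCat.{u} A) (e : ∀ p, C p →ₗ[A] Z p) (i : ∀ p, Z p →ₗ[A] C (p + 1)),
      (∀ p, Module.Free A (C p)) ∧ (∀ p, Module.Finite A (C p)) ∧ (∀ p, TotRefl A (Z p)) ∧
      (∀ p, IsSES (i p) (e (p + 1))) ∧ Nonempty (Z 0 ≃ₗ[A] M) := by
  let T := {N : ModuleCat.{u} A // TotRefl A N}
  choose K F j π hF hFf hs hK _ using fun N : T => N.2.syzygy
  choose G N' i q hG hGf hc hN' using fun N : T => N.2.cosyzygy
  -- `left k` and `right k` are the `k`-th syzygy and cosyzygy of `M`; they become `Z (-k)` and `Z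
  -- k`. `C 0` is the free cover of `M`, so the change of regime lies between `C 0` and `C 1`.
  -- Recall that `Int.negSucc k` is `-(k + 1)`.
  let left : ℕ → T := fun k => Nat.rec ⟨M, hM⟩ (fun _ N => ⟨K N, hK N⟩) k
  let right : ℕ → T := fun k => Nat.rec ⟨M, hM⟩ (fun _ N => ⟨N' N, hN' N⟩) k
  let Z : ℤ → T := fun p => match p with
    | Int.ofNat k => right k
    | Int.negSucc k => left (k + 1)
  let C : ℤ → ModuleCat.{u} A := fun p => match p with
    | Int.ofNat 0 => F ⟨M, hM⟩
    | Int.ofNat (k + 1) => G (right k)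
    | Int.negSucc k => F (left (k + 1))
  let e : ∀ p, C p →ₗ[A] (Z p).1 := fun p => match p with
    | Int.ofNat 0 => π ⟨M, hM⟩
    | Int.ofNat (k + 1) => q (right k)
    | Int.negSucc k => π (left (k + 1))
  let i' : ∀ p, (Z p).1 →ₗ[A] C (p + 1) := fun p => match p with
    | Int.ofNat k => i (right k)
    | Int.negSucc 0 => j ⟨M, hM⟩
    | Int.negSucc (k + 1) => j (left (k + 1))
  refine ⟨C, fun p => (Z p).1, e, i', fun p => ?_, fun p => ?_, fun p => (Z p).2, fun p => ?_,
    ⟨LinearEquiv.refl A M⟩⟩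
  · match p with
    | Int.ofNat 0 => exact hF _
    | Int.ofNat (k + 1) => exact hG _
    | Int.negSucc k => exact hF _
  · match p with
    | Int.ofNat 0 => exact hFf _
    | Int.ofNat (k + 1) => exact hGf _
    | Int.negSucc k => exact hFf _
  · match p with
    | Int.ofNat k => exact hc _
    | Int.negSucc 0 => exact hs _
    | Int.negSucc (k + 1) => exact hs _

/-- Degrees are variables subject to equations, so that expressions such as `1 - (b + 1)` can be
substituted without transport. -/
lemma dualComplex_exactAt_iff (K : CochainComplex (ModuleCat.{u} A) ℤ) (p a b c : ℤ)
    (hp : p = 1 - b) (hab : a + 1 = b) (hbc : b + 1 = c) :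
    (dualComplex K).ExactAt p ↔ ∀ f : K.X b →ₗ[A] A, (∀ y, f ((K.d a b).hom y) = 0) →
      ∃ g : K.X c →ₗ[A] A, ∀ y, g ((K.d b c).hom y) = f y := by
  obtain rfl : b = 1 - p := by omega
  obtain rfl : a = 1 - (p + 1) := by omega
  obtain rfl : c = 1 - (p - 1) := by omega
  rw [HomologicalComplex.exactAt_iff' _ (p - 1) p (p + 1) (by simp) (by simp),
    ShortComplex.moduleCat_exact_iff]
  constructor
  · intro h f hf
    obtain ⟨g, hg⟩ := h f (LinearMap.ext hf)
    exact ⟨g, LinearMap.congr_fun hg⟩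
  · intro h f hf
    obtain ⟨g, hg⟩ := h f (LinearMap.congr_fun hf)
    exact ⟨g, LinearMap.ext hg⟩

lemma exists_dual_factor {K : CochainComplex (ModuleCat.{u} A) ℤ}
    (hK : ∀ p, (dualComplex K).ExactAt p) {a b c : ℤ} (hab : a + 1 = b) (hbc : b + 1 = c)
    (f : K.X b →ₗ[A] A) (hf : ∀ y, f ((K.d a b).hom y) = 0) :
    ∃ g : K.X c →ₗ[A] A, ∀ y, g ((K.d b c).hom y) = f y :=
  (dualComplex_exactAt_iff K (1 - b) a b c rfl hab hbc).1 (hK _) f hf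

/-- A totally reflexive module has a complete resolution. -/
theorem TotRefl.nonempty_completeResolution {M : ModuleCat.{u} A} (hM : TotRefl A M) :
    Nonempty (CompleteResolution M) := by
  obtain ⟨C, Z, e, i, hfree, hfin, hZ, hs, ⟨E⟩⟩ := hM.exists_splice
  have hsurj (p : ℤ) : Function.Surjective (e p) := by
    obtain ⟨p, rfl⟩ : ∃ q, p = q + 1 := ⟨p - 1, by omega⟩
    exact (hs p).surj
  let K : CochainComplex (ModuleCat.{u} A) ℤ := CochainComplex.of C
    (fun p => ModuleCat.ofHom (i p ∘ₗ e p)) (fun p => by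
      ext y
      change i (p + 1) (e (p + 1) (i p (e p y))) = 0
      rw [(hs p).apply_eq_zero, map_zero])
  have hd' (p : ℤ) (y : K.X p) : (K.d p (p + 1)).hom y = i p (e p y) := by
    have h : K.d p (p + 1) = ModuleCat.ofHom (i p ∘ₗ e p) :=
      CochainComplex.of_d C (fun p => ModuleCat.ofHom (i p ∘ₗ e p)) p
    rw [h]
    rfl
  refine ⟨⟨K, hfree, hfin, fun p => ?_, fun p => ?_, ModuleCat.ofHom (E.toLinearMap ∘ₗ e 0),
    ModuleCat.ofHom (i 0 ∘ₗ E.symm.toLinearMap), ?_, E.surjective.comp (hsurj 0),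
    (hs 0).inj.comp E.symm.injective⟩⟩
  · obtain ⟨p, rfl⟩ : ∃ q, p = q + 1 := ⟨p - 1, by omega⟩
    rw [HomologicalComplex.exactAt_iff' K p (p + 1) (p + 1 + 1) (by simp) (by simp)]
    refine (ShortComplex.moduleCat_exact_iff _).2 fun y hy => ?_
    have hy' : i (p + 1) (e (p + 1) y) = 0 := (hd' (p + 1) y).symm.trans hy
    obtain ⟨k, hk⟩ := ((hs p).exact y).1 ((hs (p + 1)).inj (hy'.trans (map_zero _).symm))
    obtain ⟨z, rfl⟩ := hsurj p k
    exact ⟨z, (hd' p z).trans hk⟩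
  · obtain ⟨b, rfl⟩ : ∃ b, p = 1 - (b + 1) := ⟨-p, by omega⟩
    rw [dualComplex_exactAt_iff K _ b (b + 1) (b + 1 + 1) (by omega) rfl rfl]
    intro f hf
    -- A functional that vanishes on boundaries factors through `Z (b + 1)`. It then extends along
    -- `Z (b + 1) → C (b + 2)` because `Ext¹(Z (b + 2), A) = 0`.
    obtain ⟨g, hg⟩ := exists_factor_linear (e (b + 1)) (hsurj _) f (fun y hy => by
      obtain ⟨k, rfl⟩ := ((hs b).exact y).1 hy
      obtain ⟨z, rfl⟩ := hsurj b k
      rw [← hd']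
      exact hf z)
    obtain ⟨h, hh⟩ := (hZ (b + 1 + 1)).exists_extend (hs (b + 1)) g
    refine ⟨h, fun y => ?_⟩
    rw [hd']
    exact (hh _).trans (hg y)
  · refine ModuleCat.hom_ext (LinearMap.ext fun y => ?_)
    refine Eq.trans ?_ (hd' 0 y).symm
    change i 0 (E.symm (E (e 0 y))) = _
    rw [E.symm_apply_apply]

variable {M : ModuleCat.{u} A}

lemma Augmentation.subsingleton_ext {K : CochainComplex (ModuleCat.{u} A) ℤ} (a : Augmentation K M)
    (Y : ModuleCat.{u} A) (n : ℕ)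
    (h : ∀ f : K.X (-((n + 1 : ℕ) : ℤ)) →ₗ[A] Y,
      (∀ y, f ((K.d (-((n + 2 : ℕ) : ℤ)) (-((n + 1 : ℕ) : ℤ))).hom y) = 0) →
      ∃ g : K.X (-(n : ℤ)) →ₗ[A] Y,
        ∀ y, g ((K.d (-((n + 1 : ℕ) : ℤ)) (-(n : ℤ))).hom y) = f y) :
    Subsingleton (Ext M Y (n + 1)) := by
  refine subsingleton_of_forall_eq 0 fun α => ?_
  obtain ⟨f, hf, rfl⟩ := a.resolution.extMk_surjective α (n + 2) rfl
  rw [a.resolution.extMk_eq_zero_iff f (n + 2) rfl hf n rfl]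
  obtain ⟨g, hg⟩ := h f.hom (fun y => congrArg (fun f => f.hom y) hf)
  exact ⟨ModuleCat.ofHom g, ModuleCat.hom_ext (LinearMap.ext hg)⟩

lemma exists_eq_eval (F : Type u) [AddCommGroup F] [Module A F] [Module.Free A F]
    [Module.Finite A F] (f : (F →ₗ[A] A) →ₗ[A] A) : ∃ y, ∀ h, f h = h y := by
  obtain ⟨y, hy⟩ := (Module.bijective_dual_eval A F).2 f
  exact ⟨y, fun h => (LinearMap.congr_fun hy h).symm⟩

lemma eq_zero_of_forall_dual (F : Type u) [AddCommGroup F] [Module A F] [Module.Free A F]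
    (y : F) (h : ∀ f : F →ₗ[A] A, f y = 0) : y = 0 := by
  apply (Module.Free.chooseBasis A F).ext_elem
  intro l
  rw [map_zero]
  exact h ((Module.Free.chooseBasis A F).coord l)

namespace CompleteResolution

/-- A functional `ξ` on `M^*`, pulled back to `Hom(C¹, A)`, is evaluation at some `y`. It kills the
functionals vanishing on `M`, so `y` is a cycle, say `y = d z`. As functionals on `M` extend to
`C¹`, `ξ` is evaluation at `ε z`. -/
lemma isReflexive (R : CompleteResolution M) : Module.IsReflexive A M := by
  have := R.free 1
  have := R.finite 1
  have := R.free 2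
  refine ⟨⟨?_, fun ξ => ?_⟩⟩
  · refine (injective_iff_map_eq_zero _).2 fun m hm => R.injective ?_
    rw [map_zero]
    exact eq_zero_of_forall_dual (A := A) _ _ fun f => LinearMap.congr_fun hm (f ∘ₗ R.ι.hom)
  · obtain ⟨y, hy⟩ := exists_eq_eval (R.C.X 1) (ξ ∘ₗ LinearMap.lcomp A A R.ι.hom)
    have hy0 : (R.C.d 1 2).hom y = 0 := by
      refine eq_zero_of_forall_dual (A := A) _ _ fun f => ?_
      have h1 := hy (f ∘ₗ (R.C.d 1 2).hom)
      have h2 : LinearMap.lcomp A A R.ι.hom (f ∘ₗ (R.C.d 1 2).hom) = 0 := by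
        refine LinearMap.ext fun m => ?_
        obtain ⟨z, rfl⟩ := R.surjective m
        change f ((R.C.d 1 2).hom (R.ι.hom (R.ε.hom z))) = 0
        rw [R.fac_apply, d_d_apply, map_zero]
      rw [LinearMap.comp_apply, h2, map_zero] at h1
      exact h1.symm
    obtain ⟨z, rfl⟩ := exists_of_exactAt R.C 0 1 2 rfl rfl (R.exact 1) y hy0
    refine ⟨R.ε.hom z, LinearMap.ext fun g => ?_⟩
    obtain ⟨h, rfl⟩ := R.right.surjective g
    refine Eq.trans ?_ (hy h).symm
    exact congrArg (show R.C.X 1 →ₗ[A] A from h) (R.fac_apply z)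

/-- A module with a complete resolution has Gorenstein dimension zero. -/
theorem gDimZero (R : CompleteResolution M) : GDimZero M := by
  refine ⟨R.isReflexive, fun n hn => ?_⟩
  obtain ⟨n, rfl⟩ := Nat.exists_eq_add_of_le' hn
  constructor
  · exact R.left.subsingleton_ext _ _ fun f hf =>
      exists_dual_factor R.dual_exact (by omega) (by omega) f hf
  · refine R.right.subsingleton_ext _ _ fun f hf => ?_
    have := R.free (1 - -((n + 1 : ℕ) : ℤ))
    have := R.finite (1 - -((n + 1 : ℕ) : ℤ))
    have := R.free (1 - -((n + 2 : ℕ) : ℤ))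
    -- Finite free modules are reflexive, so exactness of the double dual reduces to exactness of
    -- `C`.
    obtain ⟨y, hy⟩ := exists_eq_eval (R.C.X (1 - -((n + 1 : ℕ) : ℤ))) f
    obtain ⟨z, rfl⟩ := exists_of_exactAt R.C (1 - -(n : ℤ)) (1 - -((n + 1 : ℕ) : ℤ))
      (1 - -((n + 2 : ℕ) : ℤ)) (by omega) (by omega) (R.exact _) y
      (eq_zero_of_forall_dual (A := A) _ _ fun h => (hy _).symm.trans (hf h))
    exact ⟨LinearMap.applyₗ z, fun h => (hy h).symm⟩

end CompleteResolution

end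

/-! ### Products in `Ext` in terms of projective resolutions -/

section

universe w v' u'

variable {C : Type u'} [Category.{v'} C] [Preadditive C]

lemma equivHomShift_symm_f {K L : CochainComplex C ℤ} {n : ℤ} (z : Cocycle K L n) (p q : ℤ)
    (h : p + n = q) : (Cocycle.equivHomShift.symm z).f p =
      z.1.v p q h ≫ (L.shiftFunctorObjXIso n p q h.symm).inv := by
  subst h
  rw [Cocycle.equivHomShift_symm_apply]
  change (z.1.rightShift n 0 (zero_add n)).v p p (add_zero p) = _
  rw [Cochain.rightShift_v _ _ _ _ _ _ _ (p + n) rfl]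

/-- Products in `Ext` compose shifted morphisms, whereas chain maps of nonzero degree compose as
cochains; the two agree. -/
lemma equivHomShift_symm_comp {K L N : CochainComplex C ℤ} {n m l : ℤ} (z₁ : Cocycle K L n)
    (z₂ : Cocycle L N m) (h : n + m = l) (z : Cocycle K N l) (hz : z.1 = z₁.1.comp z₂.1 h) :
    Cocycle.equivHomShift.symm z = ShiftedHom.comp (Cocycle.equivHomShift.symm z₁)
      (Cocycle.equivHomShift.symm z₂) (by omega) := by
  ext p
  rw [equivHomShift_symm_f z p (p + n + m) (by omega), hz,
    Cochain.comp_v _ _ h p (p + n) (p + n + m) rfl rfl, ShiftedHom.comp,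
    HomologicalComplex.comp_f, HomologicalComplex.comp_f, equivHomShift_symm_f z₁ p (p + n) rfl,
    CochainComplex.shiftFunctor_map_f', equivHomShift_symm_f z₂ (p + n) (p + n + m) rfl]
  simp [CochainComplex.shiftFunctorAdd'_inv_app_f']
  erw [Category.comp_id, Category.comp_id]
  rfl

end

section

universe w v' u'

/-- In a product of classes, the augmentation that ends the first factor meets its inverse in the
derived category at the start of the second; `hπ` cancels them. -/
lemma shiftedHom_comp_cancel {D : Type u'} [Category.{v'} D] [HasShift D ℤ] {X R S Y Y' Z' Z : D}
    {n m l : ℤ} (i : X ⟶ R) (z : ShiftedHom R S n) (π : S ⟶ Y') (s : Y' ⟶ Y) (t : Y ⟶ S)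
    (x : ShiftedHom S Z' m) (r : Z' ⟶ Z) (hπ : π ≫ s ≫ t = 𝟙 S) (h : m + n = l) :
    ((ShiftedHom.mk₀ 0 rfl i).comp ((ShiftedHom.comp z (ShiftedHom.mk₀ 0 rfl π) (zero_add n)).comp
      (ShiftedHom.mk₀ 0 rfl s) (zero_add n)) (add_zero n)).comp
      ((ShiftedHom.mk₀ 0 rfl t).comp (x.comp (ShiftedHom.mk₀ 0 rfl r) (zero_add m)) (add_zero m)) h =
    (ShiftedHom.mk₀ 0 rfl i).comp ((z.comp x h).comp (ShiftedHom.mk₀ 0 rfl r) (zero_add l))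
      (add_zero l) := by
  have hπ' := congrArg (fun f => (shiftFunctor D n).map f) hπ
  simp only [Functor.map_comp, CategoryTheory.Functor.map_id] at hπ'
  simp only [ShiftedHom.comp_mk₀, ShiftedHom.mk₀_comp]
  unfold ShiftedHom.comp
  simp only [Functor.map_comp, Category.assoc]
  rw [reassoc_of% hπ']
  congr 3
  exact (shiftFunctorAdd' D m n l h).inv.naturality r

lemma comp_inv_hom_comp_inv_hom {C : Type u'} [Category.{v'} C] {X₁ X₂ X₃ X₄ Y₁ Y₂ : C} (a : X₁ ⟶ X₂)
    (b : X₂ ⟶ X₃) (c : X₃ ⟶ X₄) (e : Y₁ ≅ X₃) (e' : Y₂ ≅ X₄) :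
    ((a ≫ b ≫ e.inv) ≫ e.hom ≫ c ≫ e'.inv) ≫ e'.hom = a ≫ b ≫ c := by
  simp

variable {C : Type u'} [Category.{v'} C] [Abelian C] {X Y Z : C}

/-- The cocycle defined by a family of maps between projective resolutions. -/
noncomputable def resolutionCochain (R : ProjectiveResolution X) (S : ProjectiveResolution Y) (n : ℕ)
    (f : ∀ k j : ℕ, j = k + n → (R.complex.X j ⟶ S.complex.X k)) :
    Cochain R.cochainComplex S.cochainComplex n :=
  Cochain.mk fun p q hpq => if h : q ≤ 0 then
    (R.cochainComplexXIso p (-p).toNat (by omega)).hom ≫ f (-q).toNat (-p).toNat (by omega) ≫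
      (S.cochainComplexXIso q (-q).toNat (by omega)).inv else 0

variable (R : ProjectiveResolution X) (S : ProjectiveResolution Y) {n : ℕ}
    (f : ∀ k j : ℕ, j = k + n → (R.complex.X j ⟶ S.complex.X k))

lemma resolutionCochain_v (p q : ℤ) (hpq : p + n = q) (j k : ℕ) (hj : -(j : ℤ) = p)
    (hk : -(k : ℤ) = q) : (resolutionCochain R S n f).v p q hpq =
      (R.cochainComplexXIso p j hj).hom ≫ f k j (by omega) ≫ (S.cochainComplexXIso q k hk).inv := by
  obtain rfl : j = (-p).toNat := by omega
  obtain rfl : k = (-q).toNat := by omega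
  exact dif_pos (by omega)

variable (hn : Even n)
  (hf : ∀ k j (h : j = k + n), R.complex.d (j + 1) j ≫ f k j h =
    f (k + 1) (j + 1) (by omega) ≫ S.complex.d (k + 1) k)
include hn hf

lemma δ_resolutionCochain : δ (n : ℤ) (n + 1) (resolutionCochain R S n f) = 0 := by
  ext p q hpq
  have hsign : ((n : ℤ) + 1).negOnePow = -1 := by
    rw [Int.negOnePow_succ, Int.negOnePow_even _ (by exact_mod_cast hn)]
  rw [δ_v _ _ rfl _ p q hpq (q - 1) (p + 1) (by omega) (by omega), Cochain.zero_v, hsign]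
  by_cases hq : q ≤ 0
  · obtain ⟨k, hk⟩ : ∃ k : ℕ, -(k : ℤ) = q := ⟨(-q).toNat, by omega⟩
    rw [resolutionCochain_v R S f p (q - 1) (by omega) (k + 1 + n) (k + 1) (by push_cast; omega)
        (by push_cast; omega),
      resolutionCochain_v R S f (p + 1) q (by omega) (k + n) k (by push_cast; omega) hk,
      R.cochainComplex_d p (p + 1) (k + 1 + n) (k + n) (by push_cast; omega) (by push_cast; omega),
      S.cochainComplex_d (q - 1) q (k + 1) k (by push_cast; omega) hk]
    have h1 := hf k (k + n) rfl
    have e : k + n + 1 = k + 1 + n := by omega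
    have h2 : ∀ (j : ℕ) (e : j = k + 1 + n), R.complex.d j (k + n) ≫ f k (k + n) rfl =
      f (k + 1) j e ≫ S.complex.d (k + 1) k := by
      intro j e
      obtain rfl : j = k + n + 1 := by omega
      exact h1
    have h3 := h2 _ rfl
    simp only [Category.assoc, Iso.inv_hom_id_assoc, Units.neg_smul, one_smul]
    rw [reassoc_of% h3, add_neg_cancel]
  · exact (CochainComplex.isZero_of_isStrictlyLE S.cochainComplex 0 q (by omega)).eq_of_tgt _ _

variable [HasExt.{w} C]

/-- The product of two classes on projective resolutions, given a lift of the first one. -/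
theorem extMk_comp_extMk {m : ℕ} (g : S.complex.X m ⟶ Z) (hg : S.complex.d (m + 1) m ≫ g = 0)
    (hf0 : R.complex.d (n + 1) n ≫ (f 0 n (by omega) ≫ S.π.f 0 : _ ⟶ Y) = 0)
    (hfg : R.complex.d (n + m + 1) (n + m) ≫ f m (n + m) (by omega) ≫ g = 0) :
    (R.extMk (f 0 n (by omega) ≫ S.π.f 0 : _ ⟶ Y) (n + 1) rfl hf0).comp
        (S.extMk g (m + 1) rfl hg) rfl =
      R.extMk (f m (n + m) (by omega) ≫ g) (n + m + 1) rfl hfg := by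
  have := HasDerivedCategory.standard C
  let z : Cocycle R.cochainComplex S.cochainComplex n :=
    Cocycle.mk (resolutionCochain R S n f) _ rfl (δ_resolutionCochain R S f hn hf)
  have hz (p q : ℤ) (hpq : p + n = q) (j k : ℕ) (hj : -(j : ℤ) = p)
    (hk : -(k : ℤ) = q) : z.1.v p q hpq =
      (R.cochainComplexXIso p j hj).hom ≫ f k j (by omega) ≫ (S.cochainComplexXIso q k hk).inv :=
    resolutionCochain_v R S f p q hpq j k hj hk
  let x := Cocycle.toSingleMk (n := (m : ℤ)) (q := 0) ((S.cochainComplexXIso (-m) m rfl).hom ≫ g)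
    (by simp) (-((m + 1 : ℕ) : ℤ)) (by push_cast; omega)
    (by rw [S.cochainComplex_d _ _ (m + 1) m rfl rfl]; simp [hg])
  -- The first class is represented by `z` followed by the augmentation of `S`, and the second by
  -- `x`. The product is therefore represented by `z` followed by `x`.
  have h1 : Cocycle.toSingleMk (n := (n : ℤ)) (q := 0)
      ((R.cochainComplexXIso (-n) n rfl).hom ≫ (f 0 n (by omega) ≫ S.π.f 0 : _ ⟶ Y))
      (by simp) (-((n + 1 : ℕ) : ℤ)) (by push_cast; omega)
      (by rw [R.cochainComplex_d _ _ (n + 1) n rfl rfl]; simp [hf0]) = z.postcomp S.π' := by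
    ext : 1
    apply (Cochain.toSingleEquiv (p := -(n : ℤ)) (by simp)).injective
    simp only [Cocycle.postcomp, Cocycle.toSingleMk_coe, Cochain.toSingleEquiv_toSingleMk]
    change _ = ((z.1.comp (Cochain.ofHom S.π') (add_zero _)).v (-(n : ℤ)) 0 (by simp)) ≫ _
    rw [Cochain.comp_v _ _ _ (-(n : ℤ)) 0 0 (by simp) (by simp),
      hz _ 0 _ n 0 rfl (by simp), Cochain.ofHom_v, S.π'_f_zero]
    exact (comp_inv_hom_comp_inv_hom _ _ _ _ _).symm
  have h2 : (Cocycle.toSingleMk (n := ((n + m : ℕ) : ℤ)) (q := 0)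
      ((R.cochainComplexXIso (-((n + m : ℕ) : ℤ)) (n + m) rfl).hom ≫ f m (n + m) (by omega) ≫ g)
      (by simp) (-((n + m + 1 : ℕ) : ℤ)) (by push_cast; omega)
      (by rw [R.cochainComplex_d _ _ (n + m + 1) (n + m) rfl rfl]; simp [hfg])).1 =
        z.1.comp x.1 (by simp) := by
    apply (Cochain.toSingleEquiv (p := -((n + m : ℕ) : ℤ)) (by simp)).injective
    simp only [x, Cocycle.toSingleMk_coe, Cochain.toSingleEquiv_toSingleMk]
    change _ = _ ≫ _
    rw [Cochain.comp_v _ _ _ (-((n + m : ℕ) : ℤ)) (-m) 0 (by push_cast; omega) (by simp),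
     hz _ _ _ (n + m) m rfl rfl, Cochain.toSingleMk_v, Category.assoc _ g]
    exact (comp_inv_hom_comp_inv_hom _ _ _ _ _).symm
  ext
  rw [Ext.comp_hom, ProjectiveResolution.extMk_hom, ProjectiveResolution.extMk_hom,
    ProjectiveResolution.extMk_hom, h1, equivHomShift_symm_comp z x (by simp) _ h2,
    Cocycle.equivHomShift_symm_postcomp, ← ShiftedHom.comp_mk₀ _ 0 rfl, ShiftedHom.map_comp,
    ShiftedHom.map_comp, ShiftedHom.map_mk₀]
  exact shiftedHom_comp_cancel _ _ _ _ _ _ _ (by simp) _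

end

/-! ### Liftings of free modules and of their maps -/

section

variable {B : Type u} [CommRing B] {c : ℕ}

/-- A free `B`-module lifting an `A`-module, where `A = B/(x₁, …, x_c)`. -/
structure Reduction (A : Type u) [CommRing A] [Algebra B A] (x : Fin c → B) (X : Type u)
    [AddCommGroup X] [Module A X] where
  L : ModuleCat.{u} B
  free : Module.Free B L
  proj : L →ₛₗ[algebraMap B A] X
  surjective : Function.Surjective proj
  proj_eq_zero_iff : ∀ y : L,
    proj y = 0 ↔ y ∈ Ideal.span (Set.range x) • (⊤ : Submodule B L)

variable {A : Type u} [CommRing A] [Algebra B A]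

/-- The reduction of degree `n` of a lifting of a complex. -/
def Lifting.reduction {x : Fin c → B} {F : ChainComplex (ModuleCat.{u} A) ℕ} (E : Lifting x F)
    (n : ℕ) : Reduction A x (F.X n) :=
  ⟨E.L n, E.free n, E.proj n, E.proj_surjective n, E.proj_eq_zero_iff n⟩

variable {x : Fin c → B} {X X' : Type u} [AddCommGroup X] [Module A X] [AddCommGroup X']
  [Module A X']

/-- The `B`-linear map `g'` lifts the `A`-linear map `g`. -/
def Lifts (r : Reduction A x X) (r' : Reduction A x X') (g' : r.L →ₗ[B] r'.L) (g : X →ₗ[A] X') : Prop :=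
  ∀ y, r'.proj (g' y) = g (r.proj y)

lemma exists_lifts (r : Reduction A x X) (r' : Reduction A x X') (g : X →ₗ[A] X') :
    ∃ g', Lifts r r' g' g := by
  have := r.free
  let e := Module.Free.chooseBasis B r.L
  choose s hs using r'.surjective
  refine ⟨e.constr ℕ fun j => s (g (r.proj (e j))), fun y => ?_⟩
  have : r'.proj.comp (e.constr ℕ fun j => s (g (r.proj (e j)))) = g.comp r.proj :=
    e.ext fun j => by simp [hs]
  exact LinearMap.congr_fun this y

lemma exists_lifts_of_linear (hs : Function.Surjective (algebraMap B A)) (r : Reduction A x X)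
    (r' : Reduction A x X') (g' : r.L →ₗ[B] r'.L) : ∃ g, Lifts r r' g' g := by
  obtain ⟨g, hg⟩ := exists_factor hs r.proj r.surjective (r'.proj.comp g') fun y hy =>
    (r'.proj_eq_zero_iff _).2 (Submodule.smul_mono le_rfl le_top
      (Submodule.map_smul'' _ _ g' ▸ Submodule.mem_map_of_mem ((r.proj_eq_zero_iff y).1 hy)))
  exact ⟨g, fun y => (hg y).symm⟩

lemma Lifts.ext {r : Reduction A x X} {r' : Reduction A x X'} {g' : r.L →ₗ[B] r'.L} {g h : X →ₗ[A] X'}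
    (hg : Lifts r r' g' g) (hh : Lifts r r' g' h) : g = h := by
  ext y
  obtain ⟨y, rfl⟩ := r.surjective y
  rw [← hg, ← hh]

lemma exists_eq_sum_smul (r : Reduction A x X) (r' : Reduction A x X') {g' : r.L →ₗ[B] r'.L}
    (h : Lifts r r' g' 0) : ∃ z : Fin c → (r.L →ₗ[B] r'.L), ∀ y, g' y = ∑ i, x i • z i y := by
  have := r.free
  let e := Module.Free.chooseBasis B r.L
  choose z hz using fun j => exists_of_mem_smul_top x _ ((r'.proj_eq_zero_iff _).1 (h (e j)))
  refine ⟨fun i => e.constr ℕ fun j => z j i, fun y => ?_⟩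
  have : g' = ∑ i, x i • e.constr ℕ fun j => z j i := e.ext fun j => by simp [hz]
  simpa using LinearMap.congr_fun this y

lemma proj_eq_zero_of_sum_eq_zero (hx : RingTheory.Sequence.IsRegular B (List.ofFn x))
    (r : Reduction A x X) (b : Fin c → r.L) (hb : ∑ i, x i • b i = 0) (i : Fin c) :
    r.proj (b i) = 0 := by
  have := r.free
  exact (r.proj_eq_zero_iff _).2 (mem_of_sum_eq_zero_free x hx.toIsWeaklyRegular b hb i)

end

section

variable {B A : Type u} [CommRing B] [CommRing A] [Algebra B A] {c : ℕ}

/-- The maps `tᵢ : X₂ → X₀` are obtained from liftings of `X₂ → X₁ → X₀` to `B`. -/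
def IsOperator (x : Fin c → B) {X₂ X₁ X₀ : Type u} [AddCommGroup X₂] [Module A X₂] [AddCommGroup X₁]
    [Module A X₁] [AddCommGroup X₀] [Module A X₀] (d₁ : X₂ →ₗ[A] X₁) (d₀ : X₁ →ₗ[A] X₀)
    (t : Fin c → (X₂ →ₗ[A] X₀)) : Prop :=
  ∃ (r₂ : Reduction A x X₂) (r₁ : Reduction A x X₁) (r₀ : Reduction A x X₀) (d₁' : r₂.L →ₗ[B] r₁.L)
    (d₀' : r₁.L →ₗ[B] r₀.L) (t' : Fin c → (r₂.L →ₗ[B] r₀.L)), Lifts r₂ r₁ d₁' d₁ ∧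
    Lifts r₁ r₀ d₀' d₀ ∧ (∀ i, Lifts r₂ r₀ (t' i) (t i)) ∧ ∀ y, d₀' (d₁' y) = ∑ i, x i • t' i y

lemma Lifting.isOperator {x : Fin c → B} {F : ChainComplex (ModuleCat.{u} A) ℕ} (E : Lifting x F)
    (n : ℕ) : IsOperator x (F.d (n + 2) (n + 1)).hom (F.d (n + 1) n).hom fun i => (E.t i n).hom :=
  ⟨E.reduction _, E.reduction _, E.reduction _, E.d _, E.d _, fun i => E.tl i n, E.proj_d _,
    E.proj_d _, fun i y => (E.t_proj i n y).symm, E.d_d n⟩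

/-- The operators commute with maps of complexes up to homotopy. -/
lemma IsOperator.exists_homotopy (hs : Function.Surjective (algebraMap B A)) {x : Fin c → B}
    (hx : RingTheory.Sequence.IsRegular B (List.ofFn x)) {X₂ X₁ X₀ Y₂ Y₁ Y₀ : Type u}
    [AddCommGroup X₂] [Module A X₂] [AddCommGroup X₁] [Module A X₁] [AddCommGroup X₀] [Module A X₀]
    [AddCommGroup Y₂] [Module A Y₂] [AddCommGroup Y₁] [Module A Y₁] [AddCommGroup Y₀] [Module A Y₀]
    {d₁ : X₂ →ₗ[A] X₁} {d₀ : X₁ →ₗ[A] X₀} {t : Fin c → (X₂ →ₗ[A] X₀)} (ht : IsOperator x d₁ d₀ t)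
    {e₁ : Y₂ →ₗ[A] Y₁} {e₀ : Y₁ →ₗ[A] Y₀} {s : Fin c → (Y₂ →ₗ[A] Y₀)} (hs' : IsOperator x e₁ e₀ s)
    (f₂ : X₂ →ₗ[A] Y₂) (f₁ : X₁ →ₗ[A] Y₁) (f₀ : X₀ →ₗ[A] Y₀) (h₁ : ∀ y, e₁ (f₂ y) = f₁ (d₁ y))
    (h₀ : ∀ y, e₀ (f₁ y) = f₀ (d₀ y)) (i : Fin c) :
    ∃ (k₁ : X₁ →ₗ[A] Y₀) (k₂ : X₂ →ₗ[A] Y₁), ∀ y, s i (f₂ y) = f₀ (t i y) + k₁ (d₁ y) + e₀ (k₂ y) := by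
  obtain ⟨r₂, r₁, r₀, d₁', d₀', t', hd₁, hd₀, ht, hdd⟩ := ht
  obtain ⟨q₂, q₁, q₀, e₁', e₀', s', he₁, he₀, hs', hee⟩ := hs'
  obtain ⟨f₂', hf₂⟩ := exists_lifts r₂ q₂ f₂
  obtain ⟨f₁', hf₁⟩ := exists_lifts r₁ q₁ f₁
  obtain ⟨f₀', hf₀⟩ := exists_lifts r₀ q₀ f₀
  obtain ⟨z₂, hz₂⟩ := exists_eq_sum_smul r₂ q₁ (g' := e₁' ∘ₗ f₂' - f₁' ∘ₗ d₁') fun y => by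
    simp [he₁ _, hf₂ _, hf₁ _, hd₁ _, h₁]
  obtain ⟨z₁, hz₁⟩ := exists_eq_sum_smul r₁ q₀ (g' := e₀' ∘ₗ f₁' - f₀' ∘ₗ d₀') fun y => by
    simp [he₀ _, hf₁ _, hf₀ _, hd₀ _, h₀]
  obtain ⟨k₂, hk₂⟩ := exists_lifts_of_linear hs r₂ q₁ (z₂ i)
  obtain ⟨k₁, hk₁⟩ := exists_lifts_of_linear hs r₁ q₀ (z₁ i)
  refine ⟨k₁, k₂, fun y => ?_⟩
  obtain ⟨y, rfl⟩ := r₂.surjective y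
  -- The lifted `f` commutes with the lifted differentials up to `∑ xᵢ z₂ᵢ` and `∑ xᵢ z₁ᵢ`.
  -- Expanding `e₀' e₁' f₂'` in two ways gives a relation on the regular sequence, whose
  -- coefficients vanish after reduction.
  have key : ∑ i, x i • (s' i (f₂' y) - (f₀' (t' i y) + z₁ i (d₁' y) + e₀' (z₂ i y))) = 0 := by
    have h2 := congrArg e₀' (hz₂ y)
    have h1 := hz₁ (d₁' y)
    simp only [LinearMap.sub_apply, LinearMap.comp_apply, map_sub, map_sum, map_smul, hdd] at h1 h2
    simp only [smul_sub, smul_add, Finset.sum_sub_distrib, Finset.sum_add_distrib, ← hee, ← h1, ← h2]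
    abel
  have := proj_eq_zero_of_sum_eq_zero hx q₀ _ key i
  rw [map_sub, sub_eq_zero, map_add, map_add, hs' i, hf₀, hk₁, he₀, ht i, hk₂, hd₁, hf₂] at this
  exact this

end

/-! ### Comparison and commutation of the operators -/

section

universe w v' u'

lemma extMk_eq_extMk {C : Type u'} [Category.{v'} C] [Abelian C] [HasExt.{w} C] {X Y : C}
    (R : ProjectiveResolution X) {n : ℕ} (f g : R.complex.X (n + 1) ⟶ Y) (k : R.complex.X n ⟶ Y)
    (h : f = g + R.complex.d (n + 1) n ≫ k) (hf : R.complex.d (n + 2) (n + 1) ≫ f = 0)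
    (hg : R.complex.d (n + 2) (n + 1) ≫ g = 0) :
    R.extMk f (n + 2) rfl hf = R.extMk g (n + 2) rfl hg := by
  rw [← sub_eq_zero, R.sub_extMk, R.extMk_eq_zero_iff _ _ _ _ n rfl]
  exact ⟨k, by rw [h, add_sub_cancel_left]⟩

end

section

variable {B A : Type u} [CommRing B] [CommRing A] [Algebra B A] {c : ℕ} {x : Fin c → B}
  (hs : Function.Surjective (algebraMap B A))
  (hx : RingTheory.Sequence.IsRegular B (List.ofFn x)) {M : ModuleCat.{u} A}
include hs hx

/-- The classes of the operators do not depend on the resolution. -/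
theorem extMk_eq_of_isOperator (P Q : ProjectiveResolution M)
    {t : Fin c → (P.complex.X 2 ⟶ P.complex.X 0)} {s : Fin c → (Q.complex.X 2 ⟶ Q.complex.X 0)}
    (ht : IsOperator x (P.complex.d 2 1).hom (P.complex.d 1 0).hom fun i => (t i).hom)
    (hs' : IsOperator x (Q.complex.d 2 1).hom (Q.complex.d 1 0).hom fun i => (s i).hom) (i : Fin c)
    (hP : P.complex.d 3 2 ≫ (t i ≫ P.π.f 0 : _ ⟶ M) = 0)
    (hQ : Q.complex.d 3 2 ≫ (s i ≫ Q.π.f 0 : _ ⟶ M) = 0) :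
    P.extMk (t i ≫ P.π.f 0 : _ ⟶ M) 3 rfl hP = Q.extMk (s i ≫ Q.π.f 0 : _ ⟶ M) 3 rfl hQ := by
  let f := ProjectiveResolution.lift (𝟙 M) P Q
  have hf : f.f 0 ≫ Q.π.f 0 = P.π.f 0 := by
    exact (ProjectiveResolution.lift_commutes_zero (𝟙 M) P Q).trans (Category.comp_id _)
  let φ : ProjectiveResolution.Hom P Q (𝟙 M) := ⟨f, hf.trans (Category.comp_id _).symm⟩
  rw [← Ext.mk₀_id_comp (Q.extMk _ _ _ _), Q.mk₀_comp_extMk _ _ _ _ φ]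
  -- Of the two homotopy terms, the one with `k₁` is a coboundary and the one with `k₂` dies under
  -- the augmentation.
  obtain ⟨k₁, k₂, hk⟩ := ht.exists_homotopy hs hx hs' (f.f 2).hom (f.f 1).hom (f.f 0).hom
    (fun y => congrArg (fun g => g.hom y) (f.comm 2 1))
    (fun y => congrArg (fun g => g.hom y) (f.comm 1 0)) i
  refine (extMk_eq_extMk P _ _ (ModuleCat.ofHom k₁ ≫ Q.π.f 0 : _ ⟶ M) ?_ _ _).symm
  have h1 : f.f 2 ≫ s i = t i ≫ f.f 0 + P.complex.d 2 1 ≫ ModuleCat.ofHom k₁ +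
      ModuleCat.ofHom k₂ ≫ Q.complex.d 1 0 := by
    ext y
    exact hk y
  have h2 := congrArg (· ≫ Q.π.f 0) h1
  simp only [Preadditive.add_comp, Category.assoc, Q.complex_d_comp_π_f_zero, Limits.comp_zero,
    add_zero, hf] at h2
  exact h2

lemma operator_eq_extMk (P Q : ProjectiveResolution M) (E : Lifting x P.complex)
    {s : Fin c → (Q.complex.X 2 ⟶ Q.complex.X 0)}
    (hs' : IsOperator x (Q.complex.d 2 1).hom (Q.complex.d 1 0).hom fun i => (s i).hom) (i : Fin c)
    (hQ : Q.complex.d 3 2 ≫ (s i ≫ Q.π.f 0 : _ ⟶ M) = 0) :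
    operator hx P E i = Q.extMk (s i ≫ Q.π.f 0 : _ ⟶ M) 3 rfl hQ :=
  extMk_eq_of_isOperator hs hx P Q (E.isOperator 0) hs' i _ _

/-- The operators commute. -/
theorem operator_comp_operator (P : ProjectiveResolution M) (E : Lifting x P.complex) (i j : Fin c) :
    (operator hx P E i).comp (operator hx P E j) (show 2 + 2 = 4 from rfl) =
      (operator hx P E j).comp (operator hx P E i) (show 2 + 2 = 4 from rfl) := by
  have h0 (j : Fin c) : P.complex.d 3 2 ≫ (E.t j 0 ≫ P.π.f 0 : _ ⟶ M) = 0 := by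
    have h : (P.complex.d 3 2 ≫ E.t j 0) ≫ P.π.f 0 = 0 := by
      rw [E.t_comm hx j 0, Category.assoc, P.complex_d_comp_π_f_zero, Limits.comp_zero]
    exact (Category.assoc _ _ _).symm.trans h
  have h2 (i j : Fin c) : P.complex.d 5 4 ≫ (E.t i 2 ≫ E.t j 0 ≫ P.π.f 0 : _ ⟶ M) = 0 := by
    have h := E.t_comm hx i 2
    have h3 := congrArg (· ≫ (E.t j 0 ≫ P.π.f 0 : _ ⟶ M)) h
    refine (Category.assoc _ _ _).symm.trans (h3.trans ?_)
    refine (Category.assoc _ _ _).trans ?_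
    rw [h0, Limits.comp_zero]
  have key (i j : Fin c) : (operator hx P E i).comp (operator hx P E j) (show 2 + 2 = 4 from rfl) =
      P.extMk (E.t i 2 ≫ E.t j 0 ≫ P.π.f 0 : _ ⟶ M) 5 rfl (h2 i j) :=
    extMk_comp_extMk P P (n := 2) (m := 2) (fun k l h => h ▸ E.t i k) (by decide)
      (fun k l h => by subst h; exact E.t_comm hx i k) _ _ (h0 i) (h2 i j)
  rw [key, key]
  -- The chain map in the comparison is `tᵢ` itself, from degrees `4, 3, 2` to degrees `2, 1, 0`,
  -- and the operator compared is `tⱼ`.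
  obtain ⟨k₁, k₂, hk⟩ := (E.isOperator 2).exists_homotopy hs hx (E.isOperator 0) (E.t i 2).hom
    (E.t i 1).hom (E.t i 0).hom
    (fun y => (congrArg (fun g => g.hom y) (E.t_comm hx i 1)).symm)
    (fun y => (congrArg (fun g => g.hom y) (E.t_comm hx i 0)).symm) j
  refine extMk_eq_extMk P _ _ (ModuleCat.ofHom k₁ ≫ P.π.f 0 : _ ⟶ M) ?_ _ _
  have h1 : E.t i 2 ≫ E.t j 0 = E.t j 2 ≫ E.t i 0 + P.complex.d 4 3 ≫ ModuleCat.ofHom k₁ +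
      ModuleCat.ofHom k₂ ≫ P.complex.d 1 0 := by
    ext y
    exact hk y
  have h2 := congrArg (· ≫ P.π.f 0) h1
  simp only [Preadditive.add_comp, Category.assoc, P.complex_d_comp_π_f_zero, Limits.comp_zero,
    add_zero] at h2
  exact h2

end

/-! ### Liftings of finitely generated free modules and of their duals -/

section

variable {B A : Type u} [CommRing B] [CommRing A] [Algebra B A] {c : ℕ} {x : Fin c → B}
  (hs : Function.Surjective (algebraMap B A))
  (hk : RingHom.ker (algebraMap B A) = Ideal.span (Set.range x))
include hs hk

lemma exists_reduction (X : Type u) [AddCommGroup X] [Module A X] [Module.Free A X]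
    [Module.Finite A X] : ∃ r : Reduction A x X, Module.Finite B r.L := by
  obtain ⟨n, ⟨e⟩⟩ := exists_equiv_fin A X
  refine ⟨⟨ModuleCat.of B (Fin n → B), inferInstanceAs (Module.Free B (Fin n → B)),
    e.symm.toLinearMap.comp (red (algebraMap B A) n), e.symm.surjective.comp (red_surjective hs n),
    fun y => ?_⟩, (inferInstance : Module.Finite B (Fin n → B))⟩
  change e.symm (red (algebraMap B A) n y) = 0 ↔ _
  rw [map_eq_zero_iff _ e.symm.injective]
  constructor
  · intro h
    rw [pi_eq_sum_univ' (show Fin n → B from y)]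
    refine Submodule.sum_mem _ fun m _ => Submodule.smul_mem_smul ?_ trivial
    rw [← hk]
    exact congrFun h m
  · intro h
    induction h using Submodule.smul_induction_on' with
    | smul r hr m _ =>
      rw [← hk] at hr
      rw [map_smulₛₗ, (RingHom.mem_ker).1 hr, zero_smul]
    | add y _ z _ hy hz => rw [map_add, hy, hz, add_zero]

variable {X : Type u} [AddCommGroup X] [Module A X]

/-- Finiteness makes `Hom_B(L, B)` free. A functional on `L` reducing to zero has its values in
`(x)`; as `L` is free, it then lies in `(x) Hom_B(L, B)`. -/
lemma exists_dual_reduction (r : Reduction A x X) (hr : Module.Finite B r.L) :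
    ∃ r' : Reduction A x (X →ₗ[A] A), ∃ e : (r.L →ₗ[B] B) ≃ₗ[B] r'.L,
      ∀ φ y, r'.proj (e φ) (r.proj y) = algebraMap B A (φ y) := by
  have := r.free
  have hIB (b : B) : algebraMap B A b = 0 ↔ b ∈ Ideal.span (Set.range x) • (⊤ : Submodule B B) := by
    rw [smul_eq_mul, Ideal.mul_top, ← hk, RingHom.mem_ker]
  let rA : Reduction A x A := ⟨ModuleCat.of B B, inferInstanceAs (Module.Free B B),
    ⟨⟨algebraMap B A, map_add _⟩, fun b y => map_mul _ _ _⟩, hs, hIB⟩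
  choose p hp using fun φ : r.L →ₗ[B] B => exists_lifts_of_linear hs r rA φ
  refine ⟨⟨ModuleCat.of B (r.L →ₗ[B] B), inferInstanceAs (Module.Free B (r.L →ₗ[B] B)),
    ⟨⟨p, fun φ ψ => ?_⟩, fun b φ => ?_⟩, fun g => ?_, fun φ => ?_⟩, LinearEquiv.refl _ _, fun φ y =>
    (hp φ y).symm⟩
  · exact (hp _).ext fun y => (map_add (algebraMap B A) _ _).trans
      (congrArg₂ _ (hp φ y) (hp ψ y))
  · exact (hp _).ext fun y => (map_mul (algebraMap B A) _ _).trans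
      (congrArg (algebraMap B A b * ·) (hp φ y))
  · obtain ⟨φ, hφ⟩ := exists_lifts r rA g
    exact ⟨φ, (hp _).ext hφ⟩
  · change p φ = 0 ↔ _
    constructor
    · intro h
      obtain ⟨z, hz⟩ := exists_eq_sum_smul r rA (g' := φ) (h ▸ hp φ)
      have : φ = ∑ i, x i • (show r.L →ₗ[B] B from z i) := LinearMap.ext fun y => by
        rw [LinearMap.sum_apply]
        exact hz y
      rw [this]
      exact Submodule.sum_mem _ fun i _ =>
        Submodule.smul_mem_smul (Ideal.subset_span ⟨i, rfl⟩) trivial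
    · intro h
      refine (hp _).ext fun y => (hIB _).2 ?_
      exact Submodule.smul_mono le_rfl le_top (Submodule.map_smul'' _ _
        (LinearMap.applyₗ y : (r.L →ₗ[B] B) →ₗ[B] B) ▸ Submodule.mem_map_of_mem h)

/-- Transposes of operators are operators. -/
lemma isOperator_dual {X₂ X₁ X₀ : Type u} [AddCommGroup X₂] [Module A X₂] [AddCommGroup X₁]
    [Module A X₁] [AddCommGroup X₀] [Module A X₀] {d₁ : X₂ →ₗ[A] X₁} {d₀ : X₁ →ₗ[A] X₀}
    {t : Fin c → (X₂ →ₗ[A] X₀)} (r₂ : Reduction A x X₂) (r₁ : Reduction A x X₁)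
    (r₀ : Reduction A x X₀) (h₂ : Module.Finite B r₂.L) (h₁ : Module.Finite B r₁.L)
    (h₀ : Module.Finite B r₀.L) {d₁' : r₂.L →ₗ[B] r₁.L} {d₀' : r₁.L →ₗ[B] r₀.L}
    {t' : Fin c → (r₂.L →ₗ[B] r₀.L)} (hd₁ : Lifts r₂ r₁ d₁' d₁) (hd₀ : Lifts r₁ r₀ d₀' d₀)
    (ht : ∀ i, Lifts r₂ r₀ (t' i) (t i)) (hdd : ∀ y, d₀' (d₁' y) = ∑ i, x i • t' i y) :
    IsOperator x (LinearMap.lcomp A A d₀) (LinearMap.lcomp A A d₁) fun i =>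
      LinearMap.lcomp A A (t i) := by
  obtain ⟨q₂, e₂, he₂⟩ := exists_dual_reduction hs hk r₂ h₂
  obtain ⟨q₁, e₁, he₁⟩ := exists_dual_reduction hs hk r₁ h₁
  obtain ⟨q₀, e₀, he₀⟩ := exists_dual_reduction hs hk r₀ h₀
  -- The transposed differentials compose in the opposite order, so their composite is the transpose
  -- of `d₀' d₁'` and the transposed `t' i` appear without sign.
  refine ⟨q₀, q₁, q₂, e₁.toLinearMap ∘ₗ LinearMap.lcomp B B d₀' ∘ₗ e₀.symm.toLinearMap,
    e₂.toLinearMap ∘ₗ LinearMap.lcomp B B d₁' ∘ₗ e₁.symm.toLinearMap,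
    fun i => e₂.toLinearMap ∘ₗ LinearMap.lcomp B B (t' i) ∘ₗ e₀.symm.toLinearMap,
    fun φ => ?_, fun φ => ?_, fun i φ => ?_, fun φ => ?_⟩
  · obtain ⟨φ, rfl⟩ := e₀.surjective φ
    ext y
    obtain ⟨y, rfl⟩ := r₁.surjective y
    simp [he₁, ← hd₀ y, he₀]
  · obtain ⟨φ, rfl⟩ := e₁.surjective φ
    ext y
    obtain ⟨y, rfl⟩ := r₂.surjective y
    simp [he₂, ← hd₁ y, he₁]
  · obtain ⟨φ, rfl⟩ := e₀.surjective φ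
    ext y
    obtain ⟨y, rfl⟩ := r₂.surjective y
    simp [he₂, ← ht i y, he₀]
  · obtain ⟨φ, rfl⟩ := e₀.surjective φ
    simp only [LinearMap.comp_apply, LinearEquiv.coe_coe, LinearEquiv.symm_apply_apply, ← map_smul,
      ← map_sum]
    congr 1
    ext y
    simp [hdd]

end

/-! ### Operators on complete resolutions -/

section

variable {B A : Type u} [CommRing B] [CommRing A] [Algebra B A] {c : ℕ} {x : Fin c → B}
  (hs : Function.Surjective (algebraMap B A))
  (hk : RingHom.ker (algebraMap B A) = Ideal.span (Set.range x))
  (hx : RingTheory.Sequence.IsRegular B (List.ofFn x))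
include hs hk hx

/-- Every complex of finitely generated free modules has chain maps of degree `2` which are
operators in every degree, and so are their transposes. -/
lemma exists_operator_cocycle (C : CochainComplex (ModuleCat.{u} A) ℤ)
    (hfree : ∀ p, Module.Free A (C.X p)) (hfin : ∀ p, Module.Finite A (C.X p)) :
    ∃ f : Fin c → Cocycle C C ((2 : ℕ) : ℤ), ∀ (p q s : ℤ) (hpq : p + 1 = q) (hqs : q + 1 = s),
      IsOperator x (C.d p q).hom (C.d q s).hom
        (fun i => ((f i).1.v p s (by omega)).hom) ∧
      IsOperator x (dualMap (C.d q s)).hom (dualMap (C.d p q)).hom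
        (fun i => (dualMap ((f i).1.v p s (by omega))).hom) := by
  choose r hr using fun p => exists_reduction hs hk (C.X p)
  -- Differentials are lifted between every pair of degrees, consecutive or not, which avoids
  -- transport along equalities of degrees.
  choose d hd using fun p q => exists_lifts (r p) (r q) (C.d p q).hom
  choose t ht using fun p q s => exists_eq_sum_smul (r p) (r s) (g' := d q s ∘ₗ d p q) fun y => by
    simp only [LinearMap.comp_apply, LinearMap.zero_apply, hd _ _ _]
    exact d_d_apply C p q s _
  choose T hT using fun p q s i => exists_lifts_of_linear hs (r p) (r s) (t p q s i)
  have hcomm (p q s u : ℤ) (i : Fin c) (y : C.X p) :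
      T q s u i ((C.d p q).hom y) = (C.d s u).hom (T p q s i y) := by
    obtain ⟨y, rfl⟩ := (r p).surjective y
    have := proj_eq_zero_of_sum_eq_zero hx (r u)
      (fun i => t q s u i (d p q y) - d s u (t p q s i y)) (by
        have h1 := ht q s u (d p q y)
        have h2 := congrArg (d s u) (ht p q s y)
        simp only [LinearMap.comp_apply, map_sum, map_smul] at h1 h2
        simp only [smul_sub, Finset.sum_sub_distrib, ← h1, ← h2, sub_self]) i
    rw [map_sub, sub_eq_zero, hT _ _ _ _ _, hd _ _ _, hd _ _ _, hT _ _ _ _ _] at this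
    exact this
  refine ⟨fun i => Cocycle.mk (Cochain.mk fun p q _ => ModuleCat.ofHom (T p (p + 1) q i)) 3 rfl ?_,
    ?_⟩
  · ext p q hpq : 1
    obtain rfl : q = p + 1 + 1 + 1 := by omega
    rw [δ_v ((2 : ℕ) : ℤ) 3 rfl _ p _ hpq (p + 1 + 1) (p + 1) (by omega) (by omega), Cochain.zero_v]
    have h3 : (3 : ℤ).negOnePow = -1 := by decide
    simp only [Cochain.mk_v, h3, Units.neg_smul, one_smul]
    rw [add_neg_eq_zero]
    ext y
    exact (hcomm _ _ _ _ _ _).symm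
  · rintro p q s rfl rfl
    exact ⟨⟨r _, r _, r _, d _ _, d _ _, t p (p + 1) (p + 1 + 1), hd _ _, hd _ _, hT _ _ _, ht _ _ _⟩,
      isOperator_dual hs hk (r _) (r _) (r _) (hr _) (hr _) (hr _) (hd _ _) (hd _ _) (hT _ _ _)
        (ht _ _ _)⟩

/-- On every complete resolution of `M` there is a chain map of degree `2` in the class of the
operator, whose transpose is in the class of the operator of `M^*`. -/
theorem CompleteResolution.exists_operator {M : ModuleCat.{u} A} (R : CompleteResolution M)
    (P : ProjectiveResolution M) (E : Lifting x P.complex) (P' : ProjectiveResolution (dual M))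
    (E' : Lifting x P'.complex) (i : Fin c) : ∃ f : Cocycle R.C R.C ((2 : ℕ) : ℤ),
      R.left.cls f = operator hx P E i ∧ R.right.cls (dualCocycle f) = operator hx P' E' i := by
  obtain ⟨f, hf⟩ := exists_operator_cocycle hs hk hx R.C R.free R.finite
  -- Degrees `-2, -1, 0` of `C^*` are degrees `3, 2, 1` of `C`.
  exact ⟨f i, (operator_eq_extMk hs hx P R.left.resolution E (hf (-2) (-1) 0 rfl rfl).1 i _).symm,
    (operator_eq_extMk hs hx P' R.right.resolution E' (hf 1 2 3 rfl rfl).2 i _).symm⟩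

end

/-! ### The class of a chain map -/

section

variable {A : Type u} [CommRing A] {M : ModuleCat.{u} A}

/-- The composition of two chain maps of arbitrary degrees. -/
def cocycleComp {K : CochainComplex (ModuleCat.{u} A) ℤ} {n m l : ℤ} (f : Cocycle K K n)
    (g : Cocycle K K m) (h : n + m = l) : Cocycle K K l :=
  Cocycle.mk (f.1.comp g.1 h) (l + 1) rfl (by
    rw [δ_comp f.1 g.1 h (n + 1) (m + 1) (l + 1) rfl rfl rfl, f.δ_eq_zero, g.δ_eq_zero]
    simp)

lemma dualCocycle_comp {K : CochainComplex (ModuleCat.{u} A) ℤ} {n m l : ℤ} (f : Cocycle K K n)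
    (g : Cocycle K K m) (h : n + m = l) :
    dualCocycle (cocycleComp f g h) =
      cocycleComp (dualCocycle g) (dualCocycle f) ((add_comm m n).trans h) := by
  ext p q hpq : 2
  have h1 := Cochain.comp_v (dualCocycle g).1 (dualCocycle f).1 ((add_comm m n).trans h) p (p + m) q
    rfl (by omega)
  have h2 := Cochain.comp_v f.1 g.1 h (1 - q) (1 - (p + m)) (1 - p) (by omega) (by omega)
  exact (congrArg dualMap h2).trans h1.symm

lemma dualCocycle_add {K : CochainComplex (ModuleCat.{u} A) ℤ} {n : ℤ} (f g : Cocycle K K n) :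
    dualCocycle (f + g) = dualCocycle f + dualCocycle g := by
  ext p q hpq : 2
  exact dualMap_add _ _

lemma dualCocycle_smul {K : CochainComplex (ModuleCat.{u} A) ℤ} {n : ℤ} (a : A)
    (f : Cocycle K K n) : dualCocycle (a • f) = a • dualCocycle f := by
  ext p q hpq : 2
  exact ModuleCat.hom_ext (LinearMap.ext fun g => LinearMap.ext fun y =>
    map_smul (show _ →ₗ[A] A from g) a _)

lemma extMk_congr {N : ModuleCat.{u} A} (P : ProjectiveResolution M) {n m : ℕ} {hm : n + 1 = m}
    (f g : P.complex.X n ⟶ N) (h : f = g) (hf : P.complex.d m n ≫ f = 0)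
    (hg : P.complex.d m n ≫ g = 0) : P.extMk f m hm hf = P.extMk g m hm hg := by
  subst h
  rfl

/-- The augmentation represents the identity. -/
lemma extMk_π (P : ProjectiveResolution M) (h : P.complex.d 1 0 ≫ (P.π.f 0 : _ ⟶ M) = 0) :
    P.extMk (P.π.f 0 : _ ⟶ M) 1 rfl h = Ext.mk₀ (𝟙 M) := by
  -- The identity chain map shows that the class of `π` is a left unit for classes of degree zero.
  -- Applied to a representative of the identity, this proves the claim.
  have key (g : P.complex.X 0 ⟶ M) (hg : P.complex.d 1 0 ≫ g = 0) :
      (P.extMk (P.π.f 0 : _ ⟶ M) 1 rfl h).comp (P.extMk g 1 rfl hg) (zero_add 0) =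
        P.extMk g 1 rfl hg :=
    (congrArg (fun u : Ext M M 0 => u.comp (P.extMk g 1 rfl hg) (zero_add 0))
      (extMk_congr P _ _ (Category.id_comp _) (by
        rw [Category.id_comp]
        exact h) h)).symm.trans
    ((extMk_comp_extMk P P (n := 0) (m := 0) (fun k l h => (P.complex.XIsoOfEq h).hom)
      (by decide) (fun k l h => by obtain rfl : l = k := h; simp) g hg
      ((congrArg (P.complex.d 1 0 ≫ ·) (Category.id_comp _)).trans h)
      (by simpa using hg)).trans (extMk_congr P _ _ (Category.id_comp _) _ _))
  obtain ⟨g, hg, hg'⟩ := P.extMk_surjective (Ext.mk₀ (𝟙 M)) 1 rfl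
  have h1 := key g hg
  rw [hg'] at h1
  exact (Ext.comp_mk₀_id _).symm.trans h1

namespace Augmentation

variable {K : CochainComplex (ModuleCat.{u} A) ℤ} (a : Augmentation K M)

lemma d_comp_v_comp_ε {n : ℕ} (f : Cocycle K K n) :
    a.resolution.complex.d (n + 1) n ≫ (f.1.v (-(n : ℤ)) 0 (by omega) ≫ a.ε : _ ⟶ M) = 0 := by
  have h := Cochain.congr_v (f.δ_eq_zero ((n : ℤ) + 1)) (-((n + 1 : ℕ) : ℤ)) 0 (by omega)
  rw [δ_v (n : ℤ) (n + 1) rfl f.1 (-((n + 1 : ℕ) : ℤ)) 0 (by omega) (-1) (-(n : ℤ))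
    (by omega) (by omega), Cochain.zero_v] at h
  have h0 : K.d (-1) 0 ≫ a.ε = 0 := by
    ext z
    exact (a.ker _).2 ⟨z, rfl⟩
  have h1 := congrArg (((n : ℤ) + 1).negOnePow • · ≫ a.ε) h
  simp only [Preadditive.add_comp, Category.assoc, h0, smul_smul, Linear.units_smul_comp,
    Int.units_mul_self, one_smul, Limits.comp_zero, smul_zero, zero_add, Limits.zero_comp] at h1
  exact h1

lemma cls_eq {n : ℕ} (f : Cocycle K K n) (g : a.resolution.complex.X n ⟶ M)
    (h : f.1.v (-(n : ℤ)) 0 (by omega) ≫ a.ε = g) :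
    a.cls f = a.resolution.extMk g (n + 1) rfl
      ((congrArg (a.resolution.complex.d (n + 1) n ≫ ·) h).symm.trans (a.d_comp_v_comp_ε f)) := by
  subst h
  rfl

lemma cls_add {n : ℕ} (f g : Cocycle K K n) : a.cls (f + g) = a.cls f + a.cls g :=
  (a.cls_eq (f + g) _ (Preadditive.add_comp _ _ _ _ _ _)).trans
    (a.resolution.add_extMk _ _ _ _ (a.d_comp_v_comp_ε f) (a.d_comp_v_comp_ε g)).symm

lemma cls_smul {n : ℕ} (r : A) (f : Cocycle K K n) : a.cls (r • f) = r • a.cls f := by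
  rw [Ext.smul_eq_comp_mk₀]
  refine Eq.trans (a.cls_eq (r • f) _ ?_) (a.resolution.extMk_comp_mk₀ _ _ _
    (a.d_comp_v_comp_ε f) (r • 𝟙 M)).symm
  change (r • f.1.v _ _ _) ≫ _ = (f.1.v _ _ _ ≫ _) ≫ _
  simp

lemma cls_one (f : Cocycle K K ((0 : ℕ) : ℤ)) (h : f.1.v 0 0 (by simp) = 𝟙 _) :
    a.cls f = Ext.mk₀ (𝟙 M) :=
  (a.cls_eq f a.ε (by
    change f.1.v 0 0 _ ≫ a.ε = _
    rw [h]
    exact Category.id_comp _)).trans (extMk_π a.resolution _)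

lemma cls_comp {n m l : ℕ} (hn : Even n) (h : n + m = l) (f : Cocycle K K n) (g : Cocycle K K m) :
    (a.cls f).comp (a.cls g) h = a.cls (cocycleComp f g (by exact_mod_cast h)) := by
  subst h
  have hsign : ((n : ℤ) + 1).negOnePow = -1 := by
    rw [Int.negOnePow_succ, Int.negOnePow_even _ (by exact_mod_cast hn)]
  refine Eq.trans ?_ (a.cls_eq (cocycleComp f g (by simp))
    (f.1.v (-((n + m : ℕ) : ℤ)) (-(m : ℤ)) (by push_cast; omega) ≫
        (g.1.v (-(m : ℤ)) 0 (by omega) ≫ a.ε)) ?_).symm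
  · refine extMk_comp_extMk a.resolution a.resolution
      (fun k j h => f.1.v (-(j : ℤ)) (-(k : ℤ)) (by omega))
      hn (fun k j h => ?_) _ (a.d_comp_v_comp_ε g) (a.d_comp_v_comp_ε f) _
    have h := Cochain.congr_v (f.δ_eq_zero ((n : ℤ) + 1)) (-((j + 1 : ℕ) : ℤ)) (-(k : ℤ)) (by omega)
    rw [δ_v (n : ℤ) (n + 1) rfl f.1 (-((j + 1 : ℕ) : ℤ)) (-(k : ℤ)) (by omega) (-((k + 1 : ℕ) : ℤ))
      (-(j : ℤ)) (by omega) (by omega), Cochain.zero_v, hsign, Units.neg_smul, one_smul,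
      add_neg_eq_zero] at h
    exact h.symm
  · have hfg := Cochain.comp_v f.1 g.1 (show (n : ℤ) + m = ((n + m : ℕ) : ℤ) by simp)
      (-((n + m : ℕ) : ℤ)) (-(m : ℤ)) 0 (by push_cast; omega) (by omega)
    exact (congrArg (· ≫ a.ε) hfg).trans (Category.assoc _ _ _)

end Augmentation

end

/-! ### The class of the transposed chain map depends only on the class of the chain map -/

section

variable {A : Type u} [CommRing A] {M : ModuleCat.{u} A}

lemma exists_dual_factor_hom {K : CochainComplex (ModuleCat.{u} A) ℤ}
    (hK : ∀ p, (dualComplex K).ExactAt p) {a b c : ℤ} (hab : a + 1 = b) (hbc : b + 1 = c)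
    {F : ModuleCat.{u} A} [Module.Free A F] [Module.Finite A F] (f : K.X b ⟶ F)
    (hf : K.d a b ≫ f = 0) : ∃ g : K.X c ⟶ F, K.d b c ≫ g = f := by
  obtain ⟨n, ⟨e⟩⟩ := exists_equiv_fin A F
  choose g hg using fun m : Fin n => exists_dual_factor hK hab hbc
    (LinearMap.proj m ∘ₗ e.toLinearMap ∘ₗ f.hom) fun y => by
      have h : f.hom ((K.d a b).hom y) = 0 := congrArg (fun f => f.hom y) hf
      simp [h]
  refine ⟨ModuleCat.ofHom (e.symm.toLinearMap ∘ₗ LinearMap.pi g), ?_⟩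
  ext y
  apply e.injective
  ext m
  simpa using hg m y

/-- In degree zero there are no coboundaries: the class is the endomorphism of `M` induced by `f`.
-/
lemma Augmentation.comp_ε_eq_zero {K : CochainComplex (ModuleCat.{u} A) ℤ} (a : Augmentation K M)
    (f : Cocycle K K ((0 : ℕ) : ℤ)) (h : a.cls f = 0) : f.1.v 0 0 (by simp) ≫ a.ε = 0 := by
  have hd : a.resolution.complex.d 1 0 ≫ (f.1.v 0 0 (by simp) ≫ a.ε : _ ⟶ M) = 0 :=
    a.d_comp_v_comp_ε f
  obtain ⟨g, hg⟩ := exists_factor_linear a.ε.hom a.surjective (f.1.v 0 0 (by simp) ≫ a.ε).hom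
    fun y hy => by
      obtain ⟨z, rfl⟩ := (a.ker y).1 hy
      exact congrArg (fun f => f.hom z) hd
  have hg' : a.ε ≫ ModuleCat.ofHom g = f.1.v 0 0 (by simp) ≫ a.ε := by
    ext y
    exact hg y
  have h1 : a.cls f = Ext.mk₀ (ModuleCat.ofHom g) := by
    have hε : a.resolution.complex.d 1 0 ≫ (a.ε : a.resolution.complex.X 0 ⟶ M) = 0 := by
      ext z
      exact (a.ker _).2 ⟨z, rfl⟩
    have hπ : a.resolution.extMk (a.ε : a.resolution.complex.X 0 ⟶ M) 1 rfl hε = Ext.mk₀ (𝟙 M) :=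
      extMk_π a.resolution hε
    have h2 := a.resolution.extMk_comp_mk₀ (a.ε : a.resolution.complex.X 0 ⟶ M) 1 rfl hε
      (ModuleCat.ofHom g)
    rw [hπ, Ext.mk₀_id_comp] at h2
    exact (a.cls_eq f (a.ε ≫ ModuleCat.ofHom g : a.resolution.complex.X 0 ⟶ M) hg'.symm).trans h2.symm
  rw [h1, Ext.mk₀_eq_zero_iff] at h
  rw [← hg', h, Limits.comp_zero]

/-- The cocycle of `f` is `d` followed by a map to `M`, which lifts through `ε` by projectivity.
This starts the induction of `exists_ι_comp`. -/
lemma Augmentation.exists_comp_ε_eq {K : CochainComplex (ModuleCat.{u} A) ℤ} (a : Augmentation K M)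
    {n : ℕ} (f : Cocycle K K n) (h : a.cls f = 0) :
    ∃ s : K.X (-(n : ℤ) + 1) ⟶ K.X 0,
      f.1.v (-(n : ℤ)) 0 (by omega) ≫ a.ε = K.d (-(n : ℤ)) (-(n : ℤ) + 1) ≫ s ≫ a.ε := by
  obtain _ | n := n
  · exact ⟨0, by simpa using a.comp_ε_eq_zero f h⟩
  · obtain ⟨g, hg⟩ := (a.resolution.extMk_eq_zero_iff _ _ _ (a.d_comp_v_comp_ε f) n rfl).1 h
    obtain ⟨e, he⟩ : ∃ e : K.X (-((n + 1 : ℕ) : ℤ) + 1) ⟶ M,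
        f.1.v (-((n + 1 : ℕ) : ℤ)) 0 (by omega) ≫ a.ε =
          K.d (-((n + 1 : ℕ) : ℤ)) (-((n + 1 : ℕ) : ℤ) + 1) ≫ e := by
      have h1 : -((n + 1 : ℕ) : ℤ) + 1 = -(n : ℤ) := by push_cast; ring
      rw [h1]
      exact ⟨g, hg.symm⟩
    have := a.projective (-((n + 1 : ℕ) : ℤ) + 1)
    have : Epi a.ε := (ModuleCat.epi_iff_surjective _).2 a.surjective
    exact ⟨Projective.factorThru e a.ε, by rw [he, Projective.factorThru_comp]⟩

namespace CompleteResolution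

variable (R : CompleteResolution M)

lemma v_comp_d {n : ℤ} (f : Cocycle R.C R.C n) (p q p' q' : ℤ) (h : p + n = q) (h' : p' + n = q')
    (hp : p + 1 = p') :
    f.1.v p q h ≫ R.C.d q q' = n.negOnePow • (R.C.d p p' ≫ f.1.v p' q' h') := by
  have h := Cochain.congr_v (f.δ_eq_zero (n + 1)) p q' (by omega)
  rw [δ_v n (n + 1) rfl f.1 p q' (by omega) q p' (by omega) (by omega), Cochain.zero_v,
    Int.negOnePow_succ, Units.neg_smul, add_neg_eq_zero] at h
  exact h

/-- Pushes a partial nullhomotopy one degree to the right. Up to sign, `f - s ≫ d` kills the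
incoming differential, so by exactness of `C^*` it factors through the outgoing one; the term in `s`
disappears after composing with `d`. -/
lemma exists_step {n : ℤ} (f : Cocycle R.C R.C n) {p p' p'' q q' q'' : ℤ} (h : p + n = q)
    (hp : p + 1 = p') (hp' : p' + 1 = p'') (hq : q + 1 = q')
    (hs : ∃ s : R.C.X p' ⟶ R.C.X q,
      f.1.v p q h ≫ R.C.d q q' = R.C.d p p' ≫ s ≫ R.C.d q q') :
    ∃ s : R.C.X p'' ⟶ R.C.X q',
      f.1.v p' q' (by omega) ≫ R.C.d q' q'' = R.C.d p' p'' ≫ s ≫ R.C.d q' q'' := by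
  obtain ⟨s, hs⟩ := hs
  have := R.free q'
  have := R.finite q'
  have hf := R.v_comp_d f p q p' q' h (by omega) hp
  obtain ⟨s', hs'⟩ := exists_dual_factor_hom R.dual_exact hp hp'
    (f.1.v p' q' (by omega) - n.negOnePow • (s ≫ R.C.d q q')) (by
      rw [Preadditive.comp_sub, Linear.comp_units_smul, ← hs, hf, smul_smul, Int.units_mul_self,
        one_smul, sub_self])
  refine ⟨s', ?_⟩
  rw [← Category.assoc, hs', Preadditive.sub_comp, Linear.units_smul_comp, Category.assoc,
    R.C.d_comp_d, Limits.comp_zero, smul_zero, sub_zero]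

/-- A chain map of trivial class is, up to sign, `d ∘ s` on cycles in degree one. -/
lemma exists_ι_comp {n : ℕ} (f : Cocycle R.C R.C n) (h : R.left.cls f = 0) (a b : ℤ) (ha : a = n)
    (hb : 1 + (n : ℤ) = b) :
    ∃ s : R.C.X 1 ⟶ R.C.X a, R.ι ≫ f.1.v 1 b hb = R.ι ≫ s ≫ R.C.d a b := by
  subst ha hb
  have key (k : ℕ) : ∀ (p p' q q' : ℤ) (hpq : p + n = q) (_ : p + 1 = p') (_ : q = k)
      (_ : q + 1 = q'), ∃ s : R.C.X p' ⟶ R.C.X q,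
        f.1.v p q hpq ≫ R.C.d q q' = R.C.d p p' ≫ s ≫ R.C.d q q' := by
    induction k with
    | zero =>
      rintro p p' q q' hpq rfl hq rfl
      obtain rfl : p = -n := by push_cast at hq; omega
      obtain rfl : q = 0 := hq
      obtain ⟨s, hs⟩ := R.left.exists_comp_ε_eq f h
      have h1 := congrArg (· ≫ R.ι) hs
      have h2 : R.left.ε ≫ R.ι = R.C.d 0 (0 + 1) := R.fac
      simp only [Category.assoc, h2] at h1
      exact ⟨s, h1⟩
    | succ k ih =>
      intro p p' q q' hpq hp hq hq'
      exact R.exists_step f (p := p - 1) (q := q - 1) (by omega) (by omega) hp (by omega)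
        (ih _ _ _ _ (by omega) (by omega) (by omega) (by omega))
  -- Degree `0` of `C` is reached here, where `d = ε ≫ ι`; cancelling `ε` gives the statement on
  -- `M`.
  obtain ⟨s, hs⟩ := key n 0 1 n (1 + n) (by omega) (by omega) rfl (by omega)
  refine ⟨(n : ℤ).negOnePow • s, ?_⟩
  have : Epi R.ε := (ModuleCat.epi_iff_surjective _).2 R.surjective
  rw [← cancel_epi R.ε, ← Category.assoc, ← Category.assoc, R.fac]
  have h1 := R.v_comp_d f 0 n 1 (1 + n) (by omega) rfl (by omega)
  rw [hs] at h1
  have h2 := congrArg ((n : ℤ).negOnePow • ·) h1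
  simp only [smul_smul, Int.units_mul_self, one_smul] at h2
  rw [← h2, Linear.units_smul_comp, Linear.comp_units_smul]

/-- Makes dualization well defined on classes. The cocycle of the transpose is the dual of `M → C¹ →
C^{1+n}`, and writing this map as `ι ≫ s ≫ d` exhibits the dual as a coboundary. For `n = 0` the map
itself must vanish. -/
theorem right_cls_dualCocycle_eq_zero {n : ℕ} (f : Cocycle R.C R.C n) (h : R.left.cls f = 0) :
    R.right.cls (dualCocycle f) = 0 := by
  obtain _ | n := n
  · refine (R.right.cls_eq (dualCocycle f) 0 ?_).trans (ProjectiveResolution.extMk_zero _ _ _)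
    have h0 : f.1.v 0 0 (by simp) ≫ R.ε = 0 := R.left.comp_ε_eq_zero f h
    have h1 := R.v_comp_d f 0 0 1 1 (by simp) (by simp) rfl
    have : Epi R.ε := (ModuleCat.epi_iff_surjective _).2 R.surjective
    have h2 : R.ι ≫ f.1.v 1 1 (by simp) = 0 := by
      rw [← cancel_epi R.ε, ← Category.assoc, R.fac, Limits.comp_zero]
      rw [← R.fac, ← Category.assoc, h0, Limits.zero_comp, R.fac] at h1
      simpa using h1.symm
    exact (congrArg dualMap h2).trans dualMap_zero
  · obtain ⟨s, hs⟩ := R.exists_ι_comp f h (1 - -(n : ℤ)) (1 - -((n + 1 : ℕ) : ℤ))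
      (by push_cast; ring) (by push_cast; ring)
    exact (R.right.resolution.extMk_eq_zero_iff _ _ _ (R.right.d_comp_v_comp_ε (dualCocycle f)) n
      rfl).2 ⟨dualMap (R.ι ≫ s), (congrArg dualMap (hs.trans (Category.assoc _ _ _).symm)).symm⟩

end CompleteResolution

end

/-! ### Compatibility of the action with dualization -/

section

variable {A : Type u} [CommRing A] {M : ModuleCat.{u} A}

namespace CompleteResolution

variable (R : CompleteResolution M)

/-- The classes `θ` and `θ'` are represented by a chain map on `R` and its transpose. -/
def AreDual {n : ℕ} (θ : Ext M M n) (θ' : Ext (dual M) (dual M) n) : Prop :=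
  ∃ f : Cocycle R.C R.C n, R.left.cls f = θ ∧ R.right.cls (dualCocycle f) = θ'

variable {R}

lemma AreDual.add {n : ℕ} {θ η : Ext M M n} {θ' η' : Ext (dual M) (dual M) n}
    (h : R.AreDual θ θ') (h' : R.AreDual η η') : R.AreDual (θ + η) (θ' + η') := by
  obtain ⟨f, rfl, rfl⟩ := h
  obtain ⟨g, rfl, rfl⟩ := h'
  exact ⟨f + g, R.left.cls_add f g, by rw [dualCocycle_add, R.right.cls_add]⟩

lemma AreDual.smul {n : ℕ} {θ : Ext M M n} {θ' : Ext (dual M) (dual M) n} (a : A)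
    (h : R.AreDual θ θ') : R.AreDual (a • θ) (a • θ') := by
  obtain ⟨f, rfl, rfl⟩ := h
  exact ⟨a • f, R.left.cls_smul a f, by rw [dualCocycle_smul, R.right.cls_smul]⟩

lemma AreDual.comp {n m l : ℕ} {θ : Ext M M n} {η : Ext M M m} {θ' : Ext (dual M) (dual M) n}
    {η' : Ext (dual M) (dual M) m} (hn : Even n) (hm : Even m) (h : R.AreDual θ θ')
    (h' : R.AreDual η η') (hl : n + m = l) :
    R.AreDual (θ.comp η hl) (η'.comp θ' ((add_comm m n).trans hl)) := by
  obtain ⟨f, rfl, rfl⟩ := h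
  obtain ⟨g, rfl, rfl⟩ := h'
  refine ⟨cocycleComp f g (by exact_mod_cast hl), (R.left.cls_comp hn hl f g).symm, ?_⟩
  rw [dualCocycle_comp]
  exact (R.right.cls_comp hm _ _ _).symm

variable (R)

lemma areDual_one : R.AreDual (Ext.mk₀ (𝟙 M)) (Ext.mk₀ (𝟙 (dual M))) := by
  let f : Cocycle R.C R.C ((0 : ℕ) : ℤ) := Cocycle.ofHom (𝟙 R.C)
  refine ⟨f, R.left.cls_one f ?_, R.right.cls_one _ ?_⟩
  · exact (Cochain.ofHom_v (𝟙 R.C) 0).trans rfl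
  · exact congrArg dualMap ((Cochain.ofHom_v (𝟙 R.C) 1).trans rfl)

lemma areDual_zero (n : ℕ) : R.AreDual (0 : Ext M M n) 0 := by
  have h : R.left.cls (0 : Cocycle R.C R.C n) = 0 := by
    simpa using R.left.cls_add (0 : Cocycle R.C R.C n) 0
  exact ⟨0, h, R.right_cls_dualCocycle_eq_zero 0 h⟩

variable {R}

lemma AreDual.sum {ι : Type*} (s : Finset ι) {n : ℕ} {θ : ι → Ext M M n}
    {θ' : ι → Ext (dual M) (dual M) n} (h : ∀ i ∈ s, R.AreDual (θ i) (θ' i)) :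
    R.AreDual (∑ i ∈ s, θ i) (∑ i ∈ s, θ' i) := by
  classical
  induction s using Finset.induction_on with
  | empty => simpa using R.areDual_zero n
  | insert i s hi ih =>
    rw [Finset.sum_insert hi, Finset.sum_insert hi]
    exact (h i (Finset.mem_insert_self _ _)).add (ih fun j hj => h j (Finset.mem_insert_of_mem hj))

/-- Two chain maps with the same class differ by one of class zero, whose transpose has class zero.
-/
lemma AreDual.eq {n : ℕ} {θ : Ext M M n} {θ' : Ext (dual M) (dual M) n} (h : R.AreDual θ θ')
    (f : Cocycle R.C R.C n) (hf : R.left.cls f = θ) : R.right.cls (dualCocycle f) = θ' := by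
  obtain ⟨g, hg, rfl⟩ := h
  have h1 : R.left.cls (f + (-1 : A) • g) = 0 := by
    rw [R.left.cls_add, R.left.cls_smul, hf, hg]
    simp
  have h2 := R.right_cls_dualCocycle_eq_zero _ h1
  rw [dualCocycle_add, dualCocycle_smul, R.right.cls_add, R.right.cls_smul] at h2
  rwa [neg_one_smul, ← sub_eq_add_neg, sub_eq_zero] at h2

end CompleteResolution

lemma word_comp {c : ℕ} {N : ModuleCat.{u} A} (e : Fin c → Ext N N 2)
    (he : ∀ i j, (e i).comp (e j) (show 2 + 2 = 4 from rfl) =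
      (e j).comp (e i) (show 2 + 2 = 4 from rfl)) (i : Fin c) (w : List (Fin c)) {l : ℕ}
    (h : 2 * w.length + 2 = l) :
    (word e w).comp (e i) h = (e i).comp (word e w) ((add_comm _ _).trans h) := by
  induction w generalizing l with
  | nil =>
    obtain rfl : l = 2 := by simpa using h.symm
    exact (Ext.mk₀_id_comp _).trans (Ext.comp_mk₀_id _).symm
  | cons j w ih =>
    rw [word, Ext.comp_assoc _ _ _ _ (show 2 * w.length + 2 = l - 2 by simp at h; omega)
        (by simp at h; omega), ih,
      ← Ext.comp_assoc (e j) (e i) (word e w) rfl _ (by simp at h; omega), he,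
      Ext.comp_assoc (e i) (e j) (word e w) rfl _ (by simp at h; omega)]

namespace CompleteResolution

variable {R : CompleteResolution M} {c : ℕ} {e : Fin c → Ext M M 2}
  {e' : Fin c → Ext (dual M) (dual M) 2} (h : ∀ i, R.AreDual (e i) (e' i))
  (he : ∀ i j, (e' i).comp (e' j) (show 2 + 2 = 4 from rfl) =
      (e' j).comp (e' i) (show 2 + 2 = 4 from rfl))
include h he

/-- Transposition reverses a word; commutation of the operators on `M^*` restores the order. -/
lemma areDual_word (w : List (Fin c)) : R.AreDual (word e w) (word e' w) := by
  induction w with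
  | nil => exact R.areDual_one
  | cons i w ih =>
    have h1 := (h i).comp (by decide) (by simp) ih (l := 2 * (i :: w).length)
      (by simp only [List.length_cons]; ring)
    rw [word_comp e' he] at h1
    exact h1

lemma areDual_polyAction (η : MvPolynomial (Fin c) A) (n : ℕ) :
    R.AreDual (polyAction e η n) (polyAction e' η n) := by
  unfold polyAction
  rw [DFinsupp.finsetSum_apply, DFinsupp.finsetSum_apply]
  refine AreDual.sum _ fun α _ => ?_
  have hα := (areDual_word h he ((List.finRange c).flatMap fun i => List.replicate (α i) i)).smul
    (η.coeff α)
  generalize η.coeff α • word e ((List.finRange c).flatMap fun i => List.replicate (α i) i) = θ at *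
  generalize η.coeff α • word e' ((List.finRange c).flatMap fun i => List.replicate (α i) i) = θ' at *
  by_cases hn : 2 * ((List.finRange c).flatMap fun i => List.replicate (α i) i).length = n
  · subst hn
    rw [DirectSum.of_eq_same, DirectSum.of_eq_same]
    exact hα
  · rw [DirectSum.of_eq_of_ne _ _ _ (Ne.symm hn), DirectSum.of_eq_of_ne _ _ _ (Ne.symm hn)]
    exact R.areDual_zero n

end CompleteResolution

end

lemma ofList_ofFn {B : Type u} [CommRing B] {c : ℕ} (x : Fin c → B) :
    Ideal.ofList (List.ofFn x) = Ideal.span (Set.range x) :=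
  congrArg Ideal.span (Set.ext fun r => by simp [List.mem_ofFn])

end CohOp

theorem lemma4p1 {B A : Type u} [CommRing B] [IsLocalRing B] [IsNoetherianRing B]
    [CommRing A] [IsLocalRing A] [Algebra B A] {c : ℕ} (x : Fin c → B)
    (hx : RingTheory.Sequence.IsRegular B (List.ofFn x))
    (hxm : ∀ i, x i ∈ IsLocalRing.maximalIdeal B)
    (hsurj : Function.Surjective (algebraMap B A))
    (hker : RingHom.ker (algebraMap B A) = Ideal.span (Set.range x))
    (M : ModuleCat.{u} A) [Module.Finite A M]
    (hdepth : CohOp.depth A M = CohOp.depth A A)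
    (hpd : projectiveDimension ((ModuleCat.restrictScalars (algebraMap B A)).obj M) < ⊤)
    (P : ProjectiveResolution M) (E : CohOp.Lifting x P.complex)
    (P' : ProjectiveResolution (CohOp.dual M)) (E' : CohOp.Lifting x P'.complex) :
    CohOp.CommutesWithDualization (CohOp.phi hx P E) (CohOp.phi hx P' E') := by
  have : IsNoetherianRing A := isNoetherianRing_of_surjective B A (algebraMap B A) hsurj
  obtain ⟨g, hg⟩ := CohOp.exists_gdimLE (algebraMap B A) hsurj (List.ofFn x) hx.toIsWeaklyRegular
    (hker.trans (CohOp.ofList_ofFn x).symm) M hpd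
  have hM := CohOp.TotRefl.of_depth hg hdepth
  obtain ⟨R₀⟩ := hM.nonempty_completeResolution
  -- Proved on every complete resolution: `R₀` supplies a representative, and an arbitrary `R` is
  -- needed for independence of the choice.
  have hdual (R : CohOp.CompleteResolution M) (η : MvPolynomial (Fin c) A) (n : ℕ) :
      R.AreDual (CohOp.phi hx P E η n) (CohOp.phi hx P' E' η n) :=
    CohOp.CompleteResolution.areDual_polyAction
      (fun i => R.exists_operator hsurj hker hx P E P' E' i)
      (CohOp.operator_comp_operator hsurj hx P' E') η n
  refine ⟨R₀.gDimZero, fun η n => ⟨?_, fun R f hf => (hdual R η n).eq f hf⟩⟩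
  obtain ⟨f, hf, -⟩ := hdual R₀ η n
  exact ⟨R₀, f, hf⟩
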